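/- Let $\gamma(x)=e^{-|x|^2/2}$ for $x\in\mathbb R^2$ and $dm_\gamma=\gamma\,dx$. For an open set $\Omega\subset\mathbb R^2$ let $L^2_\gamma(\Omega)=L^2(\Omega,dm_\gamma)$ (real-valued functions), and let $$H^1_\gamma(\Omega)=\{u\in L^2_\gamma(\Omega)\ :\ \nabla u\in L^2_\gamma(\Omega;\mathbb R^2)\},\qquad \|u\|_{H^1_\gamma(\Omega)}=\Big(\int_\Omega u^2\,dm_\gamma+\int_\Omega|\nabla u|^2\,dm_\gamma\Big)^{1/2},$$ where $\nabla u$ is the weak (distributional) gradient of $u$ in $\Omega$. Let $\Omega\subset\mathbb R^2$ be a convex domain (a convex open set, possibly unbounded). Then: 1. There is a constant $C=C(\Omega)>0$, depending only on $\Omega$, such that for every $u\in H^1_\gamma(\Omega)$ there is $\tilde u\in H^1_\gamma(\mathbb R^2)$ with $\tilde u=u$ almost everywhere in $\Omega$ and $$\|\tilde u\|_{H^1_\gamma(\mathbb R^2)}\le C\,\|u\|_{H^1_\gamma(\Omega)}.$$ 2. The embedding $H^1_\gamma(\Omega)\hookrightarrow L^2_\gamma(\Omega)$, $u\mapsto u$,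 is compact. -/

import Mathlib

open MeasureTheory Set
open scoped ContDiff ENNReal

noncomputable section

/-- The Euclidean plane. -/
abbrev Plane : Type := EuclideanSpace ℝ (Fin 2)

/-- The standard (unnormalised) Gaussian weight `γ(x) = exp(-|x|²/2)` on the plane. -/
def gaussWeight (x : Plane) : ℝ := Real.exp (-‖x‖ ^ 2 / 2)

/-- The Gaussian measure `dm_γ = γ dx`. -/
def gaussMeas : Measure Plane :=
  volume.withDensity (fun x => ENNReal.ofReal (gaussWeight x))

/-- The weighted space `L²_γ(Ω) = L²(Ω, dm_γ)` of real functions. -/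
abbrev L2Gauss (Ω : Set Plane) : Type := Lp ℝ 2 (gaussMeas.restrict Ω)

/-- The weighted space `L²_γ(Ω; ℝ²)` of vector fields. -/
abbrev L2GaussVec (Ω : Set Plane) : Type := Lp Plane 2 (gaussMeas.restrict Ω)

/-- `g` is the weak (distributional) gradient of `u` in `Ω`:
`∫_Ω u ∂ᵢφ dx = - ∫_Ω gᵢ φ dx` for every test function `φ ∈ C_c^∞(Ω)` and `i = 1, 2`.
The integrals are with respect to Lebesgue measure. The notion is used only for `u ∈ L²_γ(Ω)` and
`g ∈ L²_γ(Ω; ℝ²)`, for which both integrands are integrable. -/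
def IsWeakGradient (Ω : Set Plane) (u : Plane → ℝ) (g : Plane → Plane) : Prop :=
  ∀ φ : Plane → ℝ, ContDiff ℝ ∞ φ → HasCompactSupport φ → tsupport φ ⊆ Ω → ∀ i : Fin 2,
    ∫ x in Ω, u x * fderiv ℝ φ x (EuclideanSpace.single i 1) = - ∫ x in Ω, g x i * φ x

lemma gaussWeight_pos (x : Plane) : 0 < gaussWeight x := Real.exp_pos _

lemma continuous_gaussWeight : Continuous gaussWeight := by
  unfold gaussWeight; fun_prop

lemma measurable_ofReal_gaussWeight :
    Measurable (fun x => ENNReal.ofReal (gaussWeight x)) :=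
  continuous_gaussWeight.measurable.ennreal_ofReal

lemma gaussMeas_restrict (Ω : Set Plane) :
    gaussMeas.restrict Ω =
      (volume.restrict Ω).withDensity (fun x => ENNReal.ofReal (gaussWeight x)) :=
  restrict_withDensity' _ _

/-- Lebesgue measure on `Ω` and the Gaussian measure on `Ω` have the same null sets. -/
lemma volume_restrict_ac_gaussMeas (Ω : Set Plane) :
    volume.restrict Ω ≪ gaussMeas.restrict Ω := by
  rw [gaussMeas_restrict]
  refine withDensity_absolutelyContinuous' measurable_ofReal_gaussWeight.aemeasurable ?_
  exact Filter.Eventually.of_forall fun x => by simp [gaussWeight_pos x]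

lemma integrable_mul_test {Ω : Set Plane} {f : Plane → ℝ}
    (hf : MemLp f 2 (gaussMeas.restrict Ω)) {φ : Plane → ℝ} (hφ : Continuous φ)
    (hc : HasCompactSupport φ) : Integrable (fun x => f x * φ x) (volume.restrict Ω) := by
  have hψ : Continuous (fun x => φ x * (gaussWeight x)⁻¹) :=
    hφ.mul (continuous_gaussWeight.inv₀ fun x => (gaussWeight_pos x).ne')
  have hψc : HasCompactSupport (fun x => φ x * (gaussWeight x)⁻¹) := hc.mul_right
  have : IsLocallyFiniteMeasure (gaussMeas.restrict Ω) := by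
    rw [gaussMeas_restrict]
    exact IsLocallyFiniteMeasure.withDensity_ofReal continuous_gaussWeight
  have hL : MemLp (fun x => φ x * (gaussWeight x)⁻¹) 2 (gaussMeas.restrict Ω) :=
    hψ.memLp_of_hasCompactSupport hψc
  have h := hf.integrable_mul hL
  rw [gaussMeas_restrict, integrable_withDensity_iff_integrable_smul'
    measurable_ofReal_gaussWeight (Filter.Eventually.of_forall fun x => by simp)] at h
  refine h.congr (Filter.Eventually.of_forall fun x => ?_)
  have := (gaussWeight_pos x).ne'
  simp only [ENNReal.toReal_ofReal (gaussWeight_pos x).le, smul_eq_mul, Pi.mul_apply]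
  field_simp

lemma continuous_fderiv_test {φ : Plane → ℝ} (hφ : ContDiff ℝ ∞ φ) (v : Plane) :
    Continuous (fun x => fderiv ℝ φ x v) :=
  (hφ.continuous_fderiv (by simp)).clm_apply continuous_const

lemma memLp_coord {Ω : Set Plane} (g : L2GaussVec Ω) (i : Fin 2) :
    MemLp (fun x => g x i) 2 (gaussMeas.restrict Ω) :=
  (EuclideanSpace.proj i : Plane →L[ℝ] ℝ).comp_memLp' (Lp.memLp g)

/-- The weighted Sobolev space `H¹_γ(Ω) = {u ∈ L²_γ(Ω) | ∇u ∈ L²_γ(Ω)}`, realised as the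
space of pairs `(u, ∇u)` in the Hilbert space `L²_γ(Ω) × L²_γ(Ω; ℝ²)`. Its norm is therefore
`√(‖u‖² + ‖∇u‖²)`, see `H1Gauss.norm_eq`; the pair is determined by `u`, see
`H1Gauss.toL2_injective`. -/
def H1Gauss (Ω : Set Plane) : Submodule ℝ (WithLp 2 (L2Gauss Ω × L2GaussVec Ω)) where
  carrier := {U | IsWeakGradient Ω U.fst U.snd}
  zero_mem' := by
    intro φ _ _ _ i
    have h1 := (volume_restrict_ac_gaussMeas Ω).ae_le (Lp.coeFn_zero ℝ 2 (gaussMeas.restrict Ω))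
    have h2 := (volume_restrict_ac_gaussMeas Ω).ae_le
      (Lp.coeFn_zero Plane 2 (gaussMeas.restrict Ω))
    rw [integral_eq_zero_of_ae, integral_eq_zero_of_ae, neg_zero]
    · filter_upwards [h2] with x hx
      simp only [WithLp.zero_snd, hx]; simp
    · filter_upwards [h1] with x hx
      simp only [WithLp.zero_fst, hx]; simp
  add_mem' := by
    intro U V hU hV φ hφ hc hs i
    have h1 := (volume_restrict_ac_gaussMeas Ω).ae_le (Lp.coeFn_add U.fst V.fst)
    have h2 := (volume_restrict_ac_gaussMeas Ω).ae_le (Lp.coeFn_add U.snd V.snd)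
    have hd := continuous_fderiv_test hφ (EuclideanSpace.single i 1)
    have hdc : HasCompactSupport (fun x => fderiv ℝ φ x (EuclideanSpace.single i 1)) :=
      hc.fderiv_apply ℝ _
    have e1 : ∫ x in Ω, (U + V).fst x * fderiv ℝ φ x (EuclideanSpace.single i 1) =
        ∫ x in Ω, (U.fst x * fderiv ℝ φ x (EuclideanSpace.single i 1) +
          V.fst x * fderiv ℝ φ x (EuclideanSpace.single i 1)) := by
      refine integral_congr_ae ?_
      filter_upwards [h1] with x hx
      simp only [WithLp.add_fst, hx, Pi.add_apply, add_mul]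
    have e2 : ∫ x in Ω, (U + V).snd x i * φ x =
        ∫ x in Ω, (U.snd x i * φ x + V.snd x i * φ x) := by
      refine integral_congr_ae ?_
      filter_upwards [h2] with x hx
      simp only [WithLp.add_snd, hx, Pi.add_apply, PiLp.add_apply, add_mul]
    rw [e1, e2, integral_add (integrable_mul_test (Lp.memLp _) hd hdc)
      (integrable_mul_test (Lp.memLp _) hd hdc),
      integral_add (integrable_mul_test (memLp_coord _ i) hφ.continuous hc)
      (integrable_mul_test (memLp_coord _ i) hφ.continuous hc),
      hU φ hφ hc hs i, hV φ hφ hc hs i, neg_add]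
  smul_mem' := by
    intro c U hU φ hφ hc hs i
    have h1 := (volume_restrict_ac_gaussMeas Ω).ae_le (Lp.coeFn_smul c U.fst)
    have h2 := (volume_restrict_ac_gaussMeas Ω).ae_le (Lp.coeFn_smul c U.snd)
    have e1 : ∫ x in Ω, (c • U).fst x * fderiv ℝ φ x (EuclideanSpace.single i 1) =
        ∫ x in Ω, c * (U.fst x * fderiv ℝ φ x (EuclideanSpace.single i 1)) := by
      refine integral_congr_ae ?_
      filter_upwards [h1] with x hx
      simp only [WithLp.smul_fst, hx, Pi.smul_apply, smul_eq_mul, mul_assoc]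
    have e2 : ∫ x in Ω, (c • U).snd x i * φ x = ∫ x in Ω, c * (U.snd x i * φ x) := by
      refine integral_congr_ae ?_
      filter_upwards [h2] with x hx
      simp only [WithLp.smul_snd, hx, Pi.smul_apply, PiLp.smul_apply, smul_eq_mul, mul_assoc]
    rw [e1, e2, integral_const_mul, integral_const_mul, hU φ hφ hc hs i, mul_neg]

/-- The embedding `H¹_γ(Ω) → L²_γ(Ω)`, `u ↦ u`, as a continuous linear map. -/
def H1Gauss.toL2 (Ω : Set Plane) : H1Gauss Ω →L[ℝ] L2Gauss Ω :=
  (WithLp.fstL 2 ℝ (L2Gauss Ω) (L2GaussVec Ω)).comp (H1Gauss Ω).subtypeL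

/-- The weak gradient `H¹_γ(Ω) → L²_γ(Ω; ℝ²)`, `u ↦ ∇u`. -/
def H1Gauss.grad (Ω : Set Plane) : H1Gauss Ω →L[ℝ] L2GaussVec Ω :=
  (WithLp.sndL 2 ℝ (L2Gauss Ω) (L2GaussVec Ω)).comp (H1Gauss Ω).subtypeL

lemma H1Gauss.isWeakGradient {Ω : Set Plane} (u : H1Gauss Ω) :
    IsWeakGradient Ω (H1Gauss.toL2 Ω u) (H1Gauss.grad Ω u) := u.2

lemma H1Gauss.norm_eq {Ω : Set Plane} (u : H1Gauss Ω) :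
    ‖u‖ = Real.sqrt (‖H1Gauss.toL2 Ω u‖ ^ 2 + ‖H1Gauss.grad Ω u‖ ^ 2) :=
  WithLp.prod_norm_eq_of_L2 (u : WithLp 2 (L2Gauss Ω × L2GaussVec Ω))

/-- Every `u ∈ L²_γ(Ω)` with a weak gradient in `L²_γ(Ω; ℝ²)` comes from `H¹_γ(Ω)`. -/
lemma H1Gauss.exists_of_isWeakGradient {Ω : Set Plane} (u : L2Gauss Ω) (g : L2GaussVec Ω)
    (h : IsWeakGradient Ω u g) :
    ∃ U : H1Gauss Ω, H1Gauss.toL2 Ω U = u ∧ H1Gauss.grad Ω U = g :=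
  ⟨⟨WithLp.toLp 2 (u, g), h⟩, rfl, rfl⟩

/-- Weak gradients are unique: an element of `H¹_γ(Ω)` is determined by the function `u`. -/
lemma H1Gauss.toL2_injective {Ω : Set Plane} (hΩ : IsOpen Ω) :
    Function.Injective (H1Gauss.toL2 Ω) := by
  rw [injective_iff_map_eq_zero]
  intro U hU
  suffices hg : H1Gauss.grad Ω U = 0 by
    have : ‖U‖ = 0 := by rw [H1Gauss.norm_eq, hU, hg]; simp
    simpa using this
  have hcoord : ∀ i : Fin 2, ∀ᵐ x ∂(volume : Measure Plane), x ∈ Ω → H1Gauss.grad Ω U x i = 0 := by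
    intro i
    refine hΩ.ae_eq_zero_of_integral_contDiff_smul_eq_zero ?_ ?_
    · rw [locallyIntegrableOn_iff hΩ.isLocallyClosed]
      intro K hKΩ hK
      obtain ⟨φ, h1, -, hc, -⟩ := exists_continuous_one_zero_of_isCompact hK isClosed_empty
        (disjoint_empty K)
      have h := (integrable_mul_test (memLp_coord (H1Gauss.grad Ω U) i) φ.continuous hc)
      have h' : IntegrableOn (fun x => H1Gauss.grad Ω U x i * φ x) K volume :=
        IntegrableOn.mono_set h hKΩ
      refine h'.congr_fun (fun x hx => ?_) hK.measurableSet
      simp [h1 hx]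
    · intro φ hφ hc hs
      have h := H1Gauss.isWeakGradient U φ hφ hc hs i
      rw [integral_eq_zero_of_ae (μ := volume.restrict Ω)
        (f := fun x => H1Gauss.toL2 Ω U x * _)] at h
      · rw [← setIntegral_eq_integral_of_forall_compl_eq_zero (s := Ω)]
        · simpa [mul_comm] using h.symm
        · intro x hx
          rw [image_eq_zero_of_notMem_tsupport fun hx' => hx (hs hx'), zero_smul]
      · have h0 := (volume_restrict_ac_gaussMeas Ω).ae_le
          (Lp.coeFn_zero ℝ 2 (gaussMeas.restrict Ω))
        filter_upwards [h0] with x hx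
        rw [hU, hx]; simp
  rw [Lp.eq_zero_iff_ae_eq_zero]
  have hac : gaussMeas.restrict Ω ≪ volume.restrict Ω := by
    rw [gaussMeas_restrict]; exact withDensity_absolutelyContinuous _ _
  refine hac.ae_le ((ae_restrict_iff' hΩ.measurableSet).2 ?_)
  filter_upwards [hcoord 0, hcoord 1] with x h0 h1 hx
  ext i
  fin_cases i
  · exact h0 hx
  · exact h1 hx

end

noncomputable section

open Filter Topology Metric

/-! Two facts carry both parts. The first is a moment bound. Since `Ω` is star-shaped about any `a ∈
Ω`, the integral over `Ω` of `div ((x - a) f²γ)` is nonnegative. Expanding the divergence gives `∫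
|x|² f² γ ≤ C ∫ (f² + |∇f|²) γ` (`integral_divergence_nonneg`,
`lintegral_norm_sq_mul_le_gaussEnergy`). The second is the density in `H¹_γ(Ω)` of test functions of
the whole plane (`dense_smoothSubgroup`): contract towards an interior point, mollify, cut off. All
estimates are then proved for smooth `f` only.

Compactness: averaging over the cells of a fine grid in a large square is a finite rank operator.
Its error on `H¹_γ(Ω)` is small inside the square by a Poincaré inequality on the convex sets cell
`∩ Ω`, and outside by the moment bound (`gridAverage_error`). The embedding is thus a norm limit of
compact operators.

Extension: reflecting `f` itself fails, because `γ` is not comparable at two points a bounded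
distance apart far from the origin. Instead one extends `w = f γ^{1/2}`, for which the moment bound
controls `∫ (1 + |x|²) w² + |∇w|²`, and multiplies the extension `W` by `γ^{-1/2}`; the resulting
energy is `∫ W² + |∇W + W y / 2|²`. Only polynomial weights remain, and these tolerate bounded
displacements.

The reflection averages `w` over a disc of radius `c d(y)` about `T y`, where `d` is the distance to
`Ω` and the Lipschitz map `T` pushes `y` to a depth proportional to `d(y)` (`InwardMap`). Since `T`
need not be bi-Lipschitz, the averaging replaces a change of variables: the points `y` that sample a
given `z` all have comparable distances to `Ω`, which bounds the kernel
(`InwardMap.lintegral_kernel_le`). Such a `T` exists for unbounded `Ω` because every point of a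
planar convex set with interior lies within bounded distance of an inner disc of fixed radius
(`exists_uniform_inner_balls`). The passage from the dense subgroup to all of `H¹_γ(Ω)` uses
completeness of `H¹_γ(ℝ²)` and `controlled_closure_of_complete`. -/

/-! ### Convex geometry: projections, recession directions, inward maps -/

/-- The nearest point projection onto a nonempty closed convex set is `1`-Lipschitz. -/
lemma exists_lipschitz_nearestPoint {E : Type*} [NormedAddCommGroup E] [InnerProductSpace ℝ E]
    [CompleteSpace E] {K : Set E} (hne : K.Nonempty) (hK : IsClosed K) (hc : Convex ℝ K) :
    ∃ P : E → E, LipschitzWith 1 P ∧ ∀ x, P x ∈ K ∧ dist x (P x) = infDist x K := by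
  choose P hP hmin using fun x => exists_norm_eq_iInf_of_complete_convex hne hK.isComplete hc x
  have hvar : ∀ x, ∀ w ∈ K, inner ℝ (x - P x) (w - P x) ≤ 0 := fun x =>
    (norm_eq_iInf_iff_real_inner_le_zero hc (hP x)).1 (hmin x)
  refine ⟨P, LipschitzWith.of_dist_le_mul fun x y => ?_, fun x => ⟨hP x, ?_⟩⟩
  · have h1 := hvar x _ (hP y)
    have h2 := hvar y _ (hP x)
    -- Adding the two variational inequalities shows that `P` is firmly nonexpansive; Cauchy–Schwarz
    -- then gives the Lipschitz bound.
    have h3 : ‖P x - P y‖ ^ 2 ≤ inner ℝ (x - y) (P x - P y) := by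
      rw [← real_inner_self_eq_norm_sq]
      have e : inner ℝ (x - y) (P x - P y) - inner ℝ (P x - P y) (P x - P y) =
          -(inner ℝ (x - P x) (P y - P x) + inner ℝ (y - P y) (P x - P y)) := by
        simp only [inner_sub_left, inner_sub_right]; ring
      linarith
    have h4 := real_inner_le_norm (x - y) (P x - P y)
    rw [dist_eq_norm, dist_eq_norm, NNReal.coe_one, one_mul]
    by_contra! h
    nlinarith [norm_nonneg (x - y), norm_nonneg (P x - P y)]
  · have : Nonempty K := hne.to_subtype
    rw [infDist_eq_iInf, dist_eq_norm, hmin x]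
    simp only [dist_eq_norm]

/-- The limit of the directions of a sequence going to infinity in a closed convex set is a
recession direction. -/
lemma Convex.add_smul_mem_of_tendsto {E : Type*} [NormedAddCommGroup E] [NormedSpace ℝ E]
    {S : Set E} (hc : Convex ℝ S) (hS : IsClosed S) {z : ℕ → E} {a e : E} (hz : ∀ n, z n ∈ S)
    (hinf : Tendsto (fun n => ‖z n - a‖) atTop atTop)
    (he : Tendsto (fun n => ‖z n - a‖⁻¹ • (z n - a)) atTop (𝓝 e)) {x : E} (hx : x ∈ S) {t : ℝ}
    (ht : 0 ≤ t) : x + t • e ∈ S := by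
  have h0 : Tendsto (fun n => t * ‖z n - a‖⁻¹) atTop (𝓝 0) := by
    simpa using (tendsto_inv_atTop_zero.comp hinf).const_mul t
  -- The point `x + t e` is the limit of convex combinations of `x` and `z n` whose weight on `z n`,
  -- namely `t / ‖z n - a‖`, tends to zero.
  have hlim : Tendsto (fun n => (1 - t * ‖z n - a‖⁻¹) • x + (t * ‖z n - a‖⁻¹) • z n) atTop
      (𝓝 (x + t • e)) := by
    have h1 : Tendsto (fun n => (x + t • (‖z n - a‖⁻¹ • (z n - a))) +
        (t * ‖z n - a‖⁻¹) • (a - x)) atTop (𝓝 ((x + t • e) + (0 : ℝ) • (a - x))) :=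
      ((he.const_smul t).const_add x).add (h0.smul_const _)
    simp only [zero_smul, add_zero] at h1
    refine h1.congr fun n => ?_
    module
  refine hS.mem_of_tendsto hlim ?_
  filter_upwards [h0.eventually (gt_mem_nhds one_pos)] with n hn
  exact hc hx (hz n) (by linarith) (by positivity) (by ring)

/-- Write `z = a + α e + β f` in an orthonormal frame with `α, β ≥ 0`. If `β ≤ r`, slide the disc
about `a` along `e` until it is level with `z`. If `β > r`, the segment from `z` to `a + α e`, swept
along `e`, covers a half-strip of width `r` starting at `z`, and a disc of radius `r / 2` fits into
it near `z`. Having only one direction orthogonal to `e` is what makes this work. -/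
lemma exists_ball_near_of_recession {S : Set Plane} (hc : Convex ℝ S) {a e z : Plane} {r : ℝ}
    (hr : 0 < r) (hball : closedBall a r ⊆ S) (he : ‖e‖ = 1)
    (hrec : ∀ x ∈ S, ∀ t : ℝ, 0 ≤ t → x + t • e ∈ S) (hz : z ∈ S)
    (hze : 0 ≤ inner ℝ (z - a) e) :
    ∃ x, dist x z ≤ r ∧ closedBall x (r / 2) ⊆ S := by
  obtain ⟨f, β, hβ, hf, hef, hdec, hspan⟩ : ∃ (f : Plane) (β : ℝ), 0 ≤ β ∧ ‖f‖ = 1 ∧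
      inner ℝ e f = 0 ∧ z - a = (inner ℝ (z - a) e : ℝ) • e + β • f ∧
      ∀ p : Plane, p = (inner ℝ p e : ℝ) • e + (inner ℝ p f : ℝ) • f := by
    -- The sign `s = ±1` selects the quarter turn of `e` for which the coordinate `β` of `z - a` is
    -- nonnegative.
    have hJ : ∀ s : ℝ, s ^ 2 = 1 → ∀ J : Plane, J = !₂[-(s * e 1), s * e 0] → ‖J‖ = 1 ∧
        inner ℝ e J = 0 ∧ ∀ p : Plane, p = (inner ℝ p e : ℝ) • e + (inner ℝ p J : ℝ) • J := by
      rintro s hs J rfl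
      have he2 : e 0 ^ 2 + e 1 ^ 2 = 1 := by
        have := EuclideanSpace.real_norm_sq_eq e
        rw [he, Fin.sum_univ_two] at this; linarith
      refine ⟨?_, ?_, fun p => ?_⟩
      · rw [← sq_eq_sq₀ (norm_nonneg _) zero_le_one, EuclideanSpace.real_norm_sq_eq,
          Fin.sum_univ_two]
        simp; linear_combination (e 1 ^ 2 + e 0 ^ 2) * hs + he2
      · simp [PiLp.inner_apply, Fin.sum_univ_two]; ring
      · ext i
        fin_cases i
        · simp [PiLp.inner_apply, Fin.sum_univ_two]
          linear_combination -(p 0) * he2 + (-p 0 * e 1 ^ 2 + p 1 * e 0 * e 1) * hs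
        · simp [PiLp.inner_apply, Fin.sum_univ_two]
          linear_combination -(p 1) * he2 + (-p 1 * e 0 ^ 2 + p 0 * e 0 * e 1) * hs
    by_cases hs : 0 ≤ (inner ℝ (z - a) (!₂[-(1 * e 1), 1 * e 0] : Plane) : ℝ)
    · obtain ⟨h1, h2, h3⟩ := hJ 1 (by norm_num) _ rfl
      exact ⟨_, _, hs, h1, h2, h3 _, h3⟩
    · obtain ⟨h1, h2, h3⟩ := hJ (-1) (by norm_num) _ rfl
      refine ⟨_, _, ?_, h1, h2, h3 _, h3⟩
      push Not at hs
      simp [PiLp.inner_apply, Fin.sum_univ_two] at hs ⊢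
      linarith
  set α : ℝ := inner ℝ (z - a) e with hα
  have hzeq : z = a + α • e + β • f := by rw [add_assoc, ← hdec]; abel
  have haα : a + α • e ∈ S := hrec a (hball (mem_closedBall_self hr.le)) α hze
  rcases le_or_gt β r with hβr | hβr
  · refine ⟨a + α • e, ?_, fun y hy => ?_⟩
    · rw [dist_eq_norm, hzeq]
      have : a + α • e - (a + α • e + β • f) = -(β • f) := by abel
      rw [this, norm_neg, norm_smul, hf, mul_one, Real.norm_of_nonneg hβ]; exact hβr
    · have h := hrec (y - α • e) (hball ?_) α hze
      · simpa using h
      · rw [mem_closedBall, dist_eq_norm] at hy ⊢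
        have : y - α • e - a = y - (a + α • e) := by abel
        rw [this]; linarith
  -- The half-strip: first move from `z` towards `a + α e` by the fraction `q / β`, then along `e`
  -- by `s`.
  · have hmem : ∀ s q : ℝ, 0 ≤ s → 0 ≤ q → q ≤ r → z + s • e - q • f ∈ S := by
      intro s q hs hq hqr
      have hβ0 : 0 < β := hr.trans hβr
      have h1 : (1 - q / β) • z + (q / β) • (a + α • e) ∈ S :=
        hc hz haα (by rw [sub_nonneg, div_le_one hβ0]; linarith) (by positivity) (by ring)
      have h2 := hrec _ h1 s hs
      convert h2 using 1
      have : a + α • e = z - β • f := by rw [hzeq]; abel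
      rw [this]
      have : (q / β) • (z - β • f) = (q / β) • z - q • f := by
        rw [smul_sub, smul_smul, div_mul_cancel₀ _ hβ0.ne']
      rw [this]; module
    refine ⟨z + (r / 2) • e - (r / 2) • f, ?_, fun y hy => ?_⟩
    · rw [dist_eq_norm]
      have : z + (r / 2) • e - (r / 2) • f - z = (r / 2) • e - (r / 2) • f := by abel
      rw [this]
      refine (norm_sub_le _ _).trans ?_
      rw [norm_smul, norm_smul, he, hf, Real.norm_of_nonneg (by positivity)]; linarith
    · set p := y - (z + (r / 2) • e - (r / 2) • f) with hp
      have hpn : ‖p‖ ≤ r / 2 := by rwa [mem_closedBall, dist_eq_norm] at hy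
      have h1 := abs_le.1 ((abs_real_inner_le_norm p e).trans
        (show ‖p‖ * ‖e‖ ≤ r / 2 by rwa [he, mul_one]))
      have h2 := abs_le.1 ((abs_real_inner_le_norm p f).trans
        (show ‖p‖ * ‖f‖ ≤ r / 2 by rwa [hf, mul_one]))
      have h3 := hmem (r / 2 + inner ℝ p e) (r / 2 - inner ℝ p f) (by linarith) (by linarith)
        (by linarith)
      convert h3 using 1
      have : y = p + (z + (r / 2) • e - (r / 2) • f) := by rw [hp]; abel
      rw [this]
      nth_rewrite 1 [hspan p]
      module

/-- Every point of a planar convex set is within bounded distance of a ball of fixed radius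
contained in the closure of the set. -/
lemma exists_uniform_inner_balls {S : Set Plane} (hc : Convex ℝ S) (hS : IsClosed S) {a : Plane}
    {r : ℝ} (hr : 0 < r) (hball : closedBall a r ⊆ S) :
    ∃ M : ℝ, ∀ z ∈ S, ∃ x, dist x z ≤ M ∧ closedBall x (r / 2) ⊆ S := by
  by_contra! hcon
  choose z hzS hz using fun n : ℕ => hcon n
  have hsub : closedBall a (r / 2) ⊆ S := (closedBall_subset_closedBall (by linarith)).trans hball
  have hfar : ∀ n : ℕ, (n : ℝ) < ‖z n - a‖ := fun n => by
    by_contra! h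
    exact hz n a (by rwa [dist_comm, dist_eq_norm]) hsub
  have hpos : ∀ n, 0 < ‖z n - a‖ := fun n => (Nat.cast_nonneg n).trans_lt (hfar n)
  -- Points with no inner disc nearby must escape to infinity. A limit of their directions is a
  -- recession direction, and along it a disc exists within distance `r`, which contradicts the
  -- choice of `z (φ n)` once `φ n ≥ r`.
  obtain ⟨e, he, φ, hφ, hlim⟩ := (isCompact_sphere (0 : Plane) 1).tendsto_subseq
    (x := fun n => ‖z n - a‖⁻¹ • (z n - a)) (fun n => by
      rw [mem_sphere_zero_iff_norm, norm_smul, norm_inv, norm_norm, inv_mul_cancel₀ (hpos n).ne'])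
  rw [mem_sphere_zero_iff_norm] at he
  have hinf : Tendsto (fun n => ‖z (φ n) - a‖) atTop atTop :=
    tendsto_atTop_mono (fun n => (hfar (φ n)).le)
      (tendsto_natCast_atTop_atTop.comp hφ.tendsto_atTop)
  have hrec : ∀ x ∈ S, ∀ t : ℝ, 0 ≤ t → x + t • e ∈ S := fun x hx t ht =>
    hc.add_smul_mem_of_tendsto hS (z := fun n => z (φ n)) (fun n => hzS _) hinf hlim hx ht
  have hin : Tendsto (fun n => inner ℝ (‖z (φ n) - a‖⁻¹ • (z (φ n) - a)) e) atTop
      (𝓝 (inner ℝ e e : ℝ)) := hlim.inner tendsto_const_nhds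
  rw [real_inner_self_eq_norm_sq, he] at hin
  have hev1 := hin.eventually (lt_mem_nhds (show (0 : ℝ) < 1 ^ 2 by norm_num))
  have hev2 := (tendsto_natCast_atTop_atTop (R := ℝ)).comp hφ.tendsto_atTop
    |>.eventually_ge_atTop r
  obtain ⟨n, h1, h2⟩ := (hev1.and hev2).exists
  rw [real_inner_smul_left] at h1
  have h3 : 0 ≤ inner ℝ (z (φ n) - a) e := (pos_of_mul_pos_right h1 (by positivity)).le
  obtain ⟨x, hx1, hx2⟩ := exists_ball_near_of_recession hc hr hball he hrec (hzS _) h3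
  exact hz (φ n) x (hx1.trans h2) hx2

/-- A Lipschitz map `q` pushing the points near a planar convex open set `Ω` into its closure, at
a depth proportional to their distance from `Ω`. -/
structure InwardMap (Ω : Set Plane) where
  toFun : Plane → Plane
  lip : NNReal
  c : ℝ
  M : ℝ
  c_pos : 0 < c
  M_nonneg : 0 ≤ M
  lipschitz : LipschitzWith lip toFun
  eq_self : ∀ y ∈ closure Ω, toFun y = y
  closedBall_subset : ∀ y, closedBall (toFun y) (2 * c * min (infDist y Ω) 1) ⊆ closure Ω
  dist_le : ∀ y, infDist y Ω ≤ 1 → dist (toFun y) y ≤ M * infDist y Ω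

/-- With `P` the projection onto `S = closure Ω`, `A` the projection onto the set `K` of centres of
inner discs of radius `r / 2`, and `t = min d 1`, the map is `P + t (A ∘ P - P)`. A convex
combination of a point of `S` with a disc of radius `r / 2` in `S` contains a disc of radius `t r /
2`, so the depth is proportional to `t`. Uniform inner discs bound `A z - z` by `M` on `S`, hence
also the Lipschitz constant and the displacement. -/
lemma nonempty_inwardMap {Ω : Set Plane} (hΩ : IsOpen Ω) (hconv : Convex ℝ Ω)
    (hne : Ω.Nonempty) : Nonempty (InwardMap Ω) := by
  obtain ⟨a, ha⟩ := hne
  obtain ⟨r, hr, hball⟩ := Metric.nhds_basis_closedBall.mem_iff.1 (hΩ.mem_nhds ha)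
  set S := closure Ω with hSdef
  have hS : IsClosed S := isClosed_closure
  have hc : Convex ℝ S := hconv.closure
  have hballS : closedBall a r ⊆ S := hball.trans subset_closure
  obtain ⟨M, hM⟩ := exists_uniform_inner_balls hc hS hr hballS
  obtain ⟨P, hPl, hP⟩ := exists_lipschitz_nearestPoint (K := S) ⟨a, subset_closure ha⟩ hS hc
  set K : Set Plane := {x | closedBall x (r / 2) ⊆ S} with hK
  have hKmem : ∀ x, x ∈ K ↔ ∀ v : Plane, ‖v‖ ≤ r / 2 → x + v ∈ S := by
    intro x
    refine ⟨fun h v hv => h (by simpa [dist_eq_norm] using hv), fun h y hy => ?_⟩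
    have := h (y - x) (by simpa [dist_eq_norm] using hy)
    simpa using this
  have hKne : K.Nonempty := ⟨a, (closedBall_subset_closedBall (by linarith)).trans hballS⟩
  have hKcl : IsClosed K := by
    have : K = ⋂ (v : Plane) (_ : ‖v‖ ≤ r / 2), (fun x => x + v) ⁻¹' S := by
      ext x; rw [hKmem]; simp
    rw [this]
    exact isClosed_iInter fun v => isClosed_iInter fun _ => hS.preimage (by fun_prop)
  have hKc : Convex ℝ K := by
    intro x hx y hy s t hs ht hst
    rw [hKmem] at hx hy ⊢
    intro v hv
    have : s • x + t • y + v = s • (x + v) + t • (y + v) := by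
      have : v = (s + t) • v := by rw [hst, one_smul]
      nth_rewrite 1 [this]; module
    rw [this]; exact hc (hx v hv) (hy v hv) hs ht hst
  obtain ⟨A, hAl, hA⟩ := exists_lipschitz_nearestPoint hKne hKcl hKc
  have hAM : ∀ z ∈ S, ‖A z - z‖ ≤ M := by
    intro z hz
    obtain ⟨x, hx, hxK⟩ := hM z hz
    rw [← dist_eq_norm, dist_comm, (hA z).2]
    exact (infDist_le_dist_of_mem hxK).trans (by rwa [dist_comm])
  have hM0 : 0 ≤ M := (norm_nonneg _).trans (hAM _ (hP a).1)
  set t : Plane → ℝ := fun y => min (infDist y Ω) 1 with ht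
  have ht0 : ∀ y, 0 ≤ t y := fun y => le_min infDist_nonneg zero_le_one
  have ht1 : ∀ y, t y ≤ 1 := fun y => min_le_right _ _
  have htl : LipschitzWith 1 t := by
    simpa using (lipschitz_infDist_pt Ω).min_const 1
  have hdP : ∀ y, dist y (P y) = infDist y Ω := fun y => by
    rw [(hP y).2, hSdef, infDist_closure]
  -- The choice `c = r / 4` makes `2 c t` equal to the available depth `t r / 2`. The displacement
  -- is at most `d + t M`, whence `1 + M`.
  refine ⟨⟨fun y => P y + t y • (A (P y) - P y), (3 + M).toNNReal, r / 4, 1 + M,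
    by positivity, by positivity, ?_, ?_, ?_, ?_⟩⟩
  · refine LipschitzWith.of_dist_le_mul fun x y => ?_
    have h1 := hPl.dist_le_mul x y
    have h2 := hAl.dist_le_mul (P x) (P y)
    have h3 := htl.dist_le_mul x y
    rw [NNReal.coe_one, one_mul] at h1 h2 h3
    rw [Real.dist_eq] at h3
    rw [dist_eq_norm] at h1 h2
    have h4 := hAM _ (hP y).1
    rw [Real.coe_toNNReal _ (by positivity), dist_eq_norm]
    have e : P x + t x • (A (P x) - P x) - (P y + t y • (A (P y) - P y)) =
        (1 - t x) • (P x - P y) + t x • (A (P x) - A (P y)) +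
          (t x - t y) • (A (P y) - P y) := by module
    rw [e]
    refine (norm_add₃_le).trans ?_
    rw [norm_smul, norm_smul, norm_smul, Real.norm_of_nonneg (ht0 x),
      Real.norm_of_nonneg (show 0 ≤ 1 - t x by linarith [ht1 x]), Real.norm_eq_abs]
    rw [dist_eq_norm (P x)] at h2
    have h5 : (1 - t x) * ‖P x - P y‖ ≤ 1 * dist x y :=
      mul_le_mul (by linarith [ht0 x]) h1 (norm_nonneg _) zero_le_one
    have h6 : t x * ‖A (P x) - A (P y)‖ ≤ 1 * dist x y :=
      mul_le_mul (ht1 x) (h2.trans h1) (norm_nonneg _) zero_le_one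
    have h7 : |t x - t y| * ‖A (P y) - P y‖ ≤ dist x y * M :=
      mul_le_mul h3 h4 (norm_nonneg _) dist_nonneg
    linarith [dist_nonneg (x := x) (y := y)]
  · intro y hy
    have h0 : infDist y Ω = 0 := by rw [← infDist_closure]; exact infDist_zero_of_mem hy
    have h1 : P y = y := by
      have := hdP y; rw [h0] at this; exact (dist_eq_zero.1 this).symm
    simp [ht, h0, h1]
  · intro y x hx
    change x ∈ S
    rw [mem_closedBall, dist_eq_norm] at hx
    rcases (ht0 y).eq_or_lt with h0 | h0
    · have h0' : min (infDist y Ω) 1 = 0 := h0.symm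
      rw [← h0, h0'] at hx
      have : x = P y := by simpa [sub_eq_zero] using hx
      rw [this]; exact (hP y).1
    -- Solve `x = (1 - t) P y + t (A (P y) + v)` for `v`; then `‖v‖ ≤ r / 2` and convexity apply.
    · set v := (t y)⁻¹ • (x - (P y + t y • (A (P y) - P y))) with hv
      have hvn : ‖v‖ ≤ r / 2 := by
        rw [hv, norm_smul, norm_inv, Real.norm_of_nonneg h0.le, inv_mul_le_iff₀ h0]
        refine hx.trans (le_of_eq ?_)
        change 2 * (r / 4) * t y = _
        ring
      have h1 := (hKmem _).1 (hA (P y)).1 v hvn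
      have h2 := hc (hP y).1 h1 (a := 1 - t y) (b := t y) (by linarith [ht1 y]) h0.le (by ring)
      convert h2 using 1
      rw [smul_add, hv, smul_smul, mul_inv_cancel₀ h0.ne']
      module
  · intro y hy
    have hty : t y = infDist y Ω := min_eq_left hy
    rw [dist_eq_norm]
    have e : P y + t y • (A (P y) - P y) - y = (P y - y) + t y • (A (P y) - P y) := by abel
    rw [e]
    refine (norm_add_le _ _).trans ?_
    rw [norm_smul, Real.norm_of_nonneg (ht0 y), ← dist_eq_norm, dist_comm, hdP, hty]
    nlinarith [hAM _ (hP y).1, infDist_nonneg (x := y) (s := Ω)]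

/-! ### Averages over the discs of an inward map -/

lemma lintegral_comp_add_smul (F : Plane → ℝ≥0∞) (b : Plane) {s : ℝ} (hs : 0 < s) :
    ∫⁻ x, F (b + s • x) = ENNReal.ofReal ((s ^ 2)⁻¹) * ∫⁻ x, F x := by
  have h1 : ∫⁻ x, F (b + s • x) = ∫⁻ x, F (b + x) ∂(Measure.map (s • ·) volume) :=
    (lintegral_map_equiv (fun x => F (b + x))
      (Homeomorph.smulOfNeZero s hs.ne').toMeasurableEquiv).symm
  rw [h1, Measure.map_addHaar_smul _ hs.ne', lintegral_smul_measure, finrank_euclideanSpace_fin,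
    abs_of_pos (by positivity), smul_eq_mul, lintegral_add_left_eq_self]

lemma setLIntegral_comp_le_of_mapsTo {Q R : Set Plane} (hQ : MeasurableSet Q)
    (hR : MeasurableSet R)
    (F : Plane → ℝ≥0∞) (b : Plane) {s : ℝ} (hs : 0 < s)
    (hQR : ∀ x ∈ Q, b + s • x ∈ R) :
    ∫⁻ x in Q, F (b + s • x) ≤ ENNReal.ofReal ((s ^ 2)⁻¹) * ∫⁻ x in R, F x := by
  rw [← lintegral_indicator hR, ← lintegral_comp_add_smul _ b hs]
  refine le_trans ?_ (setLIntegral_le_lintegral Q _)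
  refine setLIntegral_mono' hQ fun x hx => ?_
  rw [indicator_of_mem (hQR x hx)]

/-- Jensen's inequality, obtained from the monotonicity of `Lᵖ` norms on a probability space. In
this form it needs no integrability of `g²`. -/
lemma ofReal_sq_integral_le_lintegral {α : Type*} [MeasurableSpace α] (μ : Measure α)
    [IsProbabilityMeasure μ] {g : α → ℝ} (hg : AEStronglyMeasurable g μ) :
    ENNReal.ofReal ((∫ x, g x ∂μ) ^ 2) ≤ ∫⁻ x, ENNReal.ofReal (g x ^ 2) ∂μ := by
  have h1 : ‖∫ x, g x ∂μ‖ₑ ≤ eLpNorm g 2 μ :=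
    (enorm_integral_le_lintegral_enorm g).trans (by
      rw [← eLpNorm_one_eq_lintegral_enorm]
      exact eLpNorm_le_eLpNorm_of_exponent_le (by norm_num) hg)
  have e : ∀ r : ℝ, ENNReal.ofReal (r ^ 2) = ‖r‖ₑ ^ 2 := fun r => by
    rw [← sq_abs, ENNReal.ofReal_pow (abs_nonneg r), ← Real.enorm_eq_ofReal_abs]
  simp only [e]
  calc ‖∫ x, g x ∂μ‖ₑ ^ 2 ≤ eLpNorm g 2 μ ^ 2 := by gcongr
    _ = ∫⁻ x, ‖g x‖ₑ ^ 2 ∂μ := by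
      have := eLpNorm_nnreal_pow_eq_lintegral (f := g) (μ := μ) (p := 2) (by norm_num)
      rw [NNReal.coe_ofNat] at this
      exact_mod_cast this

lemma volume_plane_closedBall (z : Plane) {R : ℝ} (hR : 0 ≤ R) :
    volume (closedBall z R) = ENNReal.ofReal (R ^ 2) * volume (ball (0 : Plane) 1) := by
  rw [Measure.addHaar_closedBall _ _ hR, finrank_euclideanSpace_fin]

namespace InwardMap

variable {Ω : Set Plane} (T : InwardMap Ω)

/-- The disc of twice the radius about `T y` still lies in `closure Ω`, so points of the smaller
disc keep the distance `c d(y)` from everything outside. Applied to two points sampling the same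
`z`, this compares their distances to `Ω`. -/
lemma le_dist {y y' z : Plane} (hy : infDist y Ω ≤ 1)
    (hz : z ∈ ball (T.toFun y) (T.c * infDist y Ω)) (hy' : y' ∉ closure Ω) :
    T.c * infDist y Ω ≤ dist z y' := by
  by_contra! h
  refine hy' (T.closedBall_subset y ?_)
  rw [min_eq_left hy, mem_closedBall]
  rw [mem_ball] at hz
  have := dist_triangle y' z (T.toFun y)
  rw [dist_comm y' z] at this
  linarith

/-- A Schur-type bound. With `L = c + M`, if `y` and `y0` both sample `z` then `c d(y) ≤ |z - y0| ≤
L d(y0)`, and the same holds with the roles exchanged. So all such `y` lie within `L (L / c) d(y0)`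
of `z`, and the kernel is at most `(c (c / L) d(y0))⁻²`; the product of area and kernel is `(L /
c)⁶` times the area of the unit disc, independent of `y0`. -/
lemma lintegral_kernel_le (z : Plane) :
    ∫⁻ y in {y | infDist y Ω ≤ 1} \ closure Ω,
      (ball (T.toFun y) (T.c * infDist y Ω)).indicator
        (fun _ => ENNReal.ofReal (((T.c * infDist y Ω) ^ 2)⁻¹)) z ≤
      (closure Ω).indicator (fun _ => ENNReal.ofReal (((T.c + T.M) / T.c) ^ 6) *
        volume (ball (0 : Plane) 1)) z := by
  have hc := T.c_pos
  have hM := T.M_nonneg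
  have hmeas : MeasurableSet ({y | infDist y Ω ≤ 1} \ closure Ω) :=
    (isClosed_le (continuous_infDist_pt Ω) continuous_const).measurableSet.diff
      isClosed_closure.measurableSet
  by_cases hex : ∃ y0 ∈ {y | infDist y Ω ≤ 1} \ closure Ω,
      z ∈ ball (T.toFun y0) (T.c * infDist y0 Ω)
  · obtain ⟨y0, hy0, hz0⟩ := hex
    have hzS : z ∈ closure Ω := by
      refine T.closedBall_subset y0 (ball_subset_closedBall (ball_subset_ball ?_ hz0))
      rw [min_eq_left hy0.1]
      nlinarith [infDist_nonneg (x := y0) (s := Ω)]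
    rw [indicator_of_mem hzS]
    have hdle : ∀ y, infDist y Ω ≤ 1 → z ∈ ball (T.toFun y) (T.c * infDist y Ω) →
        dist z y ≤ (T.c + T.M) * infDist y Ω := by
      intro y hy hz
      have h1 := T.dist_le y hy
      rw [mem_ball] at hz
      have := dist_triangle z (T.toFun y) y
      linarith
    have hd0 : 0 < infDist y0 Ω := by
      by_contra! h
      have := pos_of_mem_ball hz0
      nlinarith
    set L := T.c + T.M with hL
    have hLpos : 0 < L := by positivity
    set d0 := infDist y0 Ω with hd0def
    calc ∫⁻ y in {y | infDist y Ω ≤ 1} \ closure Ω,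
        (ball (T.toFun y) (T.c * infDist y Ω)).indicator
          (fun _ => ENNReal.ofReal (((T.c * infDist y Ω) ^ 2)⁻¹)) z
        ≤ ∫⁻ y in {y | infDist y Ω ≤ 1} \ closure Ω,
          (closedBall z (L * (L / T.c * d0))).indicator
            (fun _ => ENNReal.ofReal (((T.c * (T.c / L * d0)) ^ 2)⁻¹)) y := by
          refine setLIntegral_mono' hmeas fun y hy => ?_
          by_cases hzy : z ∈ ball (T.toFun y) (T.c * infDist y Ω)
          · have h1 := T.le_dist hy.1 hzy hy0.2
            have h2 := T.le_dist hy0.1 hz0 hy.2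
            have h3 := hdle y hy.1 hzy
            have h4 := hdle y0 hy0.1 hz0
            have h5 : infDist y Ω ≤ L / T.c * d0 := by
              rw [div_mul_eq_mul_div, le_div_iff₀ hc]; linarith
            have h6 : T.c / L * d0 ≤ infDist y Ω := by
              rw [div_mul_eq_mul_div, div_le_iff₀ hLpos]; linarith
            rw [indicator_of_mem hzy, indicator_of_mem]
            · refine ENNReal.ofReal_le_ofReal ?_
              gcongr
            · rw [mem_closedBall, dist_comm]
              exact h3.trans (by gcongr)
          · rw [indicator_of_notMem hzy]; exact zero_le
      _ ≤ ∫⁻ y, (closedBall z (L * (L / T.c * d0))).indicator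
            (fun _ => ENNReal.ofReal (((T.c * (T.c / L * d0)) ^ 2)⁻¹)) y :=
          setLIntegral_le_lintegral _ _
      _ = ENNReal.ofReal ((L / T.c) ^ 6) * volume (ball (0 : Plane) 1) := by
          rw [lintegral_indicator_const isClosed_closedBall.measurableSet,
            volume_plane_closedBall _ (by positivity), ← mul_assoc,
            ← ENNReal.ofReal_mul (by positivity)]
          congr 2
          field_simp
  · push Not at hex
    refine le_of_eq_of_le (setLIntegral_congr_fun hmeas fun y hy => ?_) (le_of_eq_of_le
      lintegral_zero zero_le)
    exact indicator_of_notMem (hex y hy) _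

/-- Averages over the balls attached to an inward map are bounded in `L¹`. -/
lemma lintegral_average_le (hconv : Convex ℝ Ω) (hne : Ω.Nonempty) {f : Plane → ℝ≥0∞} (hf : Measurable f) :
    ∫⁻ y in {y | infDist y Ω ≤ 1}, ∫⁻ θ in ball (0 : Plane) 1,
        f (T.toFun y + (T.c * infDist y Ω) • θ) ≤
      (1 + ENNReal.ofReal (((T.c + T.M) / T.c) ^ 6)) * volume (ball (0 : Plane) 1) *
        ∫⁻ y in Ω, f y := by
  have hc := T.c_pos
  have hS : MeasurableSet (closure Ω) := isClosed_closure.measurableSet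
  have hmeas : MeasurableSet ({y | infDist y Ω ≤ 1} \ closure Ω) :=
    (isClosed_le (continuous_infDist_pt Ω) continuous_const).measurableSet.diff hS
  -- The frontier of a convex set is Lebesgue null.
  have hclosure : ∫⁻ y in closure Ω, f y = ∫⁻ y in Ω, f y := by
    refine setLIntegral_congr ?_
    rw [closure_eq_self_union_frontier]
    exact union_ae_eq_left_of_ae_eq_empty (ae_eq_empty.2 (hconv.addHaar_frontier volume))
  have hin : ∀ y ∈ closure Ω, infDist y Ω = 0 := fun y hy => by
    rw [← infDist_closure]; exact infDist_zero_of_mem hy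
  have hsub : {y | infDist y Ω ≤ 1} ⊆ closure Ω ∪ ({y | infDist y Ω ≤ 1} \ closure Ω) := by
    intro y hy
    by_cases h : y ∈ closure Ω
    · exact Or.inl h
    · exact Or.inr ⟨hy, h⟩
  refine (lintegral_mono_set hsub).trans ((lintegral_union_le _ _ _).trans ?_)
  rw [add_mul, add_mul, one_mul]
  refine add_le_add ?_ ?_
  -- On `closure Ω` the disc degenerates to the point `y` itself, so the inner integral is the area
  -- of the unit disc times `f y`.
  · refine le_of_eq ?_
    rw [← hclosure, ← lintegral_const_mul _ hf]
    refine setLIntegral_congr_fun hS fun y hy => ?_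
    simp only [hin y hy, T.eq_self y hy, mul_zero, zero_smul, add_zero, lintegral_const,
      Measure.restrict_apply_univ]
    rw [mul_comm]
  -- Outside, `d(y) > 0` and the substitution `z = T y + c d(y) θ` produces the kernel; Tonelli's
  -- theorem and the kernel bound finish.
  · have hinner : ∀ y ∈ {y | infDist y Ω ≤ 1} \ closure Ω,
        ∫⁻ θ in ball (0 : Plane) 1, f (T.toFun y + (T.c * infDist y Ω) • θ) ≤
        ∫⁻ z, (ball (T.toFun y) (T.c * infDist y Ω)).indicator
          (fun _ => ENNReal.ofReal (((T.c * infDist y Ω) ^ 2)⁻¹)) z * f z := by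
      intro y hy
      have hd : 0 < infDist y Ω := by
        exact ((isClosed_closure.notMem_iff_infDist_pos hne.closure).1 hy.2).trans_eq
          infDist_closure
      refine (setLIntegral_comp_le_of_mapsTo (R := ball (T.toFun y) (T.c * infDist y Ω))
        isOpen_ball.measurableSet isOpen_ball.measurableSet f _ (by positivity) fun θ hθ => ?_).trans_eq ?_
      · rw [mem_ball_zero_iff] at hθ
        rw [mem_ball, dist_eq_norm, add_sub_cancel_left, norm_smul,
          Real.norm_of_nonneg (by positivity)]
        exact mul_lt_of_lt_one_right (by positivity) hθ
      · rw [← lintegral_indicator isOpen_ball.measurableSet,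
          ← lintegral_const_mul _ (hf.indicator isOpen_ball.measurableSet)]
        refine lintegral_congr fun z => ?_
        by_cases hz : z ∈ ball (T.toFun y) (T.c * infDist y Ω) <;> simp [hz]
    refine (setLIntegral_mono' hmeas hinner).trans ?_
    have hmeasK1 : Measurable (Function.uncurry fun (y z : Plane) =>
        (ball (T.toFun y) (T.c * infDist y Ω)).indicator
          (fun _ => ENNReal.ofReal (((T.c * infDist y Ω) ^ 2)⁻¹)) z) := by
      have hd : Measurable fun p : Plane × Plane => infDist p.1 Ω :=
        ((continuous_infDist_pt Ω).comp continuous_fst).measurable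
      have hU : MeasurableSet {p : Plane × Plane |
          p.2 ∈ ball (T.toFun p.1) (T.c * infDist p.1 Ω)} := by
        simp only [mem_ball]
        refine measurableSet_lt ?_ (hd.const_mul _)
        exact (continuous_snd.dist (T.lipschitz.continuous.comp continuous_fst)).measurable
      exact (((hd.const_mul _).pow_const 2).inv.ennreal_ofReal).indicator hU
    have hmeasK : Measurable (Function.uncurry fun (y z : Plane) =>
        (ball (T.toFun y) (T.c * infDist y Ω)).indicator
          (fun _ => ENNReal.ofReal (((T.c * infDist y Ω) ^ 2)⁻¹)) z * f z) := 
      hmeasK1.mul (hf.comp measurable_snd)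
    rw [lintegral_lintegral_swap hmeasK.aemeasurable, ← hclosure,
      ← lintegral_indicator hS, ← lintegral_const_mul _ (hf.indicator hS)]
    refine lintegral_mono fun z => ?_
    dsimp only
    rw [lintegral_mul_const _ (hmeasK1.of_uncurry_right (y := z))]
    refine (mul_le_mul_left (T.lintegral_kernel_le z) _).trans (le_of_eq ?_)
    by_cases hz : z ∈ closure Ω <;> simp [hz]

end InwardMap

/-! ### Euclidean Poincaré inequality -/

lemma Convex.lintegral_comp_combo_le {Q : Set Plane} (hQ : Convex ℝ Q) (hm : MeasurableSet Q)
    {y : Plane} (hy : y ∈ Q) (F : Plane → ℝ≥0∞) {s t : ℝ} (hs : 0 < s) (ht : 0 ≤ t)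
    (hst : s + t = 1) :
    ∫⁻ x in Q, F (s • x + t • y) ≤ ENNReal.ofReal ((s ^ 2)⁻¹) * ∫⁻ x in Q, F x := by
  simp_rw [add_comm _ (t • y)]
  exact setLIntegral_comp_le_of_mapsTo hm hm F _ hs fun x hx => by
    rw [add_comm]; exact hQ hx hy hs.le ht hst

/-- The fundamental theorem of calculus along the segment, then Jensen for the uniform probability
on `[0, 1]`. -/
lemma ofReal_sq_sub_le_lintegral_segment {f : Plane → ℝ} (hf : ContDiff ℝ 1 f) (x y : Plane) :
    ENNReal.ofReal ((f x - f y) ^ 2) ≤ ENNReal.ofReal (dist x y ^ 2) *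
      ∫⁻ t in Icc (0 : ℝ) 1, ENNReal.ofReal (‖fderiv ℝ f ((1 - t) • x + t • y)‖ ^ 2) := by
  have hcont : Continuous (fderiv ℝ f) := hf.continuous_fderiv one_ne_zero
  have hpath : Continuous fun t : ℝ => (1 - t) • x + t • y := by fun_prop
  have hderiv : ∀ t : ℝ, HasDerivAt (fun t : ℝ => f ((1 - t) • x + t • y))
      (fderiv ℝ f ((1 - t) • x + t • y) (y - x)) t := by
    intro t
    have h1 : HasDerivAt (fun t : ℝ => (1 - t) • x + t • y) (y - x) t := by
      have h2 : HasDerivAt (fun t : ℝ => x + t • (y - x)) ((1 : ℝ) • (y - x)) t :=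
        ((hasDerivAt_id t).smul_const (y - x)).const_add x
      rw [one_smul] at h2
      refine h2.congr_of_eventuallyEq (Eventually.of_forall fun t => ?_)
      module
    exact ((hf.differentiable one_ne_zero _).hasFDerivAt).comp_hasDerivAt t h1
  have hc' : Continuous fun t : ℝ => fderiv ℝ f ((1 - t) • x + t • y) (y - x) :=
    (hcont.comp hpath).clm_apply continuous_const
  have hftc : f y - f x = ∫ t in Icc (0 : ℝ) 1, fderiv ℝ f ((1 - t) • x + t • y) (y - x) := by
    rw [integral_Icc_eq_integral_Ioc, ← intervalIntegral.integral_of_le zero_le_one,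
      intervalIntegral.integral_eq_sub_of_hasDerivAt (fun t _ => hderiv t)
        (hc'.intervalIntegrable _ _)]
    simp
  have : IsProbabilityMeasure (volume.restrict (Icc (0 : ℝ) 1)) := ⟨by simp⟩
  rw [← neg_sub, neg_sq, hftc]
  refine (ofReal_sq_integral_le_lintegral _ hc'.aestronglyMeasurable).trans ?_
  rw [← lintegral_const_mul' _ _ ENNReal.ofReal_ne_top]
  refine lintegral_mono fun t => ?_
  rw [← ENNReal.ofReal_mul (by positivity), ← mul_pow]
  refine ENNReal.ofReal_le_ofReal ?_
  rw [← sq_abs]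
  refine pow_le_pow_left₀ (abs_nonneg _) ?_ 2
  rw [mul_comm, dist_comm, dist_eq_norm]
  exact (fderiv ℝ f _).le_opNorm _

/-- A Poincaré inequality on convex sets. -/
lemma Convex.lintegral_sq_sub_le {Q : Set Plane} (hQ : Convex ℝ Q) (hm : MeasurableSet Q)
    {h : ℝ} (hdiam : ∀ x ∈ Q, ∀ y ∈ Q, dist x y ≤ h) {f : Plane → ℝ} (hf : ContDiff ℝ 1 f) :
    ∫⁻ x in Q, ∫⁻ y in Q, ENNReal.ofReal ((f x - f y) ^ 2) ≤
      ENNReal.ofReal (4 * h ^ 2) * volume Q *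
        ∫⁻ x in Q, ENNReal.ofReal (‖fderiv ℝ f x‖ ^ 2) := by
  set F : Plane → ℝ≥0∞ := fun x => ENNReal.ofReal (‖fderiv ℝ f x‖ ^ 2) with hF
  have hFc : Continuous F := ENNReal.continuous_ofReal.comp
    ((hf.continuous_fderiv one_ne_zero).norm.pow 2)
  -- Integrate first in whichever of `x`, `y` has coefficient at least `1 / 2`. The inverse Jacobian
  -- is then at most `4`, uniformly in `t`, so nothing degenerates at the endpoints.
  have key : ∀ t ∈ Icc (0 : ℝ) 1, ∫⁻ x in Q, ∫⁻ y in Q, F ((1 - t) • x + t • y) ≤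
      4 * volume Q * ∫⁻ x in Q, F x := by
    have hconst : ∀ s : ℝ, 1 / 2 ≤ s → ENNReal.ofReal ((s ^ 2)⁻¹) ≤ 4 := by
      intro s hs
      rw [show (4 : ℝ≥0∞) = ENNReal.ofReal 4 by norm_num]
      refine ENNReal.ofReal_le_ofReal ?_
      rw [inv_le_comm₀ (by positivity) (by norm_num)]
      nlinarith
    have hbound : ∀ s t : ℝ, 1 / 2 ≤ s → 0 ≤ t → s + t = 1 →
        ∫⁻ y in Q, ∫⁻ x in Q, F (s • x + t • y) ≤ 4 * volume Q * ∫⁻ x in Q, F x := by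
      intro s t hs ht hst
      calc ∫⁻ y in Q, ∫⁻ x in Q, F (s • x + t • y) ≤ ∫⁻ y in Q, 4 * ∫⁻ x in Q, F x := by
            refine setLIntegral_mono' hm fun y hy => ?_
            refine (hQ.lintegral_comp_combo_le hm hy F (by linarith) ht hst).trans ?_
            gcongr
            exact hconst s hs
        _ = 4 * volume Q * ∫⁻ x in Q, F x := by
            rw [lintegral_const, Measure.restrict_apply_univ]; ring
    intro t ht
    rcases le_total t (1 / 2) with h1 | h1
    · rw [lintegral_lintegral_swap (f := fun x y => F ((1 - t) • x + t • y))
        (hFc.comp (f := fun p : Plane × Plane => (1 - t) • p.1 + t • p.2)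
          (by fun_prop)).measurable.aemeasurable]
      exact hbound (1 - t) t (by linarith) ht.1 (by ring)
    · simp_rw [add_comm ((1 - t) • _)]
      exact hbound t (1 - t) h1 (by linarith [ht.2]) (by ring)
  calc ∫⁻ x in Q, ∫⁻ y in Q, ENNReal.ofReal ((f x - f y) ^ 2)
      ≤ ∫⁻ x in Q, ∫⁻ y in Q, ENNReal.ofReal (h ^ 2) *
          ∫⁻ t in Icc (0 : ℝ) 1, F ((1 - t) • x + t • y) := by
        refine setLIntegral_mono' hm fun x hx => setLIntegral_mono' hm fun y hy => ?_
        refine (ofReal_sq_sub_le_lintegral_segment hf x y).trans ?_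
        gcongr
        exact hdiam x hx y hy
    _ = ENNReal.ofReal (h ^ 2) * ∫⁻ t in Icc (0 : ℝ) 1,
          ∫⁻ x in Q, ∫⁻ y in Q, F ((1 - t) • x + t • y) := by
        simp_rw [lintegral_const_mul' _ _ ENNReal.ofReal_ne_top]
        congr 1
        have h1 : ∀ x : Plane, ∫⁻ y in Q, ∫⁻ t in Icc (0 : ℝ) 1, F ((1 - t) • x + t • y) =
            ∫⁻ t in Icc (0 : ℝ) 1, ∫⁻ y in Q, F ((1 - t) • x + t • y) := fun x =>
          lintegral_lintegral_swap (f := fun y t => F ((1 - t) • x + t • y))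
            (hFc.comp (f := fun p : Plane × ℝ => (1 - p.2) • x + p.2 • p.1)
              (by fun_prop)).measurable.aemeasurable
        simp_rw [h1]
        refine lintegral_lintegral_swap (Measurable.aemeasurable ?_)
        refine Measurable.lintegral_prod_right
          (f := fun (p : Plane × ℝ) (y : Plane) => F ((1 - p.2) • p.1 + p.2 • y)) ?_
        exact (hFc.comp (f := fun q : (Plane × ℝ) × Plane => (1 - q.1.2) • q.1.1 + q.1.2 • q.2)
          (by fun_prop)).measurable
    _ ≤ ENNReal.ofReal (h ^ 2) * ∫⁻ _ in Icc (0 : ℝ) 1, 4 * volume Q * ∫⁻ x in Q, F x := by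
        gcongr 1
        exact setLIntegral_mono' measurableSet_Icc key
    _ = ENNReal.ofReal (4 * h ^ 2) * volume Q * ∫⁻ x in Q, F x := by
        rw [lintegral_const, Measure.restrict_apply_univ, Real.volume_Icc,
          ENNReal.ofReal_mul (by norm_num)]
        norm_num
        ring

/-! ### The second moment bound -/

/-- The divergence inequality `∫_Ω div ((x - a) g) ≥ 0` for `g ≥ 0` on a set star-shaped about
`a`. -/
lemma integral_divergence_nonneg {Ω : Set Plane} (hm : MeasurableSet Ω) {a : Plane}
    (hstar : ∀ x ∈ Ω, ∀ s : ℝ, 0 < s → s ≤ 1 → a + s • (x - a) ∈ Ω) {g : Plane → ℝ}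
    (hg : ContDiff ℝ 1 g) (hc : HasCompactSupport g) (hg0 : ∀ x, 0 ≤ g x) :
    0 ≤ ∫ x in Ω, (2 * g x + fderiv ℝ g x (x - a)) := by
  have hgc : Continuous g := hg.continuous
  have hg' : Continuous (fderiv ℝ g) := hg.continuous_fderiv one_ne_zero
  have hD : Continuous fun x => fderiv ℝ g x (x - a) := hg'.clm_apply (by fun_prop)
  have hDc : HasCompactSupport fun x => fderiv ℝ g x (x - a) :=
    (hc.fderiv ℝ).mono fun x hx h0 => hx (by simp [h0])
  obtain ⟨B, hB⟩ := (hc.fderiv ℝ).exists_bound_of_continuous hg'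
  obtain ⟨R, hR0, hR⟩ : ∃ R : ℝ, 0 ≤ R ∧ tsupport g ⊆ closedBall a R := by
    obtain ⟨R, hR⟩ := hc.isCompact.isBounded.subset_closedBall a
    exact ⟨max R 0, le_max_right _ _, hR.trans (closedBall_subset_closedBall (le_max_left _ _))⟩
  have hcontp : ∀ s : ℝ, Continuous fun x : Plane => a + s • (x - a) := fun s => by fun_prop
  -- Near `s = 1` one has `s ≥ 1 / 2`, so the dilated support stays in the ball of radius `2 R`;
  -- this gives the dominating function.
  have hderiv : HasDerivAt (fun s : ℝ => ∫ x in Ω, g (a + s • (x - a)))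
      (∫ x in Ω, fderiv ℝ g x (x - a)) 1 := by
    have h := hasDerivAt_integral_of_dominated_loc_of_deriv_le (μ := volume.restrict Ω)
      (F := fun (s : ℝ) x => g (a + s • (x - a)))
      (F' := fun (s : ℝ) x => fderiv ℝ g (a + s • (x - a)) (x - a)) (x₀ := 1)
      (bound := (closedBall a (2 * R)).indicator fun _ => B * (2 * R))
      (s := ball 1 (1 / 2)) (ball_mem_nhds _ (by norm_num))
      (Eventually.of_forall fun s => (hgc.comp (hcontp s)).aestronglyMeasurable) ?_
      ((hg'.comp (hcontp 1)).clm_apply (by fun_prop)).aestronglyMeasurable ?_ ?_ ?_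
    · simpa using h.2
    · simpa using (hgc.integrable_of_hasCompactSupport hc).restrict
    · refine Eventually.of_forall fun x s hs => ?_
      rw [mem_ball, Real.dist_eq, abs_lt] at hs
      by_cases hx : a + s • (x - a) ∈ tsupport g
      · have h1 := hR hx
        rw [mem_closedBall, dist_eq_norm, add_sub_cancel_left, norm_smul,
          Real.norm_of_nonneg (by linarith)] at h1
        have h2 : ‖x - a‖ ≤ 2 * R := by nlinarith [norm_nonneg (x - a)]
        rw [indicator_of_mem (by rwa [mem_closedBall, dist_eq_norm])]
        exact ((fderiv ℝ g _).le_opNorm _).trans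
          (mul_le_mul (hB _) h2 (norm_nonneg _) ((norm_nonneg _).trans (hB 0)))
      · have h0 : fderiv ℝ g (a + s • (x - a)) = 0 :=
          image_eq_zero_of_notMem_tsupport fun h => hx (tsupport_fderiv_subset ℝ h)
        rw [h0]
        simp only [_root_.zero_apply, norm_zero]
        exact indicator_nonneg (fun _ _ => mul_nonneg ((norm_nonneg _).trans (hB 0))
          (by positivity)) _
    · exact ((integrable_indicator_iff isClosed_closedBall.measurableSet).2
        (integrableOn_const measure_closedBall_lt_top.ne)).restrict
    · refine Eventually.of_forall fun x s _ => ?_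
      have h1 : HasDerivAt (fun s : ℝ => a + s • (x - a)) ((1 : ℝ) • (x - a)) s :=
        ((hasDerivAt_id s).smul_const (x - a)).const_add a
      rw [one_smul] at h1
      exact ((hg.differentiable one_ne_zero _).hasFDerivAt).comp_hasDerivAt s h1
  have hH := ((hasDerivAt_id (1 : ℝ)).pow 2).mul hderiv
  -- After substitution, `s² ∫_Ω g(a + s (x - a))` is the integral of `g` over the contracted set,
  -- which lies in `Ω`. It is thus largest at `s = 1`, and its left derivative there, the integral
  -- in question, is nonnegative. No regularity of the boundary is used.
  have hle : ∀ s : ℝ, 0 < s → s ≤ 1 →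
      s ^ 2 * ∫ x in Ω, g (a + s • (x - a)) ≤ ∫ x in Ω, g x := by
    intro s hs hs1
    have h1 := setLIntegral_comp_le_of_mapsTo hm hm (fun x => ENNReal.ofReal (g x)) (a - s • a) hs
      (fun x hx => by
        have := hstar x hx s hs hs1
        convert this using 1
        module)
    have e : ∀ x, a - s • a + s • x = a + s • (x - a) := fun x => by module
    simp only [e] at h1
    have hi : Integrable g (volume.restrict Ω) :=
      (hgc.integrable_of_hasCompactSupport hc).restrict
    rw [integral_eq_lintegral_of_nonneg_ae (Eventually.of_forall fun x => hg0 _)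
      (hgc.comp (hcontp s)).aestronglyMeasurable,
      integral_eq_lintegral_of_nonneg_ae (Eventually.of_forall fun x => hg0 _)
      hgc.aestronglyMeasurable]
    have hfin : ∫⁻ x in Ω, ENNReal.ofReal (g x) ≠ ⊤ := hi.lintegral_lt_top.ne
    have h2 := ENNReal.toReal_mono (ENNReal.mul_ne_top ENNReal.ofReal_ne_top hfin) h1
    rw [ENNReal.toReal_mul, ENNReal.toReal_ofReal (by positivity)] at h2
    calc _ ≤ s ^ 2 * ((s ^ 2)⁻¹ * (∫⁻ x in Ω, ENNReal.ofReal (g x)).toReal) := by gcongr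
      _ = _ := by field_simp
  have hlim := (hasDerivWithinAt_iff_tendsto_slope' (s := Iio 1) (by simp)).1
    (hH.hasDerivWithinAt (s := Iio 1))
  have hnn := ge_of_tendsto hlim (b := 0) (by
    filter_upwards [Ioo_mem_nhdsLT (show (0 : ℝ) < 1 by norm_num)] with s hs
    rw [slope_def_field]
    refine div_nonneg_of_nonpos ?_ (by linarith [hs.2])
    have := hle s hs.1 hs.2.le
    simpa using this)
  rw [integral_add ((hgc.integrable_of_hasCompactSupport hc).restrict.const_mul 2)
    (hD.integrable_of_hasCompactSupport hDc).restrict, integral_const_mul]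
  simpa using hnn

lemma hasFDerivAt_gaussWeight (x : Plane) :
    HasFDerivAt gaussWeight (-(gaussWeight x) • innerSL ℝ x) x := by
  have h1 : HasFDerivAt (fun x : Plane => -‖x‖ ^ 2 / 2) (-(innerSL ℝ x)) x := by
    have h := ((hasStrictFDerivAt_norm_sq x).hasFDerivAt.neg).mul_const (2⁻¹ : ℝ)
    refine (h.congr_of_eventuallyEq (Eventually.of_forall fun y => ?_)).congr_fderiv ?_
    · simp [div_eq_mul_inv]
    · ext v; simp
  refine h1.exp.congr_fderiv ?_
  ext v; simp [gaussWeight]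

lemma contDiff_gaussWeight : ContDiff ℝ ∞ gaussWeight := by
  unfold gaussWeight
  exact (((contDiff_norm_sq ℝ).neg).div_const 2).exp

/-- The Gaussian energy density `(u² + |g|²) γ` integrated over `Ω`. -/
def gaussEnergy (Ω : Set Plane) (u : Plane → ℝ) (g : Plane → Plane →L[ℝ] ℝ) : ℝ≥0∞ :=
  ∫⁻ x in Ω, ENNReal.ofReal ((u x ^ 2 + ‖g x‖ ^ 2) * gaussWeight x)

/-- Functions of finite energy on a convex set have a finite second Gaussian moment. -/
lemma lintegral_norm_sq_mul_le_gaussEnergy {Ω : Set Plane} (hm : MeasurableSet Ω)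
    (hconv : Convex ℝ Ω) {a : Plane} (ha : a ∈ Ω) {f : Plane → ℝ} (hf : ContDiff ℝ 1 f)
    (hc : HasCompactSupport f) :
    ∫⁻ x in Ω, ENNReal.ofReal (‖x‖ ^ 2 * f x ^ 2 * gaussWeight x) ≤
      ENNReal.ofReal (32 + 3 * ‖a‖ ^ 2) * gaussEnergy Ω f (fderiv ℝ f) := by
  have hfc := hf.continuous
  have hf' : Continuous (fderiv ℝ f) := hf.continuous_fderiv one_ne_zero
  have hγ := continuous_gaussWeight
  -- For `g = f² γ` the derivative of the weight produces `-f² ⟨x, x - a⟩ γ`, the source of the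
  -- second moment.
  set g : Plane → ℝ := fun x => f x ^ 2 * gaussWeight x with hgdef
  have hg : ContDiff ℝ 1 g := (hf.pow 2).mul (contDiff_gaussWeight.of_le (by simp))
  have hgcs : HasCompactSupport g := hc.mono fun x hx h0 => hx (by simp [hgdef, h0])
  have hgd : ∀ x v, fderiv ℝ g x v =
      (2 * f x * fderiv ℝ f x v - f x ^ 2 * inner ℝ x v) * gaussWeight x := by
    intro x v
    have h := ((hf.differentiable one_ne_zero x).hasFDerivAt.pow 2).mul (hasFDerivAt_gaussWeight x)
    have h' : HasFDerivAt g _ x := h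
    rw [h'.fderiv]
    simp
    ring
  have hstar : ∀ x ∈ Ω, ∀ s : ℝ, 0 < s → s ≤ 1 → a + s • (x - a) ∈ Ω := fun x hx s hs hs1 =>
    hconv.add_smul_sub_mem ha hx ⟨hs.le, hs1⟩
  have key := integral_divergence_nonneg hm hstar hg hgcs fun x =>
    mul_nonneg (sq_nonneg _) (gaussWeight_pos x).le
  set F1 : Plane → ℝ := fun x => ‖x‖ ^ 2 * f x ^ 2 * gaussWeight x with hF1
  set F2 : Plane → ℝ := fun x => (32 + 3 * ‖a‖ ^ 2) *
    ((f x ^ 2 + ‖fderiv ℝ f x‖ ^ 2) * gaussWeight x) with hF2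
  have hzero : ∀ x, x ∉ tsupport f → f x = 0 ∧ fderiv ℝ f x = 0 := fun x hx =>
    ⟨image_eq_zero_of_notMem_tsupport hx,
      image_eq_zero_of_notMem_tsupport fun h => hx (tsupport_fderiv_subset ℝ h)⟩
  have hF1i : Integrable F1 (volume.restrict Ω) := by
    refine (Continuous.integrable_of_hasCompactSupport (by fun_prop) ?_).restrict
    exact HasCompactSupport.intro hc fun x hx => by simp [hF1, (hzero x hx).1]
  have hF2i : Integrable F2 (volume.restrict Ω) := by
    refine (Continuous.integrable_of_hasCompactSupport (by fun_prop) ?_).restrict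
    exact HasCompactSupport.intro hc fun x hx => by simp [hF2, (hzero x hx).1, (hzero x hx).2]
  -- Young's inequality with weights `1 / 8` and `8` gives the `32` after multiplication by `4`. The
  -- terms in `|x|² f²` add up to `1 - 2 = -1` and those in `|a|² f²` to `1 + 2 = 3`.
  have hpt : ∀ x, 4 * (2 * g x + fderiv ℝ g x (x - a)) ≤ F2 x - F1 x := by
    intro x
    have h1 := (fderiv ℝ f x).le_opNorm (x - a)
    rw [Real.norm_eq_abs] at h1
    have h2 : 2 * f x * fderiv ℝ f x (x - a) ≤
        1 / 8 * (f x ^ 2 * ‖x - a‖ ^ 2) + 8 * ‖fderiv ℝ f x‖ ^ 2 := by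
      have h3 : f x * fderiv ℝ f x (x - a) ≤ |f x| * (‖fderiv ℝ f x‖ * ‖x - a‖) :=
        (le_abs_self _).trans (by rw [abs_mul]; gcongr)
      have h4 := sq_nonneg (|f x| * ‖x - a‖ - 8 * ‖fderiv ℝ f x‖)
      have h5 := sq_abs (f x)
      nlinarith
    have h3 : ‖x - a‖ ^ 2 ≤ 2 * ‖x‖ ^ 2 + 2 * ‖a‖ ^ 2 := by
      have := norm_sub_le x a
      nlinarith [norm_nonneg (x - a), sq_nonneg (‖x‖ - ‖a‖)]
    have h4 : ‖x‖ ^ 2 / 2 - ‖a‖ ^ 2 / 2 ≤ inner ℝ x (x - a) := by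
      rw [inner_sub_right, real_inner_self_eq_norm_sq]
      have := real_inner_le_norm x a
      nlinarith [sq_nonneg (‖x‖ - ‖a‖)]
    rw [hgd]
    simp only [hF1, hF2, hgdef]
    have h5 : f x ^ 2 * ‖x - a‖ ^ 2 ≤ f x ^ 2 * (2 * ‖x‖ ^ 2 + 2 * ‖a‖ ^ 2) := by gcongr
    have h6 : f x ^ 2 * (‖x‖ ^ 2 / 2 - ‖a‖ ^ 2 / 2) ≤ f x ^ 2 * inner ℝ x (x - a) := by gcongr
    have h7 : 4 * (2 * f x ^ 2 + (2 * f x * fderiv ℝ f x (x - a) -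
        f x ^ 2 * inner ℝ x (x - a))) ≤
        (32 + 3 * ‖a‖ ^ 2) * (f x ^ 2 + ‖fderiv ℝ f x‖ ^ 2) - ‖x‖ ^ 2 * f x ^ 2 := by
      nlinarith [sq_nonneg (f x), mul_nonneg (sq_nonneg ‖a‖) (sq_nonneg ‖fderiv ℝ f x‖)]
    have h8 := mul_le_mul_of_nonneg_right h7 (gaussWeight_pos x).le
    linarith
  have hdi : Integrable (fun x => 2 * g x + fderiv ℝ g x (x - a)) (volume.restrict Ω) := by
    have h1 : Continuous (fderiv ℝ g) := hg.continuous_fderiv one_ne_zero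
    have h2 := hg.continuous
    refine (Continuous.integrable_of_hasCompactSupport
      ((continuous_const.mul h2).add (h1.clm_apply (by fun_prop))) ?_).restrict
    refine HasCompactSupport.intro hc fun x hx => ?_
    change 2 * g x + fderiv ℝ g x (x - a) = 0
    rw [hgd]
    simp [hgdef, (hzero x hx).1]
  have hmain : ∫ x in Ω, F1 x ≤ ∫ x in Ω, F2 x := by
    have h1 := integral_mono (hdi.const_mul 4) (hF2i.sub hF1i) hpt
    rw [integral_const_mul] at h1
    simp only [Pi.sub_apply] at h1
    rw [integral_sub hF2i hF1i] at h1
    linarith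
  have h := ENNReal.ofReal_le_ofReal hmain
  rw [ofReal_integral_eq_lintegral_ofReal hF1i (Eventually.of_forall fun x =>
      mul_nonneg (by positivity) (gaussWeight_pos x).le),
    ofReal_integral_eq_lintegral_ofReal hF2i (Eventually.of_forall fun x =>
      mul_nonneg (by positivity) (mul_nonneg (by positivity) (gaussWeight_pos x).le))] at h
  refine h.trans_eq ?_
  rw [gaussEnergy, ← lintegral_const_mul' _ _ ENNReal.ofReal_ne_top]
  refine lintegral_congr fun x => ?_
  rw [← ENNReal.ofReal_mul (by positivity)]

/-! ### Gaussian energy and representatives of Sobolev elements -/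

lemma integrable_gaussWeight : Integrable gaussWeight := by
  have h := (GaussianFourier.integrable_cexp_neg_mul_sq_norm_add (V := Plane) (b := 1 / 2)
    (by norm_num) 0 0).norm
  refine h.congr (Eventually.of_forall fun x => ?_)
  simp only [Complex.norm_exp, gaussWeight]
  congr 1
  have : -(1 / 2 : ℂ) * (‖x‖ : ℂ) ^ 2 + 0 * ((inner ℝ (0 : Plane) x : ℝ) : ℂ) =
      ((-‖x‖ ^ 2 / 2 : ℝ) : ℂ) := by
    push_cast; ring
  rw [this, Complex.ofReal_re]

instance : IsFiniteMeasure gaussMeas :=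
  isFiniteMeasure_withDensity_ofReal integrable_gaussWeight.2

lemma gaussMeas_restrict_ac (Ω : Set Plane) : gaussMeas.restrict Ω ≪ volume.restrict Ω := by
  rw [gaussMeas_restrict]; exact withDensity_absolutelyContinuous _ _

lemma lintegral_gaussMeas_restrict (Ω : Set Plane) (F : Plane → ℝ≥0∞) :
    ∫⁻ x, F x ∂(gaussMeas.restrict Ω) = ∫⁻ x in Ω, ENNReal.ofReal (gaussWeight x) * F x := by
  rw [gaussMeas_restrict, lintegral_withDensity_eq_lintegral_mul_non_measurable _
    measurable_ofReal_gaussWeight (Eventually.of_forall fun x => ENNReal.ofReal_lt_top)]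
  rfl

lemma ofReal_norm_sq_eq_lintegral {α E : Type*} [MeasurableSpace α] {μ : Measure α}
    [NormedAddCommGroup E] {v : Lp E 2 μ} {u : α → E} (h : v =ᵐ[μ] u) :
    ENNReal.ofReal (‖v‖ ^ 2) = ∫⁻ x, ENNReal.ofReal (‖u x‖ ^ 2) ∂μ := by
  have h2 := eLpNorm_nnreal_pow_eq_lintegral (f := v) (μ := μ) (p := 2) (by norm_num)
  rw [NNReal.coe_ofNat] at h2
  rw [ENNReal.ofReal_pow (norm_nonneg _), ofReal_norm, Lp.enorm_def]
  refine (Eq.trans (by norm_cast) h2).trans (lintegral_congr_ae ?_)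
  filter_upwards [h] with x hx
  rw [hx, ENNReal.ofReal_pow (norm_nonneg _), ofReal_norm]
  norm_cast

lemma memLp_two_of_lintegral_ne_top {α E : Type*} [MeasurableSpace α] {μ : Measure α}
    [NormedAddCommGroup E] {u : α → E} (hu : AEStronglyMeasurable u μ)
    (h : ∫⁻ x, ENNReal.ofReal (‖u x‖ ^ 2) ∂μ ≠ ⊤) : MemLp u 2 μ := by
  refine ⟨hu, ?_⟩
  have h2 := eLpNorm_nnreal_pow_eq_lintegral (f := u) (μ := μ) (p := 2) (by norm_num)
  by_contra hcon
  have htop : eLpNorm u 2 μ = ⊤ := by simpa using hcon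
  refine h (Eq.trans (lintegral_congr fun x => ?_) (h2.symm.trans ?_))
  · rw [ENNReal.ofReal_pow (norm_nonneg _), ofReal_norm]
    exact (ENNReal.rpow_natCast _ 2).symm
  · rw [show ((2 : NNReal) : ℝ≥0∞) = 2 by norm_cast, htop]; simp

/-- The vector representing a linear form on the plane. -/
abbrev dualVec (L : Plane →L[ℝ] ℝ) : Plane := (InnerProductSpace.toDual ℝ Plane).symm L

lemma dualVec_apply (L : Plane →L[ℝ] ℝ) (i : Fin 2) :
    dualVec L i = L (EuclideanSpace.single i 1) := by
  have h := InnerProductSpace.toDual_symm_apply (x := (EuclideanSpace.single i 1 : Plane)) (y := L)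
  rw [EuclideanSpace.inner_single_right] at h
  simpa using h

lemma norm_dualVec (L : Plane →L[ℝ] ℝ) : ‖dualVec L‖ = ‖L‖ := LinearIsometryEquiv.norm_map _ _

lemma continuous_dualVec : Continuous dualVec := LinearIsometryEquiv.continuous _

lemma gaussEnergy_eq (Ω : Set Plane) {u : Plane → ℝ} {G : Plane → Plane →L[ℝ] ℝ}
    (hu : AEStronglyMeasurable u (volume.restrict Ω)) :
    gaussEnergy Ω u G = ∫⁻ x, ENNReal.ofReal (‖u x‖ ^ 2) ∂(gaussMeas.restrict Ω) +
      ∫⁻ x, ENNReal.ofReal (‖dualVec (G x)‖ ^ 2) ∂(gaussMeas.restrict Ω) := by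
  rw [lintegral_gaussMeas_restrict, lintegral_gaussMeas_restrict, ← lintegral_add_left']
  · refine lintegral_congr fun x => ?_
    rw [← mul_add, ← ENNReal.ofReal_add (by positivity) (by positivity),
      ← ENNReal.ofReal_mul (gaussWeight_pos x).le, mul_comm, norm_dualVec, Real.norm_eq_abs,
      sq_abs]
  · exact (measurable_ofReal_gaussWeight.aemeasurable).mul
      ((hu.norm.pow 2).aemeasurable.ennreal_ofReal)

/-- Translates Hilbert space norms into extended nonnegative Lebesgue integrals, where Tonelli's
theorem and monotonicity apply without integrability conditions. -/
lemma H1Gauss.ofReal_norm_sq {Ω : Set Plane} {U : H1Gauss Ω} {u : Plane → ℝ}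
    {G : Plane → Plane →L[ℝ] ℝ} (hu : toL2 Ω U =ᵐ[gaussMeas.restrict Ω] u)
    (hG : grad Ω U =ᵐ[gaussMeas.restrict Ω] fun x => dualVec (G x)) :
    ENNReal.ofReal (‖U‖ ^ 2) = gaussEnergy Ω u G := by
  have hum : AEStronglyMeasurable u (volume.restrict Ω) :=
    ((Lp.aestronglyMeasurable _).congr hu).mono_ac (volume_restrict_ac_gaussMeas Ω)
  rw [H1Gauss.norm_eq, Real.sq_sqrt (by positivity), ENNReal.ofReal_add (by positivity)
    (by positivity), ofReal_norm_sq_eq_lintegral hu, ofReal_norm_sq_eq_lintegral hG,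
    gaussEnergy_eq Ω hum]

lemma IsWeakGradient.congr_ae {Ω : Set Plane} {u u' : Plane → ℝ} {g g' : Plane → Plane}
    (h : IsWeakGradient Ω u g) (hu : u' =ᵐ[gaussMeas.restrict Ω] u)
    (hg : g' =ᵐ[gaussMeas.restrict Ω] g) : IsWeakGradient Ω u' g' := by
  intro φ hφ hc hs i
  have h1 := (volume_restrict_ac_gaussMeas Ω).ae_le hu
  have h2 := (volume_restrict_ac_gaussMeas Ω).ae_le hg
  have e1 : ∫ x in Ω, u' x * fderiv ℝ φ x (EuclideanSpace.single i 1) =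
      ∫ x in Ω, u x * fderiv ℝ φ x (EuclideanSpace.single i 1) := by
    refine integral_congr_ae ?_
    filter_upwards [h1] with x hx; rw [hx]
  have e2 : ∫ x in Ω, g' x i * φ x = ∫ x in Ω, g x i * φ x := by
    refine integral_congr_ae ?_
    filter_upwards [h2] with x hx; rw [hx]
  rw [e1, e2, h φ hφ hc hs i]

/-- A function of finite Gaussian energy with a weak derivative is in `H¹_γ(Ω)`. -/
lemma H1Gauss.exists_of_gaussEnergy_ne_top {Ω : Set Plane} {u : Plane → ℝ}
    {G : Plane → Plane →L[ℝ] ℝ} (hu : AEStronglyMeasurable u (volume.restrict Ω))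
    (hG : AEStronglyMeasurable G (volume.restrict Ω)) (hE : gaussEnergy Ω u G ≠ ⊤)
    (hw : IsWeakGradient Ω u fun x => dualVec (G x)) :
    ∃ U : H1Gauss Ω, toL2 Ω U =ᵐ[gaussMeas.restrict Ω] u ∧
      grad Ω U =ᵐ[gaussMeas.restrict Ω] fun x => dualVec (G x) := by
  rw [gaussEnergy_eq Ω hu] at hE
  have h1 := memLp_two_of_lintegral_ne_top (hu.mono_ac (gaussMeas_restrict_ac Ω))
    (fun h => hE (by rw [h, top_add]))
  have h2 := memLp_two_of_lintegral_ne_top (u := fun x => dualVec (G x))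
    ((continuous_dualVec.comp_aestronglyMeasurable hG).mono_ac (gaussMeas_restrict_ac Ω))
    (fun h => hE (by rw [h, add_top]))
  obtain ⟨U, hU1, hU2⟩ := H1Gauss.exists_of_isWeakGradient h1.toLp h2.toLp
    (hw.congr_ae h1.coeFn_toLp h2.coeFn_toLp)
  exact ⟨U, by rw [hU1]; exact h1.coeFn_toLp, by rw [hU2]; exact h2.coeFn_toLp⟩

/-- The test function vanishes off `Ω`, so the integration by parts takes place on the whole plane
and has no boundary term. -/
lemma isWeakGradient_of_contDiff (Ω : Set Plane) {f : Plane → ℝ} (hf : ContDiff ℝ 1 f) :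
    IsWeakGradient Ω f fun x => dualVec (fderiv ℝ f x) := by
  intro φ hφ hc hs i
  have hφ0 : ∀ x, x ∉ Ω → φ x = 0 := fun x hx =>
    image_eq_zero_of_notMem_tsupport fun h => hx (hs h)
  have hφ0' : ∀ x, x ∉ Ω → fderiv ℝ φ x = 0 := fun x hx =>
    image_eq_zero_of_notMem_tsupport fun h => hx (hs (tsupport_fderiv_subset ℝ h))
  have hfc := hf.continuous
  have hf' : Continuous fun x => fderiv ℝ f x (EuclideanSpace.single i 1) :=
    (hf.continuous_fderiv one_ne_zero).clm_apply continuous_const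
  have hφc := hφ.continuous
  have hφ' := continuous_fderiv_test hφ (EuclideanSpace.single i 1)
  simp only [dualVec_apply]
  rw [setIntegral_eq_integral_of_forall_compl_eq_zero fun x hx => by simp [hφ0' x hx],
    setIntegral_eq_integral_of_forall_compl_eq_zero fun x hx => by simp [hφ0 x hx]]
  refine integral_mul_fderiv_eq_neg_fderiv_mul_of_integrable ?_ ?_ ?_
    (fun x _ => hf.differentiable one_ne_zero x)
    (fun x _ => hφ.differentiable (by simp) x)
  · exact (hf'.mul hφc).integrable_of_hasCompactSupport hc.mul_left
  · exact (hfc.mul hφ').integrable_of_hasCompactSupport (hc.fderiv_apply ℝ _).mul_left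
  · exact (hfc.mul hφc).integrable_of_hasCompactSupport hc.mul_left

/-- `f` is a smooth compactly supported function on the plane representing `U` on `Ω`. -/
structure IsSmoothRep (Ω : Set Plane) (U : H1Gauss Ω) (f : Plane → ℝ) : Prop where
  contDiff : ContDiff ℝ ∞ f
  hasCompactSupport : HasCompactSupport f
  toL2_ae : H1Gauss.toL2 Ω U =ᵐ[gaussMeas.restrict Ω] f
  grad_ae : H1Gauss.grad Ω U =ᵐ[gaussMeas.restrict Ω] fun x => dualVec (fderiv ℝ f x)

/-- The elements of `H¹_γ(Ω)` represented by test functions on the plane. -/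
def smoothSubgroup (Ω : Set Plane) : AddSubgroup (H1Gauss Ω) where
  carrier := {U | ∃ f, IsSmoothRep Ω U f}
  zero_mem' := by
    refine ⟨fun _ => 0, contDiff_const, HasCompactSupport.zero, ?_, ?_⟩
    · rw [map_zero]; exact Lp.coeFn_zero _ _ _
    · rw [map_zero]
      filter_upwards [Lp.coeFn_zero Plane 2 (gaussMeas.restrict Ω)] with x hx
      rw [hx]; simp
  add_mem' := by
    rintro U V ⟨f, hf, hfc, hU, hU'⟩ ⟨g, hg, hgc, hV, hV'⟩
    refine ⟨f + g, hf.add hg, hfc.add hgc, ?_, ?_⟩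
    · rw [map_add]
      exact (Lp.coeFn_add _ _).trans (hU.add hV)
    · rw [map_add]
      refine (Lp.coeFn_add _ _).trans ((hU'.add hV').trans (Eventually.of_forall fun x => ?_))
      simp only [Pi.add_apply]
      rw [fderiv_add (hf.differentiable (by simp) x) (hg.differentiable (by simp) x)]
      exact (map_add (InnerProductSpace.toDual ℝ Plane).symm _ _).symm
  neg_mem' := by
    rintro U ⟨f, hf, hfc, hU, hU'⟩
    refine ⟨-f, hf.neg, hfc.comp_left (g := fun t => -t) neg_zero, ?_, ?_⟩
    · rw [map_neg]
      exact (Lp.coeFn_neg _).trans hU.neg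
    · rw [map_neg]
      refine (Lp.coeFn_neg _).trans (hU'.neg.trans (Eventually.of_forall fun x => ?_))
      simp only [Pi.neg_apply]
      rw [fderiv_neg]
      exact (map_neg (InnerProductSpace.toDual ℝ Plane).symm _).symm

/-! ### Mollification and density of test functions -/

lemma lintegral_ofReal_sq_mul_gaussWeight (Ω : Set Plane) (w : Plane → ℝ) :
    ∫⁻ x in Ω, ENNReal.ofReal (w x ^ 2 * gaussWeight x) =
      eLpNorm w 2 (gaussMeas.restrict Ω) ^ 2 := by
  have h2 := eLpNorm_nnreal_pow_eq_lintegral (f := w) (μ := gaussMeas.restrict Ω) (p := 2)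
    (by norm_num)
  rw [NNReal.coe_ofNat, lintegral_gaussMeas_restrict] at h2
  refine Eq.trans (lintegral_congr fun x => ?_) (h2.symm.trans (by norm_cast))
  rw [mul_comm, ENNReal.ofReal_mul (gaussWeight_pos x).le, ← sq_abs,
    ENNReal.ofReal_pow (abs_nonneg _), ← Real.enorm_eq_ofReal_abs]
  norm_cast

lemma locallyIntegrable_indicator_of_memLp {Ω : Set Plane} (hm : MeasurableSet Ω)
    {v : Plane → ℝ} (hv : MemLp v 2 (gaussMeas.restrict Ω)) :
    LocallyIntegrable (Ω.indicator v) volume := by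
  rw [locallyIntegrable_iff]
  intro K hK
  obtain ⟨φ, h1, -, hc, -⟩ := exists_continuous_one_zero_of_isCompact hK isClosed_empty
    (disjoint_empty K)
  have h := (integrable_indicator_iff hm).2 (integrable_mul_test hv φ.continuous hc)
  refine (h.integrableOn (s := K)).congr_fun (fun x hx => ?_) hK.measurableSet
  by_cases hxΩ : x ∈ Ω <;> simp [hxΩ, h1 hx]

/-- Jensen for the probability measure with density `φ.normed`. -/
lemma ContDiffBump.ofReal_sq_convolution_le (φ : ContDiffBump (0 : Plane)) {g : Plane → ℝ}
    (hg : Measurable g) (p : Plane) :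
    ENNReal.ofReal ((convolution (φ.normed volume) g (ContinuousLinearMap.lsmul ℝ ℝ) volume p) ^ 2)
      ≤ ∫⁻ θ, ENNReal.ofReal (φ.normed volume θ) * ENNReal.ofReal (g (p - θ) ^ 2) := by
  set ρ : Plane → ℝ≥0∞ := fun θ => ENNReal.ofReal (φ.normed volume θ) with hρ
  have hρm : Measurable ρ := φ.continuous_normed.measurable.ennreal_ofReal
  have hfin : ∀ᵐ θ ∂(volume : Measure Plane), ρ θ < ⊤ :=
    Eventually.of_forall fun θ => ENNReal.ofReal_lt_top
  have hprob : IsProbabilityMeasure ((volume : Measure Plane).withDensity ρ) := ⟨by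
    rw [withDensity_apply _ MeasurableSet.univ, setLIntegral_univ,
      ← ofReal_integral_eq_lintegral_ofReal φ.integrable_normed
        (Eventually.of_forall φ.nonneg_normed), φ.integral_normed, ENNReal.ofReal_one]⟩
  have h := ofReal_sq_integral_le_lintegral (volume.withDensity ρ) (g := fun θ => g (p - θ))
    (hg.comp (measurable_const.sub measurable_id)).aestronglyMeasurable
  rw [integral_withDensity_eq_integral_toReal_smul hρm hfin,
    lintegral_withDensity_eq_lintegral_mul_non_measurable _ hρm hfin] at h
  refine le_of_eq_of_le ?_ h
  congr 2
  refine integral_congr_ae (Eventually.of_forall fun θ => ?_)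
  simp [hρ, ENNReal.toReal_ofReal (φ.nonneg_normed θ)]

/-- The mollification of `v` on `Ω`, composed with the homothety of centre `a` and ratio
`1 - ε`. -/
def smoothing (φ : ContDiffBump (0 : Plane)) (Ω : Set Plane) (a : Plane) (ε : ℝ) (v : Plane → ℝ)
    (x : Plane) : ℝ :=
  convolution (φ.normed volume) (Ω.indicator v) (ContinuousLinearMap.lsmul ℝ ℝ) volume
    ((1 - ε) • x + ε • a)

/-- The point equals `(1 - ε) x + ε (a - θ / ε)`, with `a - θ / ε` in the ball about `a`. Convexity
of `Ω` gives membership; convexity of the square gives the norm bound, which says that `γ(x)` is at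
most a constant times `γ` at the new point. Thus mollification at scale `ε r` never leaves `Ω`. -/
lemma Convex.homothety_sub_mem {Ω : Set Plane} (hconv : Convex ℝ Ω) {a : Plane} {r : ℝ}
    (hball : closedBall a r ⊆ Ω) {ε : ℝ} (hε0 : 0 < ε) (hε1 : ε ≤ 1 / 2) {x θ : Plane}
    (hx : x ∈ Ω) (hθ : ‖θ‖ ≤ ε * r) :
    (1 - ε) • x + ε • a - θ ∈ Ω ∧
      ‖(1 - ε) • x + ε • a - θ‖ ^ 2 ≤ ‖x‖ ^ 2 + (‖a‖ + r) ^ 2 := by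
  have hb : ‖ε⁻¹ • θ‖ ≤ r := by
    rw [norm_smul, norm_inv, Real.norm_of_nonneg hε0.le, inv_mul_le_iff₀ hε0]; exact hθ
  have hbΩ : a - ε⁻¹ • θ ∈ Ω := hball (by simpa [dist_eq_norm] using hb)
  have e : (1 - ε) • x + ε • a - θ = (1 - ε) • x + ε • (a - ε⁻¹ • θ) := by
    rw [smul_sub, smul_smul, mul_inv_cancel₀ hε0.ne', one_smul, add_sub_assoc]
  rw [e]
  refine ⟨hconv hx hbΩ (by linarith) hε0.le (by ring), ?_⟩
  have h1 : ‖(1 - ε) • x + ε • (a - ε⁻¹ • θ)‖ ≤ (1 - ε) * ‖x‖ + ε * (‖a‖ + r) := by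
    refine (norm_add_le _ _).trans ?_
    rw [norm_smul, norm_smul, Real.norm_of_nonneg hε0.le,
      Real.norm_of_nonneg (show 0 ≤ 1 - ε by linarith)]
    gcongr
    exact (norm_sub_le _ _).trans (by linarith)
  have hr : 0 ≤ r := (norm_nonneg _).trans hb
  have h2 : ((1 - ε) * ‖x‖ + ε * (‖a‖ + r)) ^ 2 ≤ (1 - ε) * ‖x‖ ^ 2 + ε * (‖a‖ + r) ^ 2 := by
    nlinarith [mul_nonneg (mul_nonneg hε0.le (show 0 ≤ 1 - ε by linarith))
      (sq_nonneg (‖x‖ - (‖a‖ + r)))]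
  have h3 := pow_le_pow_left₀ (norm_nonneg _) h1 2
  nlinarith [sq_nonneg ‖x‖, sq_nonneg (‖a‖ + r)]

/-- Uniform boundedness on `L²_γ(Ω)`, which lets convergence be tested on a dense class. The
exponential is the comparison of weights; the `4` bounds `(1 - ε)⁻²` for `ε ≤ 1 / 2`. -/
lemma lintegral_smoothing_le {Ω : Set Plane} (hm : MeasurableSet Ω) (hconv : Convex ℝ Ω)
    {a : Plane} {r : ℝ} (hball : closedBall a r ⊆ Ω) (φ : ContDiffBump (0 : Plane)) {ε : ℝ}
    (hε0 : 0 < ε) (hε1 : ε ≤ 1 / 2) (hφ : φ.rOut ≤ ε * r) {v : Plane → ℝ} (hv : Measurable v) :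
    ∫⁻ x in Ω, ENNReal.ofReal (smoothing φ Ω a ε v x ^ 2 * gaussWeight x) ≤
      ENNReal.ofReal (4 * Real.exp ((‖a‖ + r) ^ 2 / 2)) *
        ∫⁻ x in Ω, ENNReal.ofReal (v x ^ 2 * gaussWeight x) := by
  set E := Real.exp ((‖a‖ + r) ^ 2 / 2) with hE
  set H : Plane → ℝ≥0∞ := Ω.indicator fun x => ENNReal.ofReal (v x ^ 2 * gaussWeight x) with hH
  have hHm : Measurable H :=
    ((hv.pow_const 2).mul continuous_gaussWeight.measurable).ennreal_ofReal.indicator hm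
  set ρ : Plane → ℝ≥0∞ := fun θ => ENNReal.ofReal (φ.normed volume θ) with hρ
  have hρm : Measurable ρ := φ.continuous_normed.measurable.ennreal_ofReal
  have hρ1 : ∫⁻ θ, ρ θ = 1 := by
    rw [← ofReal_integral_eq_lintegral_ofReal φ.integrable_normed
        (Eventually.of_forall φ.nonneg_normed), φ.integral_normed, ENNReal.ofReal_one]
  have hpt : ∀ x ∈ Ω, ENNReal.ofReal (smoothing φ Ω a ε v x ^ 2 * gaussWeight x) ≤
      ∫⁻ θ, ρ θ * (ENNReal.ofReal E * H ((1 - ε) • x + ε • a - θ)) := by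
    intro x hx
    rw [ENNReal.ofReal_mul (sq_nonneg _)]
    refine (mul_le_mul_left (φ.ofReal_sq_convolution_le (hv.indicator hm) _) _).trans ?_
    rw [← lintegral_mul_const' _ _ ENNReal.ofReal_ne_top]
    refine lintegral_mono fun θ => ?_
    rw [mul_assoc]
    by_cases hθ : θ ∈ ball (0 : Plane) φ.rOut
    · refine mul_le_mul_right ?_ _
      obtain ⟨hmem, hle⟩ := hconv.homothety_sub_mem hball hε0 hε1 hx
        ((mem_ball_zero_iff.1 hθ).le.trans hφ)
      rw [hH, indicator_of_mem hmem, indicator_of_mem hmem, ← ENNReal.ofReal_mul (by positivity),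
        ← ENNReal.ofReal_mul (by positivity)]
      refine ENNReal.ofReal_le_ofReal ?_
      have : gaussWeight x ≤ E * gaussWeight ((1 - ε) • x + ε • a - θ) := by
        rw [gaussWeight, gaussWeight, hE, ← Real.exp_add, Real.exp_le_exp]
        linarith
      nlinarith [sq_nonneg (v ((1 - ε) • x + ε • a - θ))]
    · have : φ.normed volume θ = 0 := by
        rw [← φ.support_normed_eq (μ := volume)] at hθ
        simpa using hθ
      simp [hρ, this]
  calc ∫⁻ x in Ω, ENNReal.ofReal (smoothing φ Ω a ε v x ^ 2 * gaussWeight x)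
      ≤ ∫⁻ x in Ω, ∫⁻ θ, ρ θ * (ENNReal.ofReal E * H ((1 - ε) • x + ε • a - θ)) :=
        setLIntegral_mono' hm hpt
    _ ≤ ∫⁻ x, ∫⁻ θ, ρ θ * (ENNReal.ofReal E * H ((1 - ε) • x + ε • a - θ)) :=
        setLIntegral_le_lintegral _ _
    _ = ∫⁻ θ, ∫⁻ x, ρ θ * (ENNReal.ofReal E * H ((1 - ε) • x + ε • a - θ)) := by
        refine lintegral_lintegral_swap (Measurable.aemeasurable ?_)
        refine (hρm.comp measurable_snd).mul (measurable_const.mul (hHm.comp ?_))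
        fun_prop
    _ ≤ ∫⁻ θ, ρ θ * (ENNReal.ofReal (4 * E) * ∫⁻ x, H x) := by
        refine lintegral_mono fun θ => ?_
        rw [lintegral_const_mul' _ _ ENNReal.ofReal_ne_top,
          lintegral_const_mul' _ _ ENNReal.ofReal_ne_top]
        refine mul_le_mul_right ?_ _
        have e : ∀ x, (1 - ε) • x + ε • a - θ = (ε • a - θ) + (1 - ε) • x := fun x => by abel
        simp only [e]
        rw [lintegral_comp_add_smul H _ (by linarith), ← mul_assoc, mul_comm 4 E,
          ENNReal.ofReal_mul (by positivity)]
        gcongr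
        rw [inv_le_comm₀ (by nlinarith) (by norm_num)]
        nlinarith
    _ = _ := by
        rw [lintegral_mul_const _ hρm, hρ1, one_mul, hH, lintegral_indicator hm]

lemma continuous_smoothing (φ : ContDiffBump (0 : Plane)) {Ω : Set Plane} (a : Plane) (ε : ℝ)
    {v : Plane → ℝ} (hv : LocallyIntegrable (Ω.indicator v) volume) :
    Continuous (smoothing φ Ω a ε v) :=
  ((φ.hasCompactSupport_normed (μ := volume)).continuous_convolution_left _ φ.continuous_normed
    hv).comp (by fun_prop)

lemma smoothing_sub (φ : ContDiffBump (0 : Plane)) {Ω : Set Plane} (a : Plane) (ε : ℝ)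
    {v w : Plane → ℝ} (hv : LocallyIntegrable (Ω.indicator v) volume)
    (hw : LocallyIntegrable (Ω.indicator w) volume) (x : Plane) :
    smoothing φ Ω a ε (v - w) x = smoothing φ Ω a ε v x - smoothing φ Ω a ε w x := by
  have hex : ∀ g : Plane → ℝ, LocallyIntegrable g volume → ConvolutionExists (φ.normed volume) g
      (ContinuousLinearMap.lsmul ℝ ℝ) volume := fun g hg =>
    (φ.hasCompactSupport_normed (μ := volume)).convolutionExists_left _ φ.continuous_normed hg
  have h := (hex _ (hv.sub hw) ((1 - ε) • x + ε • a)).distrib_add (hex _ hw _)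
  rw [sub_add_cancel] at h
  rw [smoothing, smoothing, smoothing, indicator_sub', h, add_sub_cancel_right]

/-- Mollifications converge in `L²_γ(Ω)`. -/
lemma tendsto_lintegral_smoothing_sub {Ω : Set Plane} (hΩ : IsOpen Ω) (hconv : Convex ℝ Ω)
    {a : Plane} {r : ℝ} (hball : closedBall a r ⊆ Ω) {φ : ℕ → ContDiffBump (0 : Plane)}
    {ε : ℕ → ℝ} (hε0 : ∀ n, 0 < ε n) (hε1 : ∀ n, ε n ≤ 1 / 2) (hε : Tendsto ε atTop (𝓝 0))
    (hφ : ∀ n, (φ n).rOut ≤ ε n * r) {v : Plane → ℝ} (hvm : Measurable v)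
    (hv : MemLp v 2 (gaussMeas.restrict Ω)) :
    Tendsto (fun n => ∫⁻ x in Ω,
      ENNReal.ofReal ((smoothing (φ n) Ω a (ε n) v x - v x) ^ 2 * gaussWeight x)) atTop
      (𝓝 0) := by
  have hm := hΩ.measurableSet
  have hrout : Tendsto (fun n => (φ n).rOut) atTop (𝓝 0) :=
    squeeze_zero (fun n => (φ n).rOut_pos.le) hφ (by simpa using hε.mul_const r)
  set K : ℝ≥0∞ := ENNReal.ofReal (4 * Real.exp ((‖a‖ + r) ^ 2 / 2)) with hK
  rw [ENNReal.tendsto_nhds_zero]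
  intro δ hδ
  -- The final error is `3 (K δ' + δ' + δ')`: smoothing of `v - k`, convergence for `k`, and `v - k`
  -- itself.
  set δ' : ℝ≥0∞ := δ / (3 * (K + 2)) with hδ'
  have hδ'0 : δ' ≠ 0 := by
    refine (ENNReal.div_pos hδ.ne' ?_).ne'
    exact ENNReal.mul_ne_top (by norm_num) (ENNReal.add_ne_top.2 ⟨ENNReal.ofReal_ne_top, by norm_num⟩)
  -- A norm below both `1` and `δ'` has square below `δ'`.
  obtain ⟨k, hkc, hkle, hk, hkmem⟩ := hv.exists_hasCompactSupport_eLpNorm_sub_le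
    (by norm_num) (ε := min 1 δ') (by simp [hδ'0])
  have hvk : ∫⁻ x in Ω, ENNReal.ofReal ((v - k) x ^ 2 * gaussWeight x) ≤ δ' := by
    rw [lintegral_ofReal_sq_mul_gaussWeight, sq]
    calc _ ≤ (1 : ℝ≥0∞) * δ' :=
          mul_le_mul' (hkle.trans (min_le_left _ _)) (hkle.trans (min_le_right _ _))
      _ = δ' := one_mul _
  have hvi := locallyIntegrable_indicator_of_memLp hm hv
  have hki := locallyIntegrable_indicator_of_memLp hm hkmem
  have hlimk : Tendsto (fun n => ∫⁻ x in Ω,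
      ENNReal.ofReal ((smoothing (φ n) Ω a (ε n) k x - k x) ^ 2 * gaussWeight x)) atTop
      (𝓝 0) := by
    obtain ⟨B, hB⟩ := hkc.exists_bound_of_continuous hk
    have hbound : ∀ n x, |smoothing (φ n) Ω a (ε n) k x| ≤ B := by
      intro n x
      rw [smoothing, convolution_def, ← Real.norm_eq_abs]
      refine (norm_integral_le_of_norm_le ((φ n).integrable_normed.mul_const B)
        (Eventually.of_forall fun θ => ?_)).trans_eq ?_
      · rw [ContinuousLinearMap.lsmul_apply, smul_eq_mul, norm_mul,
          Real.norm_of_nonneg ((φ n).nonneg_normed θ)]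
        refine mul_le_mul_of_nonneg_left ?_ ((φ n).nonneg_normed θ)
        exact (norm_indicator_le_norm_self _ _).trans (hB _)
      · rw [integral_mul_const, (φ n).integral_normed, one_mul]
    have hlim := tendsto_lintegral_of_dominated_convergence (μ := volume.restrict Ω)
      (F := fun n x => ENNReal.ofReal
        ((smoothing (φ n) Ω a (ε n) k x - k x) ^ 2 * gaussWeight x)) (f := fun _ => 0)
      (fun x => ENNReal.ofReal ((2 * B) ^ 2 * gaussWeight x)) ?_ ?_ ?_ ?_
    · simpa using hlim
    · intro n
      exact ((((continuous_smoothing (φ n) a (ε n) hki).sub hk).pow 2).mul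
        continuous_gaussWeight).measurable.ennreal_ofReal
    · intro n
      refine Eventually.of_forall fun x => ENNReal.ofReal_le_ofReal ?_
      refine mul_le_mul_of_nonneg_right ?_ (gaussWeight_pos x).le
      rw [← sq_abs]
      refine pow_le_pow_left₀ (abs_nonneg _) ?_ 2
      have h1 := hbound n x
      have h2 := hB x
      rw [Real.norm_eq_abs] at h2
      exact (abs_sub _ _).trans (by linarith)
    · exact (integrable_gaussWeight.const_mul _).restrict.lintegral_lt_top.ne
    · refine (ae_restrict_iff' hm).2 (Eventually.of_forall fun x hx => ?_)
      have hpx : Tendsto (fun n => (1 - ε n) • x + ε n • a) atTop (𝓝 x) := by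
        have h1 := ((tendsto_const_nhds (x := (1 : ℝ))).sub hε).smul_const x
        have h2 := h1.add (hε.smul_const a)
        simpa using h2
      -- Extension by zero does not harm continuity at points of the open set `Ω`, and pointwise
      -- convergence is needed only there.
      have hind : Tendsto (Ω.indicator k) (𝓝 x) (𝓝 (k x)) := by
        refine (hk.tendsto x).congr' ?_
        filter_upwards [hΩ.mem_nhds hx] with y hy
        rw [indicator_of_mem hy]
      have h1 : Tendsto (fun n => smoothing (φ n) Ω a (ε n) k x) atTop (𝓝 (k x)) :=
        ContDiffBump.convolution_tendsto_right (g := fun _ => Ω.indicator k) hrout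
          (Eventually.of_forall fun _ => (hk.measurable.indicator hm).aestronglyMeasurable)
          (hind.comp tendsto_snd) hpx
      have h2 := (((h1.sub_const (k x)).pow 2).mul_const (gaussWeight x))
      have h3 := (ENNReal.continuous_ofReal.tendsto _).comp h2
      simpa [Function.comp_def] using h3
  filter_upwards [(ENNReal.tendsto_nhds_zero.1 hlimk) δ' (pos_iff_ne_zero.2 hδ'0)] with n hn
  have hS := lintegral_smoothing_le hm hconv hball (φ n) (hε0 n) (hε1 n) (hφ n)
    (hvm.sub hk.measurable)
  have hSk : Measurable (smoothing (φ n) Ω a (ε n) k) :=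
    (continuous_smoothing (φ n) a (ε n) hki).measurable
  have hSd : Measurable (smoothing (φ n) Ω a (ε n) (v - k)) := by
    refine (continuous_smoothing (φ n) a (ε n) ?_).measurable
    rw [indicator_sub']; exact hvi.sub hki
  have hγ := continuous_gaussWeight.measurable
  have hkm := hk.measurable
  calc ∫⁻ x in Ω, ENNReal.ofReal ((smoothing (φ n) Ω a (ε n) v x - v x) ^ 2 * gaussWeight x)
      ≤ ∫⁻ x in Ω, 3 * (ENNReal.ofReal (smoothing (φ n) Ω a (ε n) (v - k) x ^ 2 * gaussWeight x) +
          (ENNReal.ofReal ((smoothing (φ n) Ω a (ε n) k x - k x) ^ 2 * gaussWeight x) +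
          ENNReal.ofReal ((v - k) x ^ 2 * gaussWeight x))) := by
        refine lintegral_mono fun x => ?_
        have hγx := (gaussWeight_pos x).le
        rw [← ENNReal.ofReal_add (by positivity) (by positivity),
          ← ENNReal.ofReal_add (by positivity) (by positivity),
          show (3 : ℝ≥0∞) = ENNReal.ofReal 3 by norm_num, ← ENNReal.ofReal_mul (by norm_num)]
        refine ENNReal.ofReal_le_ofReal ?_
        rw [← add_mul, ← add_mul, ← mul_assoc]
        refine mul_le_mul_of_nonneg_right ?_ hγx
        rw [smoothing_sub _ _ _ hvi hki, Pi.sub_apply]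
        generalize smoothing (φ n) Ω a (ε n) v x = A
        generalize smoothing (φ n) Ω a (ε n) k x = B
        nlinarith [sq_nonneg ((A - B) - (B - k x)), sq_nonneg ((A - B) + (v x - k x)),
          sq_nonneg ((B - k x) + (v x - k x))]
    _ ≤ 3 * (K * δ' + (δ' + δ')) := by
        rw [lintegral_const_mul' _ _ (by norm_num), lintegral_add_left, lintegral_add_left]
        · gcongr
          exact hS.trans (by gcongr)
        · exact (((hSk.sub hkm).pow_const 2).mul hγ).ennreal_ofReal
        · exact ((hSd.pow_const 2).mul hγ).ennreal_ofReal
    _ = 3 * (K + 2) * δ' := by ring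
    _ ≤ δ := ENNReal.mul_div_le

/-- Weak differentiation commutes with mollification. -/
lemma IsWeakGradient.fderiv_smoothing {Ω : Set Plane} (hm : MeasurableSet Ω)
    (hconv : Convex ℝ Ω) {a : Plane} {r : ℝ} (hball : closedBall a r ⊆ Ω)
    (φ : ContDiffBump (0 : Plane)) {ε : ℝ} (hε0 : 0 < ε) (hε1 : ε ≤ 1 / 2) (hφ : φ.rOut ≤ ε * r)
    {u : Plane → ℝ} {g : Plane → Plane} (hw : IsWeakGradient Ω u g)
    (hu : LocallyIntegrable (Ω.indicator u) volume) {x : Plane} (hx : x ∈ Ω) (i : Fin 2) :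
    fderiv ℝ (smoothing φ Ω a ε u) x (EuclideanSpace.single i 1) =
      (1 - ε) * smoothing φ Ω a ε (fun y => g y i) x := by
  set N : Plane → ℝ := φ.normed volume with hN
  set p : Plane := (1 - ε) • x + ε • a with hp
  set e : Plane := EuclideanSpace.single i 1 with he
  have hNs : ContDiff ℝ ∞ N := φ.contDiff_normed
  have hNc : HasCompactSupport N := φ.hasCompactSupport_normed
  have hflip : ∀ v : Plane → ℝ, ∀ q : Plane,
      convolution N (Ω.indicator v) (ContinuousLinearMap.lsmul ℝ ℝ) volume q =
        ∫ t in Ω, v t * N (q - t) := by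
    intro v q
    rw [← convolution_flip, convolution_def, ← integral_indicator hm]
    refine integral_congr_ae (Eventually.of_forall fun t => ?_)
    by_cases ht : t ∈ Ω <;> simp [ht, mul_comm]
  have hderiv := hNc.hasFDerivAt_convolution_right (ContinuousLinearMap.lsmul ℝ ℝ).flip hu
    (hNs.of_le (by simp)) p
  rw [convolution_flip] at hderiv
  have haff : HasFDerivAt (fun y : Plane => (1 - ε) • y + ε • a)
      ((1 - ε) • ContinuousLinearMap.id ℝ Plane) x :=
    ((hasFDerivAt_id x).const_smul (1 - ε)).add_const (ε • a)
  have hcomp : HasFDerivAt (smoothing φ Ω a ε u) _ x := hderiv.comp x haff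
  rw [hcomp.fderiv]
  simp only [ContinuousLinearMap.comp_smul, ContinuousLinearMap.comp_id,
    _root_.smul_apply, smul_eq_mul]
  congr 1
  rw [convolution_precompR_apply _ hu (hNc.fderiv ℝ) (hNs.continuous_fderiv (by simp)),
    convolution_def, smoothing, hflip]
  -- The reflected and translated mollifier is supported in `Ω` by `Convex.homothety_sub_mem`, hence
  -- is admissible in the definition of the weak gradient. The factor `1 - ε` came from the chain
  -- rule.
  set ψ : Plane → ℝ := fun t => N (p - t) with hψ
  have hψs : ContDiff ℝ ∞ ψ := hNs.comp (contDiff_const.sub contDiff_id)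
  have hsub : tsupport ψ ⊆ closedBall p φ.rOut := by
    refine closure_minimal (fun t ht => ?_) isClosed_closedBall
    have h1 : p - t ∈ Function.support N := ht
    rw [hN, φ.support_normed_eq, mem_ball_zero_iff] at h1
    rw [mem_closedBall, dist_comm, dist_eq_norm]
    exact h1.le
  have hψc : HasCompactSupport ψ :=
    (isCompact_closedBall p φ.rOut).of_isClosed_subset (isClosed_tsupport _) hsub
  have hψΩ : tsupport ψ ⊆ Ω := by
    intro t ht
    have h1 := hsub ht
    rw [mem_closedBall, dist_comm, dist_eq_norm] at h1
    have h2 := (hconv.homothety_sub_mem hball hε0 hε1 hx (h1.trans hφ)).1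
    rwa [← hp, sub_sub_cancel] at h2
  have hψd : ∀ t, fderiv ℝ ψ t e = -fderiv ℝ N (p - t) e := by
    intro t
    have h1 : HasFDerivAt (fun t : Plane => p - t) (-ContinuousLinearMap.id ℝ Plane) t :=
      (hasFDerivAt_id t).const_sub p
    have h2 : HasFDerivAt ψ _ t :=
      (hNs.differentiable (by simp) (p - t)).hasFDerivAt.comp t h1
    rw [h2.fderiv]
    simp
  have h := hw ψ hψs hψc hψΩ i
  simp only [← he, hψd, mul_neg, integral_neg, neg_inj] at h
  rw [← h, ← integral_indicator hm]
  refine integral_congr_ae (Eventually.of_forall fun t => ?_)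
  by_cases ht : t ∈ Ω <;> simp [ht, mul_comm]

lemma norm_sq_eq_sum_apply_single (L : Plane →L[ℝ] ℝ) :
    ‖L‖ ^ 2 = ∑ i : Fin 2, L (EuclideanSpace.single i 1) ^ 2 := by
  rw [← norm_dualVec, EuclideanSpace.real_norm_sq_eq]
  simp only [dualVec_apply]

/-- A `C¹` function close in energy to an element of `H¹_γ(Ω)` represents a nearby element. -/
lemma H1Gauss.exists_near {Ω : Set Plane} {U : H1Gauss Ω} {u : Plane → ℝ}
    {G : Plane → Plane →L[ℝ] ℝ} (hu : toL2 Ω U =ᵐ[gaussMeas.restrict Ω] u)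
    (hG : grad Ω U =ᵐ[gaussMeas.restrict Ω] fun x => dualVec (G x)) {f : Plane → ℝ}
    (hf : ContDiff ℝ 1 f)
    (hE : gaussEnergy Ω (u - f) (fun x => G x - fderiv ℝ f x) ≠ ⊤) :
    ∃ V : H1Gauss Ω, toL2 Ω V =ᵐ[gaussMeas.restrict Ω] f ∧
      grad Ω V =ᵐ[gaussMeas.restrict Ω] (fun x => dualVec (fderiv ℝ f x)) ∧
      ENNReal.ofReal (‖U - V‖ ^ 2) = gaussEnergy Ω (u - f) (fun x => G x - fderiv ℝ f x) := by
  have hum : AEStronglyMeasurable u (volume.restrict Ω) :=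
    ((Lp.aestronglyMeasurable _).congr hu).mono_ac (volume_restrict_ac_gaussMeas Ω)
  have hGm : AEStronglyMeasurable G (volume.restrict Ω) := by
    have h1 := ((Lp.aestronglyMeasurable _).congr hG).mono_ac (volume_restrict_ac_gaussMeas Ω)
    refine ((InnerProductSpace.toDual ℝ Plane).continuous.comp_aestronglyMeasurable h1).congr
      (Eventually.of_forall fun x => ?_)
    simp [dualVec]
  have hf' := hf.continuous_fderiv one_ne_zero
  have hfin : gaussEnergy Ω f (fderiv ℝ f) ≠ ⊤ := by
    have hle : gaussEnergy Ω f (fderiv ℝ f) ≤ ENNReal.ofReal 2 * (gaussEnergy Ω u G +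
        gaussEnergy Ω (u - f) (fun x => G x - fderiv ℝ f x)) := by
      rw [gaussEnergy, gaussEnergy, gaussEnergy, ← lintegral_add_left',
        ← lintegral_const_mul' _ _ ENNReal.ofReal_ne_top]
      · refine lintegral_mono fun x => ?_
        have hγ := (gaussWeight_pos x).le
        rw [← ENNReal.ofReal_add (by positivity) (by positivity),
          ← ENNReal.ofReal_mul (by norm_num)]
        refine ENNReal.ofReal_le_ofReal ?_
        rw [← add_mul, ← mul_assoc]
        refine mul_le_mul_of_nonneg_right ?_ hγ
        have h1 : ‖fderiv ℝ f x‖ ≤ ‖G x‖ + ‖G x - fderiv ℝ f x‖ := by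
          have := norm_sub_le (G x) (G x - fderiv ℝ f x)
          rwa [sub_sub_cancel] at this
        simp only [Pi.sub_apply]
        nlinarith [sq_nonneg (‖G x‖ - ‖G x - fderiv ℝ f x‖), norm_nonneg (fderiv ℝ f x),
          sq_nonneg (2 * u x - f x)]
      · have : AEMeasurable (fun x => (u x ^ 2 + ‖G x‖ ^ 2) * gaussWeight x)
            (volume.restrict Ω) :=
          ((hum.aemeasurable.pow_const 2).add (hGm.norm.aemeasurable.pow_const 2)).mul
            continuous_gaussWeight.aemeasurable
        exact this.ennreal_ofReal
    refine ne_top_of_le_ne_top ?_ hle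
    rw [← H1Gauss.ofReal_norm_sq hu hG]
    exact ENNReal.mul_ne_top ENNReal.ofReal_ne_top (ENNReal.add_ne_top.2 ⟨ENNReal.ofReal_ne_top, hE⟩)
  obtain ⟨V, hV1, hV2⟩ := H1Gauss.exists_of_gaussEnergy_ne_top
    hf.continuous.aestronglyMeasurable hf'.aestronglyMeasurable hfin
    (isWeakGradient_of_contDiff Ω hf)
  refine ⟨V, hV1, hV2, H1Gauss.ofReal_norm_sq ?_ ?_⟩
  · rw [map_sub]
    exact (Lp.coeFn_sub _ _).trans (hu.sub hV1)
  · rw [map_sub]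
    refine (Lp.coeFn_sub _ _).trans ((hG.sub hV2).trans (Eventually.of_forall fun x => ?_))
    exact (map_sub (InnerProductSpace.toDual ℝ Plane).symm _ _).symm

lemma exists_norm_sub_lt_of_tendsto {E : Type*} [NormedAddCommGroup E] {F : ℕ → ℝ≥0∞}
    (hF : Tendsto F atTop (𝓝 0)) {δ : ℝ} (hδ : 0 < δ) {P : ℕ → E → Prop} {U : E}
    (h : ∀ n, F n ≠ ⊤ → ∃ V, P n V ∧ ENNReal.ofReal (‖U - V‖ ^ 2) = F n) :
    ∃ n V, P n V ∧ ‖U - V‖ < δ := by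
  have hev := hF.eventually (gt_mem_nhds (show (0 : ℝ≥0∞) < ENNReal.ofReal (δ ^ 2) by
    simpa using by positivity))
  obtain ⟨n, hn⟩ := hev.exists
  obtain ⟨V, hP, hV⟩ := h n (ne_top_of_lt hn)
  refine ⟨n, V, hP, ?_⟩
  rw [← hV, ENNReal.ofReal_lt_ofReal_iff (by positivity)] at hn
  exact lt_of_pow_lt_pow_left₀ 2 hδ.le hn

/-- The gradient of the smoothing is `1 - ε` times the smoothing of the gradient, so its error
splits into the smoothing error of `g` and the vanishing term `ε g`. -/
lemma H1Gauss.exists_contDiff_near {Ω : Set Plane} (hΩ : IsOpen Ω) (hconv : Convex ℝ Ω)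
    (hne : Ω.Nonempty) (U : H1Gauss Ω) {δ : ℝ} (hδ : 0 < δ) :
    ∃ (f : Plane → ℝ) (V : H1Gauss Ω), ContDiff ℝ ∞ f ∧
      toL2 Ω V =ᵐ[gaussMeas.restrict Ω] f ∧
      grad Ω V =ᵐ[gaussMeas.restrict Ω] (fun x => dualVec (fderiv ℝ f x)) ∧ ‖U - V‖ < δ := by
  obtain ⟨a, ha⟩ := hne
  obtain ⟨r, hr, hball⟩ := Metric.nhds_basis_closedBall.mem_iff.1 (hΩ.mem_nhds ha)
  have hm := hΩ.measurableSet
  set u : Plane → ℝ := ⇑(toL2 Ω U) with hu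
  set g : Plane → Plane := ⇑(grad Ω U) with hg
  have hum : Measurable u := (Lp.stronglyMeasurable _).measurable
  have hgm : Measurable g := (Lp.stronglyMeasurable _).measurable
  have huL : MemLp u 2 (gaussMeas.restrict Ω) := Lp.memLp _
  have hgL : ∀ i, MemLp (fun x => g x i) 2 (gaussMeas.restrict Ω) := memLp_coord _
  have hgim : ∀ i, Measurable fun x => g x i := fun i =>
    (EuclideanSpace.proj i : Plane →L[ℝ] ℝ).continuous.measurable.comp hgm
  -- The shift by `2` ensures `ε n ≤ 1 / 2` already at `n = 0`.
  set ε : ℕ → ℝ := fun n => ((n : ℝ) + 2)⁻¹ with hεdef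
  have hε0 : ∀ n, 0 < ε n := fun n => by positivity
  have hε1 : ∀ n, ε n ≤ 1 / 2 := fun n => by
    rw [one_div]; exact inv_anti₀ (by norm_num) (by linarith [Nat.cast_nonneg (α := ℝ) n])
  have hε : Tendsto ε atTop (𝓝 0) :=
    tendsto_inv_atTop_zero.comp (tendsto_atTop_add_const_right _ _ tendsto_natCast_atTop_atTop)
  set φ : ℕ → ContDiffBump (0 : Plane) := fun n =>
    ⟨ε n * r / 2, ε n * r, half_pos (mul_pos (hε0 n) hr), half_lt_self (mul_pos (hε0 n) hr)⟩
    with hφdef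
  have hφ : ∀ n, (φ n).rOut ≤ ε n * r := fun n => le_rfl
  set f : ℕ → Plane → ℝ := fun n => smoothing (φ n) Ω a (ε n) u with hf
  have hui := locallyIntegrable_indicator_of_memLp hm huL
  have hfs : ∀ n, ContDiff ℝ ∞ (f n) := fun n =>
    ((φ n).hasCompactSupport_normed.contDiff_convolution_left _ (φ n).contDiff_normed hui).comp
      ((contDiff_id.const_smul (1 - ε n)).add contDiff_const)
  set G : Plane → Plane →L[ℝ] ℝ := fun x => InnerProductSpace.toDual ℝ Plane (g x) with hGdef
  have hGe : ∀ x i, G x (EuclideanSpace.single i 1) = g x i := fun x i => by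
    rw [← dualVec_apply]; simp [hGdef, dualVec]
  have htend : Tendsto (fun n => gaussEnergy Ω (u - f n) (fun x => G x - fderiv ℝ (f n) x)) atTop
      (𝓝 0) := by
    set A : (Plane → ℝ) → ℕ → ℝ≥0∞ := fun v n => ∫⁻ x in Ω,
      ENNReal.ofReal ((smoothing (φ n) Ω a (ε n) v x - v x) ^ 2 * gaussWeight x) with hA
    have hAt : ∀ v, Measurable v → MemLp v 2 (gaussMeas.restrict Ω) → Tendsto (A v) atTop (𝓝 0) :=
      fun v hv1 hv2 =>
        tendsto_lintegral_smoothing_sub hΩ hconv hball hε0 hε1 hε hφ hv1 hv2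
    set B : Fin 2 → ℝ≥0∞ := fun i => ∫⁻ x in Ω, ENNReal.ofReal (g x i ^ 2 * gaussWeight x) with hB
    have hBfin : ∀ i, B i ≠ ⊤ := fun i => by
      rw [hB]
      dsimp only
      rw [lintegral_ofReal_sq_mul_gaussWeight]
      exact ENNReal.pow_ne_top (hgL i).2.ne
    have hsum : Tendsto (fun n => A u n + ∑ i : Fin 2,
        (ENNReal.ofReal 2 * A (fun x => g x i) n + ENNReal.ofReal (2 * ε n ^ 2) * B i)) atTop (𝓝 0) := by
      have h1 : Tendsto (fun n => ENNReal.ofReal (2 * ε n ^ 2)) atTop (𝓝 0) := by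
        have := (ENNReal.continuous_ofReal.tendsto _).comp ((hε.pow 2).const_mul 2)
        simpa [Function.comp_def] using this
      have h2 : ∀ i : Fin 2, Tendsto (fun n => ENNReal.ofReal 2 * A (fun x => g x i) n +
          ENNReal.ofReal (2 * ε n ^ 2) * B i) atTop (𝓝 0) := by
        intro i
        have h3 := ENNReal.Tendsto.const_mul (a := ENNReal.ofReal 2) (hAt _ (hgim i) (hgL i))
          (Or.inr ENNReal.ofReal_ne_top)
        have h4 := ENNReal.Tendsto.mul_const (b := B i) h1 (Or.inr (hBfin i))
        simpa using h3.add h4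
      simpa using (hAt u hum huL).add (tendsto_finsetSum Finset.univ fun i _ => h2 i)
    refine tendsto_of_tendsto_of_tendsto_of_le_of_le tendsto_const_nhds hsum
      (fun n => zero_le) fun n => ?_
    have hSm : ∀ v, MemLp v 2 (gaussMeas.restrict Ω) → Measurable (smoothing (φ n) Ω a (ε n) v) :=
      fun v hv => (continuous_smoothing _ _ _ (locallyIntegrable_indicator_of_memLp hm hv)).measurable
    have hγm := continuous_gaussWeight.measurable
    have hpt : ∀ x ∈ Ω, ENNReal.ofReal (((u - f n) x ^ 2 + ‖G x - fderiv ℝ (f n) x‖ ^ 2) *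
        gaussWeight x) ≤
        ENNReal.ofReal ((smoothing (φ n) Ω a (ε n) u x - u x) ^ 2 * gaussWeight x) +
        ∑ i : Fin 2, (ENNReal.ofReal 2 * ENNReal.ofReal
          ((smoothing (φ n) Ω a (ε n) (fun y => g y i) x - g x i) ^ 2 * gaussWeight x) +
          ENNReal.ofReal (2 * ε n ^ 2) * ENNReal.ofReal (g x i ^ 2 * gaussWeight x)) := by
      intro x hx
      have hγ := (gaussWeight_pos x).le
      have h1 : ∀ i : Fin 2, (ENNReal.ofReal 2 * ENNReal.ofReal
          ((smoothing (φ n) Ω a (ε n) (fun y => g y i) x - g x i) ^ 2 * gaussWeight x) +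
          ENNReal.ofReal (2 * ε n ^ 2) * ENNReal.ofReal (g x i ^ 2 * gaussWeight x)) =
          ENNReal.ofReal ((2 * (smoothing (φ n) Ω a (ε n) (fun y => g y i) x - g x i) ^ 2 +
            2 * ε n ^ 2 * g x i ^ 2) * gaussWeight x) := by
        intro i
        rw [← ENNReal.ofReal_mul (by norm_num),
          ← ENNReal.ofReal_mul (by positivity), ← ENNReal.ofReal_add (by positivity)
          (by positivity)]
        congr 1; ring
      simp only [h1]
      rw [← ENNReal.ofReal_sum_of_nonneg (fun i _ => by positivity),
        ← ENNReal.ofReal_add (by positivity) (Finset.sum_nonneg fun i _ => by positivity)]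
      refine ENNReal.ofReal_le_ofReal ?_
      rw [← Finset.sum_mul, ← add_mul]
      refine mul_le_mul_of_nonneg_right ?_ hγ
      refine add_le_add (le_of_eq (by rw [Pi.sub_apply]; ring)) ?_
      rw [norm_sq_eq_sum_apply_single]
      refine Finset.sum_le_sum fun i _ => ?_
      rw [_root_.sub_apply, hGe, hf]
      dsimp only
      rw [(H1Gauss.isWeakGradient U).fderiv_smoothing hm hconv hball (φ n) (hε0 n) (hε1 n) (hφ n)
        hui hx i]
      change (g x i - (1 - ε n) * smoothing (φ n) Ω a (ε n) (fun y => g y i) x) ^ 2 ≤ _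
      generalize smoothing (φ n) Ω a (ε n) (fun y => g y i) x = S
      have h2 : (1 - ε n) ^ 2 ≤ 1 := by nlinarith [hε0 n, hε1 n]
      have h3 := mul_le_mul_of_nonneg_right h2 (sq_nonneg (S - g x i))
      nlinarith [sq_nonneg ((1 - ε n) * (g x i - S) - ε n * g x i)]
    refine (setLIntegral_mono' hm hpt).trans_eq ?_
    rw [lintegral_add_left]
    · congr 1
      rw [lintegral_finsetSum]
      · refine Finset.sum_congr rfl fun i _ => ?_
        rw [lintegral_add_left, lintegral_const_mul' _ _ ENNReal.ofReal_ne_top,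
          lintegral_const_mul' _ _ ENNReal.ofReal_ne_top]
        exact ((((hSm _ (hgL i)).sub (hgim i)).pow_const 2).mul hγm).ennreal_ofReal.const_mul _
      · intro i _
        exact (((((hSm _ (hgL i)).sub (hgim i)).pow_const 2).mul hγm).ennreal_ofReal.const_mul
          _).add ((((hgim i).pow_const 2).mul hγm).ennreal_ofReal.const_mul _)
    · exact ((((hSm _ huL).sub hum).pow_const 2).mul hγm).ennreal_ofReal
  obtain ⟨n, V, ⟨h1, h2⟩, h3⟩ := exists_norm_sub_lt_of_tendsto htend hδ (U := U)
    (P := fun n V => toL2 Ω V =ᵐ[gaussMeas.restrict Ω] f n ∧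
      grad Ω V =ᵐ[gaussMeas.restrict Ω] fun x => dualVec (fderiv ℝ (f n) x)) fun n hn => by
      obtain ⟨V, h1, h2, h3⟩ := H1Gauss.exists_near (U := U) (u := u) (G := G) (f := f n)
        EventuallyEq.rfl (Eventually.of_forall fun x => by simp [hGdef, dualVec, hg])
        ((hfs n).of_le (by simp)) hn
      exact ⟨V, ⟨h1, h2⟩, h3⟩
  exact ⟨f n, V, hfs n, h1, h2, h3⟩

/-- Dilations of one bump, so the gradients are uniformly bounded. Equality with `1` near a point,
not merely at it, makes the derivative vanish there too. -/
lemma exists_smooth_cutoffs : ∃ (χ : ℕ → Plane → ℝ) (B : ℝ), ∀ n, ContDiff ℝ ∞ (χ n) ∧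
    HasCompactSupport (χ n) ∧ (∀ x, 0 ≤ χ n x ∧ χ n x ≤ 1) ∧ (∀ x, ‖fderiv ℝ (χ n) x‖ ≤ B) ∧
    ∀ x, ‖x‖ < n → χ n =ᶠ[𝓝 x] 1 := by
  let φ : ContDiffBump (0 : Plane) := ⟨1, 2, one_pos, one_lt_two⟩
  obtain ⟨B, hB⟩ := (φ.hasCompactSupport.fderiv ℝ).exists_bound_of_continuous
    ((φ.contDiff (n := 1)).continuous_fderiv one_ne_zero)
  have hinv : ∀ n : ℕ, 0 < ((n : ℝ) + 1)⁻¹ := fun n => by positivity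
  refine ⟨fun n x => φ (((n : ℝ) + 1)⁻¹ • x), B, fun n => ⟨?_, ?_, ?_, ?_, ?_⟩⟩
  · exact φ.contDiff.comp (contDiff_id.const_smul _)
  · exact φ.hasCompactSupport.comp_smul (hinv n).ne'
  · exact fun x => ⟨φ.nonneg, φ.le_one⟩
  · intro x
    have h1 : HasFDerivAt (fun x : Plane => φ (((n : ℝ) + 1)⁻¹ • x)) _ x :=
      ((φ.contDiff (n := 1)).differentiable one_ne_zero _).hasFDerivAt.comp x
        ((hasFDerivAt_id x).const_smul ((n : ℝ) + 1)⁻¹)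
    rw [h1.fderiv, ContinuousLinearMap.comp_smul, ContinuousLinearMap.comp_id, norm_smul,
      Real.norm_of_nonneg (hinv n).le]
    have h2 : ((n : ℝ) + 1)⁻¹ ≤ 1 := inv_le_one_of_one_le₀ (by linarith [n.cast_nonneg (α := ℝ)])
    calc _ ≤ 1 * B := mul_le_mul h2 (hB _) (norm_nonneg _) zero_le_one
      _ = B := one_mul _
  · intro x hx
    have hmem : {y : Plane | ‖y‖ < n} ∈ 𝓝 x := (isOpen_lt continuous_norm continuous_const).mem_nhds hx
    filter_upwards [hmem] with y hy
    refine φ.one_of_mem_closedBall ?_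
    rw [mem_closedBall_zero_iff, norm_smul, Real.norm_of_nonneg (hinv n).le,
      inv_mul_le_iff₀ (by positivity)]
    change ‖y‖ ≤ (n + 1) * 1
    have : ‖y‖ < n := hy
    linarith

/-- Dominated convergence: at each point the integrand is eventually zero, and it is bounded by `3 +
2 B²` times the energy density of `f`. -/
lemma tendsto_gaussEnergy_cutoff {Ω : Set Plane} {f : Plane → ℝ} (hf : ContDiff ℝ 1 f)
    (hE : gaussEnergy Ω f (fderiv ℝ f) ≠ ⊤) {χ : ℕ → Plane → ℝ} {B : ℝ}
    (hχ : ∀ n, ContDiff ℝ ∞ (χ n)) (h01 : ∀ n x, 0 ≤ χ n x ∧ χ n x ≤ 1)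
    (hB : ∀ n x, ‖fderiv ℝ (χ n) x‖ ≤ B) (h1 : ∀ (n : ℕ) x, ‖x‖ < n → χ n =ᶠ[𝓝 x] 1) :
    Tendsto (fun n => gaussEnergy Ω (f - χ n * f) fun x => fderiv ℝ f x - fderiv ℝ (χ n * f) x)
      atTop (𝓝 0) := by
  have hχ1 : ∀ n, ContDiff ℝ 1 (χ n) := fun n => (hχ n).of_le (by simp)
  have hprod : ∀ n, ContDiff ℝ 1 (χ n * f) := fun n => (hχ1 n).mul hf
  have hf' := hf.continuous_fderiv one_ne_zero
  have hlim := tendsto_lintegral_of_dominated_convergence (μ := volume.restrict Ω)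
    (F := fun n x => ENNReal.ofReal (((f - χ n * f) x ^ 2 +
      ‖fderiv ℝ f x - fderiv ℝ (χ n * f) x‖ ^ 2) * gaussWeight x)) (f := fun _ => 0)
    (fun x => ENNReal.ofReal (3 + 2 * B ^ 2) *
      ENNReal.ofReal ((f x ^ 2 + ‖fderiv ℝ f x‖ ^ 2) * gaussWeight x)) ?_ ?_ ?_ ?_
  · simpa [gaussEnergy] using hlim
  · intro n
    have hc : Continuous fun x => ((f - χ n * f) x ^ 2 +
        ‖fderiv ℝ f x - fderiv ℝ (χ n * f) x‖ ^ 2) * gaussWeight x :=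
      ((((hf.sub (hprod n)).continuous.pow 2).add
        ((hf'.sub ((hprod n).continuous_fderiv one_ne_zero)).norm.pow 2))).mul
        continuous_gaussWeight
    exact hc.measurable.ennreal_ofReal
  · intro n
    refine Eventually.of_forall fun x => ?_
    have hγ := (gaussWeight_pos x).le
    dsimp only
    rw [← ENNReal.ofReal_mul (by positivity)]
    refine ENNReal.ofReal_le_ofReal ?_
    rw [← mul_assoc]
    refine mul_le_mul_of_nonneg_right ?_ hγ
    obtain ⟨h0, h1⟩ := h01 n x
    have hd : fderiv ℝ f x - fderiv ℝ (χ n * f) x =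
        (1 - χ n x) • fderiv ℝ f x - f x • fderiv ℝ (χ n) x := by
      rw [fderiv_mul ((hχ1 n).differentiable one_ne_zero x) (hf.differentiable one_ne_zero x)]
      module
    have hn1 : ‖fderiv ℝ f x - fderiv ℝ (χ n * f) x‖ ≤ ‖fderiv ℝ f x‖ + |f x| * B := by
      rw [hd]
      refine (norm_sub_le _ _).trans ?_
      rw [norm_smul, norm_smul, Real.norm_of_nonneg (show 0 ≤ 1 - χ n x by linarith),
        Real.norm_eq_abs]
      have := mul_le_mul_of_nonneg_right (show 1 - χ n x ≤ 1 by linarith)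
        (norm_nonneg (fderiv ℝ f x))
      have h3 := mul_le_mul_of_nonneg_left (hB n x) (abs_nonneg (f x))
      linarith
    have hn2 := pow_le_pow_left₀ (norm_nonneg _) hn1 2
    have hn3 : (f - χ n * f) x ^ 2 ≤ f x ^ 2 := by
      have : (f - χ n * f) x = (1 - χ n x) * f x := by simp; ring
      rw [this, mul_pow]
      have h4 : (1 - χ n x) ^ 2 ≤ 1 := by nlinarith
      nlinarith [sq_nonneg (f x)]
    have h5 := sq_abs (f x)
    have h6 : (‖fderiv ℝ f x‖ + |f x| * B) ^ 2 ≤ 2 * ‖fderiv ℝ f x‖ ^ 2 + 2 * (f x ^ 2 * B ^ 2) := by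
      rw [← h5]
      nlinarith [sq_nonneg (‖fderiv ℝ f x‖ - |f x| * B)]
    nlinarith [sq_nonneg (f x), sq_nonneg ‖fderiv ℝ f x‖,
      mul_nonneg (sq_nonneg B) (sq_nonneg ‖fderiv ℝ f x‖)]
  · rw [lintegral_const_mul' _ _ ENNReal.ofReal_ne_top]
    exact ENNReal.mul_ne_top ENNReal.ofReal_ne_top hE
  · refine Eventually.of_forall fun x => ?_
    refine tendsto_const_nhds.congr' ?_
    obtain ⟨m, hm⟩ := exists_nat_gt ‖x‖
    filter_upwards [eventually_ge_atTop m] with n hn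
    have h2 := h1 n x (hm.trans_le (by exact_mod_cast hn))
    have h3 : χ n * f =ᶠ[𝓝 x] f := by
      filter_upwards [h2] with y hy
      simp [hy]
    rw [h3.fderiv_eq]
    simp [h2.self_of_nhds]

/-- Test functions on the plane are dense in `H¹_γ(Ω)` for `Ω` convex. -/
theorem dense_smoothSubgroup {Ω : Set Plane} (hΩ : IsOpen Ω) (hconv : Convex ℝ Ω)
    (hne : Ω.Nonempty) : Dense (smoothSubgroup Ω : Set (H1Gauss Ω)) := by
  rw [Metric.dense_iff]
  intro U δ hδ
  obtain ⟨f, V, hf, hV1, hV2, hUV⟩ := H1Gauss.exists_contDiff_near hΩ hconv hne U (half_pos hδ)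
  obtain ⟨χ, B, hχ⟩ := exists_smooth_cutoffs
  have hf1 : ContDiff ℝ 1 f := hf.of_le (by simp)
  have hE : gaussEnergy Ω f (fderiv ℝ f) ≠ ⊤ := by
    rw [← H1Gauss.ofReal_norm_sq hV1 hV2]; exact ENNReal.ofReal_ne_top
  have htend := tendsto_gaussEnergy_cutoff hf1 hE (fun n => (hχ n).1) (fun n => (hχ n).2.2.1)
    (fun n => (hχ n).2.2.2.1) (fun n => (hχ n).2.2.2.2)
  obtain ⟨n, W, hW, hVW⟩ := exists_norm_sub_lt_of_tendsto htend (half_pos hδ) (U := V)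
    (P := fun n W => IsSmoothRep Ω W (χ n * f)) fun n hn => by
      obtain ⟨W, h1, h2, h3⟩ := H1Gauss.exists_near hV1 hV2
        (((hχ n).1.of_le (by simp)).mul hf1) hn
      exact ⟨W, ⟨(hχ n).1.mul hf, (hχ n).2.1.mul_right, h1, h2⟩, h3⟩
  refine ⟨W, ?_, ⟨_, hW⟩⟩
  rw [mem_ball, dist_comm, dist_eq_norm]
  calc ‖U - W‖ ≤ ‖U - V‖ + ‖V - W‖ := norm_sub_le_norm_sub_add_norm_sub _ _ _
    _ < δ := by linarith

/-! ### Grid averages and compactness -/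

/-- A Gaussian Poincaré inequality on small convex sets. -/
lemma Convex.lintegral_sq_sub_mean_le {Q : Set Plane} (hQ : Convex ℝ Q) (hm : MeasurableSet Q)
    {h γ₀ : ℝ} (hγ₀ : 0 < γ₀) (hdiam : ∀ x ∈ Q, ∀ y ∈ Q, dist x y ≤ h)
    (hγ : ∀ x ∈ Q, γ₀ ≤ gaussWeight x) {f : Plane → ℝ} (hf : ContDiff ℝ 1 f)
    (hfi : Integrable f gaussMeas) :
    ∫⁻ x in Q, ENNReal.ofReal ((f x - (gaussMeas.real Q)⁻¹ * ∫ y in Q, f y ∂gaussMeas) ^ 2)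
        ∂gaussMeas ≤
      ENNReal.ofReal (4 * h ^ 2 / γ₀ ^ 2) *
        ∫⁻ x in Q, ENNReal.ofReal (‖fderiv ℝ f x‖ ^ 2) ∂gaussMeas := by
  by_cases h0 : gaussMeas Q = 0
  · rw [Measure.restrict_eq_zero.2 h0]; simp
  have hle1 : ∀ F : Plane → ℝ≥0∞, ∫⁻ x in Q, F x ∂gaussMeas ≤ ∫⁻ x in Q, F x := by
    intro F
    rw [lintegral_gaussMeas_restrict]
    refine lintegral_mono fun x => ?_
    have : gaussWeight x ≤ 1 := by
      rw [gaussWeight, Real.exp_le_one_iff]; nlinarith [sq_nonneg ‖x‖]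
    calc _ ≤ 1 * F x := mul_le_mul_left (ENNReal.ofReal_le_one.2 this) _
      _ = F x := one_mul _
  have hle2 : ∀ F : Plane → ℝ≥0∞, ∫⁻ x in Q, F x ≤
      ENNReal.ofReal γ₀⁻¹ * ∫⁻ x in Q, F x ∂gaussMeas := by
    intro F
    rw [lintegral_gaussMeas_restrict, ← lintegral_const_mul' _ _ ENNReal.ofReal_ne_top]
    refine setLIntegral_mono' hm fun x hx => ?_
    rw [← mul_assoc, ← ENNReal.ofReal_mul (by positivity)]
    have : 1 ≤ γ₀⁻¹ * gaussWeight x := by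
      rw [inv_mul_eq_div, le_div_iff₀ hγ₀, one_mul]; exact hγ x hx
    calc F x = 1 * F x := (one_mul _).symm
      _ ≤ _ := mul_le_mul_left (ENNReal.one_le_ofReal.2 this) _
  have hvol : volume Q ≤ ENNReal.ofReal γ₀⁻¹ * gaussMeas Q := by
    simpa using hle2 fun _ => 1
  have hfin : gaussMeas Q ≠ ⊤ := measure_ne_top _ _
  -- The deviation from the mean is an average of differences against the normalised measure, so
  -- Jensen reduces the claim to the double integral in the Euclidean inequality.
  set ν := ProbabilityTheory.cond gaussMeas Q with hν
  have hνp : IsProbabilityMeasure ν := ProbabilityTheory.cond_isProbabilityMeasure h0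
  have hc : (gaussMeas.real Q)⁻¹ * ∫ y in Q, f y ∂gaussMeas = ∫ y, f y ∂ν := by
    rw [hν, ProbabilityTheory.cond, integral_smul_measure, ENNReal.toReal_inv]; rfl
  have hfν : Integrable f ν :=
    (hfi.restrict (s := Q)).smul_measure (ENNReal.inv_ne_top.2 h0)
  have hpt : ∀ x, ENNReal.ofReal
      ((f x - (gaussMeas.real Q)⁻¹ * ∫ y in Q, f y ∂gaussMeas) ^ 2) ≤
      (gaussMeas Q)⁻¹ * ∫⁻ y in Q, ENNReal.ofReal ((f x - f y) ^ 2) := by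
    intro x
    have e : f x - (gaussMeas.real Q)⁻¹ * ∫ y in Q, f y ∂gaussMeas = ∫ y, (f x - f y) ∂ν := by
      rw [hc, integral_sub (integrable_const _) hfν]; simp
    rw [e]
    refine (ofReal_sq_integral_le_lintegral ν
      (continuous_const.sub hf.continuous).aestronglyMeasurable).trans ?_
    rw [hν, ProbabilityTheory.cond, lintegral_smul_measure, smul_eq_mul]
    exact mul_le_mul_right (hle1 _) _
  calc _ ≤ ∫⁻ x in Q, ENNReal.ofReal
        ((f x - (gaussMeas.real Q)⁻¹ * ∫ y in Q, f y ∂gaussMeas) ^ 2) := hle1 _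
    _ ≤ ∫⁻ x in Q, (gaussMeas Q)⁻¹ * ∫⁻ y in Q, ENNReal.ofReal ((f x - f y) ^ 2) :=
        lintegral_mono hpt
    _ ≤ (gaussMeas Q)⁻¹ * (ENNReal.ofReal (4 * h ^ 2) * volume Q *
          ∫⁻ x in Q, ENNReal.ofReal (‖fderiv ℝ f x‖ ^ 2)) := by
        rw [lintegral_const_mul' _ _ (ENNReal.inv_ne_top.2 h0)]
        exact mul_le_mul_right (hQ.lintegral_sq_sub_le hm hdiam hf) _
    -- Two factors `γ₀⁻¹`: one for replacing the area of `Q`, one for replacing the gradient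
    -- integral. The bound `γ ≤ 1` used elsewhere is free.
    _ ≤ (gaussMeas Q)⁻¹ * (ENNReal.ofReal (4 * h ^ 2) * (ENNReal.ofReal γ₀⁻¹ * gaussMeas Q) *
          (ENNReal.ofReal γ₀⁻¹ *
            ∫⁻ x in Q, ENNReal.ofReal (‖fderiv ℝ f x‖ ^ 2) ∂gaussMeas)) := by
        gcongr
        exact hle2 _
    _ = ((gaussMeas Q)⁻¹ * gaussMeas Q) * (ENNReal.ofReal (4 * h ^ 2) * ENNReal.ofReal γ₀⁻¹ *
          ENNReal.ofReal γ₀⁻¹) *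
            ∫⁻ x in Q, ENNReal.ofReal (‖fderiv ℝ f x‖ ^ 2) ∂gaussMeas := by ring
    _ = _ := by
        rw [ENNReal.inv_mul_cancel h0 hfin, one_mul, ← ENNReal.ofReal_mul (by positivity),
          ← ENNReal.ofReal_mul (by positivity)]
        congr 2
        field_simp

/-- The index of the cell of the grid of mesh `1 / N` containing a point. -/
def gridIndex (N : ℕ) (x : Plane) (i : Fin 2) : ℤ := ⌊x i * N⌋

/-- The cells of the grid of mesh `1 / N`. -/
def gridCell (N : ℕ) (k : Fin 2 → ℤ) : Set Plane := {x | gridIndex N x = k}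

lemma mem_gridCell {N : ℕ} {k : Fin 2 → ℤ} {x : Plane} :
    x ∈ gridCell N k ↔ ∀ i, x i * N ∈ Ico (k i : ℝ) (k i + 1) := by
  simp only [gridCell, mem_ofPred_eq, funext_iff, gridIndex, Int.floor_eq_iff, mem_Ico]

lemma measurableSet_gridCell (N : ℕ) (k : Fin 2 → ℤ) : MeasurableSet (gridCell N k) := by
  have : gridCell N k = ⋂ i, (fun x : Plane => x i * N) ⁻¹' Ico (k i : ℝ) (k i + 1) := by
    ext x; simp only [mem_gridCell, mem_iInter, mem_preimage]
  rw [this]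
  refine MeasurableSet.iInter fun i => measurableSet_Ico.preimage ?_
  exact Continuous.measurable (by fun_prop)

lemma convex_gridCell (N : ℕ) (k : Fin 2 → ℤ) : Convex ℝ (gridCell N k) := by
  intro x hx y hy s t hs ht hst
  rw [mem_gridCell] at hx hy ⊢
  intro i
  have := convex_Ico (k i : ℝ) (k i + 1) (hx i) (hy i) hs ht hst
  convert this using 1
  simp only [PiLp.add_apply, PiLp.smul_apply, smul_eq_mul]
  ring

lemma dist_le_of_mem_gridCell {N : ℕ} (hN : 0 < N) {k : Fin 2 → ℤ} {x y : Plane}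
    (hx : x ∈ gridCell N k) (hy : y ∈ gridCell N k) : dist x y ≤ 2 / N := by
  rw [mem_gridCell] at hx hy
  have hN' : (0 : ℝ) < N := by exact_mod_cast hN
  have hi : ∀ i, (x i - y i) ^ 2 ≤ (1 / N) ^ 2 := by
    intro i
    rw [← sq_abs]
    refine pow_le_pow_left₀ (abs_nonneg _) ?_ 2
    rw [abs_le, ← neg_div, div_le_iff₀ hN', le_div_iff₀ hN']
    have h1 := hx i
    have h2 := hy i
    rw [mem_Ico] at h1 h2
    constructor <;> linarith
  rw [dist_eq_norm, ← pow_le_pow_iff_left₀ (norm_nonneg _) (by positivity) two_ne_zero,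
    EuclideanSpace.real_norm_sq_eq, Fin.sum_univ_two]
  have h0 := hi 0
  have h1 := hi 1
  simp only [PiLp.sub_apply]
  have e : (2 / (N : ℝ)) ^ 2 = 4 * (1 / N) ^ 2 := by ring
  rw [e]
  nlinarith [sq_nonneg (1 / (N : ℝ))]

/-- The cells of the grid of mesh `1 / N` covering the square `[-R, R)²`. -/
def gridSquare (N R : ℕ) : Finset (Fin 2 → ℤ) :=
  Fintype.piFinset fun _ => Finset.Ico (-(R * N : ℤ)) (R * N)

lemma gridIndex_mem_gridSquare {N R : ℕ} (hN : 0 < N) {x : Plane} :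
    gridIndex N x ∈ gridSquare N R ↔ ∀ i, x i ∈ Ico (-R : ℝ) R := by
  have hN' : (0 : ℝ) < N := by exact_mod_cast hN
  simp only [gridSquare, Fintype.mem_piFinset, Finset.mem_Ico, gridIndex, mem_Ico, Int.le_floor,
    Int.floor_lt]
  refine forall_congr' fun i => ?_
  push_cast
  rw [mul_lt_mul_iff_left₀ hN', ← neg_mul, mul_le_mul_iff_left₀ hN']

lemma norm_ge_of_gridIndex_notMem {N R : ℕ} (hN : 0 < N) {x : Plane}
    (hx : gridIndex N x ∉ gridSquare N R) : (R : ℝ) ≤ ‖x‖ := by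
  rw [gridIndex_mem_gridSquare hN] at hx
  push Not at hx
  obtain ⟨i, hi⟩ := hx
  have h1 := PiLp.norm_apply_le x i
  rw [Real.norm_eq_abs] at h1
  refine le_trans ?_ h1
  rw [mem_Ico, not_and_or] at hi
  rcases hi with hi | hi
  · exact le_abs.2 (Or.inr (by linarith))
  · exact le_abs.2 (Or.inl (by linarith))

lemma gaussWeight_ge_of_gridIndex_mem {N R : ℕ} (hN : 0 < N) {x : Plane}
    (hx : gridIndex N x ∈ gridSquare N R) : Real.exp (-(R : ℝ) ^ 2) ≤ gaussWeight x := by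
  rw [gridIndex_mem_gridSquare hN] at hx
  rw [gaussWeight, Real.exp_le_exp, EuclideanSpace.real_norm_sq_eq, Fin.sum_univ_two]
  -- Each coordinate contributes at most `R²`, so `|x|² / 2 ≤ R²`.
  have h : ∀ i, x i ^ 2 ≤ (R : ℝ) ^ 2 := fun i => by
    have := hx i
    rw [mem_Ico] at this
    exact sq_le_sq' this.1 this.2.le
  linarith [h 0, h 1]

/-- The finite rank operator averaging over the cells of the grid of mesh `1 / N` in
`[-R, R)²`. -/
def gridAverage (Ω : Set Plane) (N R : ℕ) : L2Gauss Ω →L[ℝ] L2Gauss Ω :=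
  -- A cell of measure zero is harmless: its inverse measure is `0` by convention.
  ∑ k ∈ gridSquare N R, (((gaussMeas.restrict Ω).real (gridCell N k))⁻¹ •
    innerSL ℝ (indicatorConstLp 2 (measurableSet_gridCell N k)
      (measure_ne_top (gaussMeas.restrict Ω) _) (1 : ℝ))).smulRight
    (indicatorConstLp 2 (measurableSet_gridCell N k)
      (measure_ne_top (gaussMeas.restrict Ω) _) (1 : ℝ))

/-- Each summand factors through `ℝ`. -/
lemma isCompactOperator_gridAverage (Ω : Set Plane) (N R : ℕ) :
    IsCompactOperator (gridAverage Ω N R) := by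
  have h : gridAverage Ω N R ∈ compactOperator (RingHom.id ℝ) (L2Gauss Ω) (L2Gauss Ω) := by
    refine Submodule.sum_mem _ fun k _ => ?_
    have h1 : IsCompactOperator (ContinuousLinearMap.id ℝ ℝ) :=
      isCompactOperator_id_iff_locallyCompactSpace.2 inferInstance
    exact (h1.comp_clm (((gaussMeas.restrict Ω).real (gridCell N k))⁻¹ •
      innerSL ℝ (indicatorConstLp 2 (measurableSet_gridCell N k)
        (measure_ne_top (gaussMeas.restrict Ω) _) (1 : ℝ)))).clm_comp
      ((ContinuousLinearMap.id ℝ ℝ).smulRight (indicatorConstLp 2 (measurableSet_gridCell N k)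
        (measure_ne_top (gaussMeas.restrict Ω) _) (1 : ℝ)))
  exact h

lemma gridAverage_ae (Ω : Set Plane) (N R : ℕ) (v : L2Gauss Ω) :
    gridAverage Ω N R v =ᵐ[gaussMeas.restrict Ω] fun x => ∑ k ∈ gridSquare N R,
      (gridCell N k).indicator (fun _ => ((gaussMeas.restrict Ω).real (gridCell N k))⁻¹ *
        ∫ y in gridCell N k, v y ∂(gaussMeas.restrict Ω)) x := by
  rw [gridAverage, _root_.sum_apply]
  induction gridSquare N R using Finset.induction_on with
  | empty =>
    simp only [Finset.sum_empty]
    exact Lp.coeFn_zero ℝ 2 (gaussMeas.restrict Ω)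
  | insert k F hk ih =>
    rw [Finset.sum_insert hk]
    refine (Lp.coeFn_add _ _).trans ?_
    simp only [Finset.sum_insert hk]
    refine EventuallyEq.add ?_ ih
    rw [ContinuousLinearMap.smulRight_apply]
    refine (Lp.coeFn_smul _ _).trans ?_
    filter_upwards [indicatorConstLp_coeFn (p := 2) (μ := gaussMeas.restrict Ω)
      (hs := measurableSet_gridCell N k) (hμs := measure_ne_top _ _) (c := (1 : ℝ))] with x hx
    rw [Pi.smul_apply, hx, _root_.smul_apply, innerSL_apply_apply,
      L2.inner_indicatorConstLp_one]
    by_cases hxk : x ∈ gridCell N k <;> simp [hxk]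

/-- On a cell of the square, the Poincaré inequality applies to the convex set cell `∩ Ω`, of
diameter at most `2 / N`, where the weight is at least `exp (-R²)`. Off the square the average is
zero and `|x| ≥ R`, so the moment bound gains `R⁻²`. -/
lemma gridAverage_error {Ω : Set Plane} (hΩ : IsOpen Ω) (hconv : Convex ℝ Ω) {a : Plane}
    (ha : a ∈ Ω) {N R : ℕ} (hN : 0 < N) (hR : 0 < R) {U : H1Gauss Ω} {f : Plane → ℝ}
    (hU : IsSmoothRep Ω U f) :
    ENNReal.ofReal (‖H1Gauss.toL2 Ω U - gridAverage Ω N R (H1Gauss.toL2 Ω U)‖ ^ 2) ≤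
      ENNReal.ofReal ((4 * (2 / N) ^ 2 / Real.exp (-(R : ℝ) ^ 2) ^ 2 +
        (32 + 3 * ‖a‖ ^ 2) / R ^ 2) * ‖U‖ ^ 2) := by
  have hm := hΩ.measurableSet
  have hf1 : ContDiff ℝ 1 f := hU.contDiff.of_le (by simp)
  have hfi : Integrable f gaussMeas := by
    obtain ⟨B, hB⟩ := hU.hasCompactSupport.exists_bound_of_continuous hf1.continuous
    exact Integrable.of_bound hf1.continuous.aestronglyMeasurable B (Eventually.of_forall hB)
  have hR' : (0 : ℝ) < R := by exact_mod_cast hR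
  set μ := gaussMeas.restrict Ω with hμ
  set K1 : ℝ := 4 * (2 / N) ^ 2 / Real.exp (-(R : ℝ) ^ 2) ^ 2 with hK1
  set K2 : ℝ := (32 + 3 * ‖a‖ ^ 2) / R ^ 2 with hK2
  have hK1p : 0 ≤ K1 := by positivity
  have hK2p : 0 ≤ K2 := by positivity
  set c : (Fin 2 → ℤ) → ℝ := fun k => (μ.real (gridCell N k))⁻¹ *
    ∫ y in gridCell N k, f y ∂μ with hc
  have hae : ⇑(H1Gauss.toL2 Ω U - gridAverage Ω N R (H1Gauss.toL2 Ω U)) =ᵐ[μ]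
      fun x => f x - ∑ k ∈ gridSquare N R, (gridCell N k).indicator (fun _ => c k) x := by
    refine (Lp.coeFn_sub _ _).trans (hU.toL2_ae.sub ((gridAverage_ae Ω N R _).trans ?_))
    refine Eventually.of_forall fun x => Finset.sum_congr rfl fun k _ => ?_
    have : ∫ y in gridCell N k, H1Gauss.toL2 Ω U y ∂μ = ∫ y in gridCell N k, f y ∂μ :=
      integral_congr_ae (ae_restrict_of_ae hU.toL2_ae)
    rw [this]
  set D : Set Plane := ⋃ k ∈ gridSquare N R, gridCell N k with hD
  have hDm : MeasurableSet D :=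
    Finset.measurableSet_biUnion _ fun k _ => measurableSet_gridCell N k
  have hDmem : ∀ x, x ∈ D ↔ gridIndex N x ∈ gridSquare N R := fun x => by
    simp [hD, gridCell]
  have hdisj : (gridSquare N R : Set (Fin 2 → ℤ)).PairwiseDisjoint (gridCell N) := by
    intro k _ l _ hkl
    refine Set.disjoint_left.2 fun x hx hx' => hkl ?_
    exact (show gridIndex N x = k from hx).symm.trans hx'
  rw [ofReal_norm_sq_eq_lintegral hae, ENNReal.ofReal_mul (by positivity),
    H1Gauss.ofReal_norm_sq hU.toL2_ae hU.grad_ae, ← lintegral_add_compl _ hDm,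
    ENNReal.ofReal_add hK1p hK2p, add_mul]
  refine add_le_add ?_ ?_
  · rw [hD, lintegral_biUnion_finset hdisj fun k _ => measurableSet_gridCell N k]
    calc ∑ k ∈ gridSquare N R, ∫⁻ x in gridCell N k, ENNReal.ofReal
          (‖f x - ∑ k ∈ gridSquare N R, (gridCell N k).indicator (fun _ => c k) x‖ ^ 2) ∂μ
        ≤ ∑ k ∈ gridSquare N R, ENNReal.ofReal K1 *
          ∫⁻ x in gridCell N k, ENNReal.ofReal (‖fderiv ℝ f x‖ ^ 2) ∂μ := by
          refine Finset.sum_le_sum fun k hk => ?_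
          have hmk := measurableSet_gridCell N k
          have hrr : μ.restrict (gridCell N k) = gaussMeas.restrict (gridCell N k ∩ Ω) :=
            Measure.restrict_restrict hmk
          have hck : c k = (gaussMeas.real (gridCell N k ∩ Ω))⁻¹ *
              ∫ y in gridCell N k ∩ Ω, f y ∂gaussMeas := by
            rw [hc]
            dsimp only
            rw [hrr, hμ, measureReal_restrict_apply hmk]
          have h1 : ∀ x ∈ gridCell N k, ENNReal.ofReal
              (‖f x - ∑ k ∈ gridSquare N R, (gridCell N k).indicator (fun _ => c k) x‖ ^ 2) =
              ENNReal.ofReal ((f x - c k) ^ 2) := by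
            intro x hx
            rw [Finset.sum_eq_single k, indicator_of_mem hx, Real.norm_eq_abs, sq_abs]
            · intro l _ hlk
              refine indicator_of_notMem (fun hx' => hlk ?_) _
              exact (show gridIndex N x = l from hx').symm.trans hx
            · exact fun h => absurd hk h
          rw [setLIntegral_congr_fun hmk h1, hrr, hck]
          refine Convex.lintegral_sq_sub_mean_le ((convex_gridCell N k).inter hconv)
            (hmk.inter hm) (Real.exp_pos _)
            (fun x hx y hy => dist_le_of_mem_gridCell hN hx.1 hy.1) (fun x hx => ?_) hf1 hfi
          refine gaussWeight_ge_of_gridIndex_mem hN ?_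
          rw [show gridIndex N x = k from hx.1]; exact hk
      _ = ENNReal.ofReal K1 * ∫⁻ x in D, ENNReal.ofReal (‖fderiv ℝ f x‖ ^ 2) ∂μ := by
          rw [← Finset.mul_sum, hD,
            lintegral_biUnion_finset hdisj fun k _ => measurableSet_gridCell N k]
      _ ≤ ENNReal.ofReal K1 * gaussEnergy Ω f (fderiv ℝ f) := by
          gcongr
          refine (setLIntegral_le_lintegral _ _).trans ?_
          rw [hμ, lintegral_gaussMeas_restrict, gaussEnergy]
          refine lintegral_mono fun x => ?_
          have hγ := (gaussWeight_pos x).le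
          rw [← ENNReal.ofReal_mul hγ, mul_comm]
          refine ENNReal.ofReal_le_ofReal (mul_le_mul_of_nonneg_right ?_ hγ)
          nlinarith [sq_nonneg (f x)]
  · calc ∫⁻ x in Dᶜ, ENNReal.ofReal
          (‖f x - ∑ k ∈ gridSquare N R, (gridCell N k).indicator (fun _ => c k) x‖ ^ 2) ∂μ
        ≤ ∫⁻ x in Dᶜ, ENNReal.ofReal (((R : ℝ) ^ 2)⁻¹ * (‖x‖ ^ 2 * f x ^ 2)) ∂μ := by
          refine setLIntegral_mono' hDm.compl fun x hx => ?_
          have hx' : gridIndex N x ∉ gridSquare N R := fun h => hx ((hDmem x).2 h)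
          rw [Finset.sum_eq_zero fun l hl => indicator_of_notMem (fun h => hx' (by
            rw [show gridIndex N x = l from h]; exact hl)) _, sub_zero, Real.norm_eq_abs, sq_abs]
          refine ENNReal.ofReal_le_ofReal ?_
          have h1 := norm_ge_of_gridIndex_notMem hN hx'
          have h2 : (R : ℝ) ^ 2 ≤ ‖x‖ ^ 2 := by gcongr
          rw [inv_mul_eq_div, le_div_iff₀ (by positivity)]
          nlinarith [sq_nonneg (f x)]
      _ ≤ ∫⁻ x, ENNReal.ofReal (((R : ℝ) ^ 2)⁻¹ * (‖x‖ ^ 2 * f x ^ 2)) ∂μ :=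
          setLIntegral_le_lintegral _ _
      _ = ENNReal.ofReal (((R : ℝ) ^ 2)⁻¹) *
            ∫⁻ x in Ω, ENNReal.ofReal (‖x‖ ^ 2 * f x ^ 2 * gaussWeight x) := by
          rw [hμ, lintegral_gaussMeas_restrict, ← lintegral_const_mul' _ _ ENNReal.ofReal_ne_top]
          refine lintegral_congr fun x => ?_
          rw [← ENNReal.ofReal_mul (gaussWeight_pos x).le, ← ENNReal.ofReal_mul (by positivity)]
          congr 1; ring
      _ ≤ ENNReal.ofReal (((R : ℝ) ^ 2)⁻¹) * (ENNReal.ofReal (32 + 3 * ‖a‖ ^ 2) *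
            gaussEnergy Ω f (fderiv ℝ f)) := by
          gcongr
          exact lintegral_norm_sq_mul_le_gaussEnergy hm hconv ha hf1 hU.hasCompactSupport
      _ = ENNReal.ofReal K2 * gaussEnergy Ω f (fderiv ℝ f) := by
          rw [← mul_assoc, ← ENNReal.ofReal_mul (by positivity), hK2, inv_mul_eq_div]

/-- The embedding `H¹_γ(Ω) → L²_γ(Ω)` is compact for `Ω` convex. -/
theorem isCompactOperator_toL2 {Ω : Set Plane} (hΩ : IsOpen Ω) (hconv : Convex ℝ Ω)
    (hne : Ω.Nonempty) : IsCompactOperator (H1Gauss.toL2 Ω) := by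
  obtain ⟨a, ha⟩ := hne
  have hcl : IsClosed {f : H1Gauss Ω →L[ℝ] L2Gauss Ω | IsCompactOperator f} :=
    isClosed_setOfPred_isCompactOperator
  refine hcl.closure_subset ?_
  refine (@Metric.mem_closure_iff (H1Gauss Ω →L[ℝ] L2Gauss Ω)
    SeminormedAddCommGroup.toPseudoMetricSpace _ _).2 fun δ hδ => ?_
  set A : ℝ := 32 + 3 * ‖a‖ ^ 2 with hA
  have hlim1 : Tendsto (fun R : ℕ => A / (R : ℝ) ^ 2) atTop (𝓝 0) :=
    tendsto_const_nhds.div_atTop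
      ((tendsto_pow_atTop two_ne_zero).comp tendsto_natCast_atTop_atTop)
  -- `R` must be fixed before `N`, since the cell error carries the factor `exp (2 R²)`.
  obtain ⟨R, hR, hR0⟩ := ((hlim1.eventually (gt_mem_nhds
    (show (0 : ℝ) < (δ / 2) ^ 2 / 2 by positivity))).and (eventually_gt_atTop 0)).exists
  have hlim2 : Tendsto (fun N : ℕ => 4 * (2 / (N : ℝ)) ^ 2 / Real.exp (-(R : ℝ) ^ 2) ^ 2) atTop
      (𝓝 0) := by
    have h1 : Tendsto (fun N : ℕ => 2 / (N : ℝ)) atTop (𝓝 0) :=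
      tendsto_const_nhds.div_atTop tendsto_natCast_atTop_atTop
    simpa using ((h1.pow 2).const_mul 4).div_const (Real.exp (-(R : ℝ) ^ 2) ^ 2)
  obtain ⟨N, hN, hN0⟩ := ((hlim2.eventually (gt_mem_nhds
    (show (0 : ℝ) < (δ / 2) ^ 2 / 2 by positivity))).and (eventually_gt_atTop 0)).exists
  refine ⟨(gridAverage Ω N R).comp (H1Gauss.toL2 Ω),
    (isCompactOperator_gridAverage Ω N R).comp_clm _, ?_⟩
  rw [dist_eq_norm]
  refine (ContinuousLinearMap.opNorm_le_bound _ (half_pos hδ).le fun U => ?_).trans_lt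
    (half_lt_self hδ)
  set T := H1Gauss.toL2 Ω - (gridAverage Ω N R).comp (H1Gauss.toL2 Ω) with hT
  -- The estimate is a closed condition on `U`, so it need only be checked on the dense subgroup.
  have hclosed : IsClosed {U : H1Gauss Ω | ‖T U‖ ≤ δ / 2 * ‖U‖} :=
    isClosed_le T.continuous.norm (continuous_const.mul continuous_norm)
  refine hclosed.closure_subset_iff.2 ?_ ((dense_smoothSubgroup hΩ hconv ⟨a, ha⟩) U)
  rintro V ⟨f, hV⟩
  have h1 := gridAverage_error hΩ hconv ha hN0 hR0 hV
  rw [ENNReal.ofReal_le_ofReal_iff (by positivity)] at h1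
  change ‖T V‖ ≤ δ / 2 * ‖V‖
  refine le_of_sq_le_sq ?_ (by positivity)
  calc ‖T V‖ ^ 2 ≤ _ := h1
    _ ≤ (δ / 2 * ‖V‖) ^ 2 := by
      rw [mul_pow]
      refine mul_le_mul_of_nonneg_right ?_ (sq_nonneg _)
      linarith

/-! ### The averaged reflection -/

/-- The uniform probability measure on the unit disc. -/
abbrev discMeas : Measure Plane := ProbabilityTheory.cond volume (ball (0 : Plane) 1)

instance : IsProbabilityMeasure discMeas :=
  ProbabilityTheory.cond_isProbabilityMeasure_of_finite (measure_ball_pos _ _ one_pos).ne'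
    measure_ball_lt_top.ne

lemma ae_discMeas_norm_le : ∀ᵐ θ ∂discMeas, ‖θ‖ ≤ 1 := by
  filter_upwards [ProbabilityTheory.ae_cond_mem (μ := volume)
    (measurableSet_ball (x := (0 : Plane)) (ε := 1))] with θ hθ
  exact (mem_ball_zero_iff.1 hθ).le

lemma sq_integral_le_integral_sq {α : Type*} [MeasurableSpace α] (μ : Measure α)
    [IsProbabilityMeasure μ] {g : α → ℝ} (hg : AEStronglyMeasurable g μ)
    (hg2 : Integrable (fun x => g x ^ 2) μ) : (∫ x, g x ∂μ) ^ 2 ≤ ∫ x, g x ^ 2 ∂μ := by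
  have h := ofReal_sq_integral_le_lintegral μ hg
  rw [← ofReal_integral_eq_lintegral_ofReal hg2 (Eventually.of_forall fun x => sq_nonneg _),
    ENNReal.ofReal_le_ofReal_iff (integral_nonneg fun x => sq_nonneg _)] at h
  exact h

/-- First order Taylor bound whose remainder constant does not depend on the base point, so it can
be averaged over `θ`. -/
lemma abs_sub_le_of_lipschitzWith_fderiv {w : Plane → ℝ} (hw : ContDiff ℝ 1 w) {K : NNReal}
    (hK : LipschitzWith K (fderiv ℝ w)) (a b : Plane) :
    |w b - w a| ≤ ‖fderiv ℝ w a‖ * ‖b - a‖ + K * ‖b - a‖ ^ 2 := by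
  have h := (convex_closedBall a ‖b - a‖).norm_image_sub_le_of_norm_fderiv_le' (𝕜 := ℝ) (f := w)
    (φ := fderiv ℝ w a) (C := K * ‖b - a‖)
    (fun x _ => hw.differentiable one_ne_zero x) (fun x hx => by
      rw [← dist_eq_norm]
      refine (hK.dist_le_mul x a).trans ?_
      gcongr
      exact hx) (mem_closedBall_self (norm_nonneg _)) (y := b) (by simp [dist_eq_norm])
  have h2 := (fderiv ℝ w a).le_opNorm (b - a)
  rw [Real.norm_eq_abs] at h h2
  have h3 := abs_sub_abs_le_abs_sub (w b - w a) (fderiv ℝ w a (b - a))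
  nlinarith

namespace InwardMap

variable {Ω : Set Plane} (T : InwardMap Ω)

/-- The points averaged over by the reflection operator. -/
def point (y θ : Plane) : Plane := T.toFun y + (T.c * min (infDist y Ω) 1) • θ

/-- The averaged reflection of `w`, cut off at distance one from `Ω`. -/
def reflection (w : Plane → ℝ) (y : Plane) : ℝ :=
  max 0 (1 - infDist y Ω) * ∫ θ, w (T.point y θ) ∂discMeas

lemma continuous_point (y : Plane) : Continuous (T.point y) := by
  unfold point; fun_prop

lemma dist_point_le {θ : Plane} (hθ : ‖θ‖ ≤ 1) (x y : Plane) :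
    ‖T.point x θ - T.point y θ‖ ≤ (T.lip + T.c) * ‖x - y‖ := by
  have h1 := T.lipschitz.dist_le_mul x y
  have h2 : |min (infDist x Ω) 1 - min (infDist y Ω) 1| ≤ ‖x - y‖ := by
    have := ((lipschitz_infDist_pt Ω).min_const 1).dist_le_mul x y
    rw [NNReal.coe_one, one_mul, Real.dist_eq, dist_eq_norm] at this
    exact this
  rw [dist_eq_norm, dist_eq_norm] at h1
  have e : T.point x θ - T.point y θ = (T.toFun x - T.toFun y) +
      (T.c * (min (infDist x Ω) 1 - min (infDist y Ω) 1)) • θ := by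
    unfold point; module
  rw [e]
  refine (norm_add_le _ _).trans ?_
  rw [norm_smul, norm_mul, Real.norm_of_nonneg T.c_pos.le, Real.norm_eq_abs, add_mul]
  refine add_le_add h1 ?_
  calc _ ≤ T.c * |min (infDist x Ω) 1 - min (infDist y Ω) 1| * 1 := by
        gcongr; exact mul_nonneg T.c_pos.le (abs_nonneg _)
    _ ≤ T.c * ‖x - y‖ := by
        rw [mul_one]; exact mul_le_mul_of_nonneg_left h2 T.c_pos.le

/-- Sampling moves points by a bounded amount, so `|y|` and the norm of a sampled point differ by a
constant. -/
lemma norm_point_sub_le {θ : Plane} (hθ : ‖θ‖ ≤ 1) {y : Plane} (hy : infDist y Ω ≤ 1) :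
    ‖T.point y θ - y‖ ≤ T.M + T.c := by
  have h1 := T.dist_le y hy
  rw [dist_eq_norm] at h1
  have e : T.point y θ - y = (T.toFun y - y) + (T.c * min (infDist y Ω) 1) • θ := by
    unfold point; abel
  have h2 : 0 ≤ min (infDist y Ω) 1 := le_min infDist_nonneg zero_le_one
  rw [e]
  refine (norm_add_le _ _).trans (add_le_add (h1.trans ?_) ?_)
  · exact mul_le_of_le_one_right T.M_nonneg hy
  · rw [norm_smul, Real.norm_of_nonneg (mul_nonneg T.c_pos.le h2)]
    calc _ ≤ T.c * 1 * 1 := by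
          have := T.c_pos
          gcongr
          exact min_le_right _ _
      _ = T.c := by ring

lemma integrable_comp_point {g : Plane → ℝ} (hg : Continuous g) {B : ℝ} (hB : ∀ x, ‖g x‖ ≤ B)
    (y : Plane) : Integrable (fun θ => g (T.point y θ)) discMeas :=
  Integrable.of_bound (hg.comp (T.continuous_point y)).aestronglyMeasurable B
    (Eventually.of_forall fun _ => hB _)

lemma reflection_eq_self (w : Plane → ℝ) {y : Plane} (hy : y ∈ Ω) : T.reflection w y = w y := by
  have h0 : infDist y Ω = 0 := infDist_zero_of_mem hy
  simp [reflection, point, h0, T.eq_self y (subset_closure hy)]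

lemma reflection_eq_zero (w : Plane → ℝ) {y : Plane} (hy : 1 ≤ infDist y Ω) :
    T.reflection w y = 0 := by
  rw [reflection, max_eq_left (by linarith), zero_mul]

lemma abs_reflection_le {w : Plane → ℝ} (y : Plane) :
    |T.reflection w y| ≤ ∫ θ, |w (T.point y θ)| ∂discMeas := by
  rw [reflection, abs_mul, abs_of_nonneg (le_max_left _ _)]
  have h1 : max 0 (1 - infDist y Ω) ≤ 1 := max_le zero_le_one (by linarith [infDist_nonneg (x := y) (s := Ω)])
  have h2 : |∫ θ, w (T.point y θ) ∂discMeas| ≤ ∫ θ, |w (T.point y θ)| ∂discMeas :=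
    abs_integral_le_integral_abs
  calc _ ≤ 1 * ∫ θ, |w (T.point y θ)| ∂discMeas :=
        mul_le_mul h1 h2 (abs_nonneg _) zero_le_one
    _ = _ := one_mul _

/-- Local control of the increments of the reflection. -/
lemma abs_reflection_sub_le {w : Plane → ℝ} (hw : Continuous w) {B : ℝ} (hB : ∀ x, ‖w x‖ ≤ B)
    {x y : Plane} {D : Plane → ℝ} (hD : Integrable D discMeas)
    (hle : ∀ θ, ‖θ‖ ≤ 1 → |w (T.point x θ) - w (T.point y θ)| ≤ D θ) :
    |T.reflection w x - T.reflection w y| ≤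
      ∫ θ, D θ ∂discMeas + ‖x - y‖ * ∫ θ, |w (T.point y θ)| ∂discMeas := by
  have hi := T.integrable_comp_point hw hB
  set χ : Plane → ℝ := fun y => max 0 (1 - infDist y Ω) with hχ
  have hχ0 : 0 ≤ χ x := le_max_left _ _
  have hχ1 : χ x ≤ 1 := max_le zero_le_one (by linarith [infDist_nonneg (x := x) (s := Ω)])
  have hχl : |χ x - χ y| ≤ ‖x - y‖ := by
    have h := (lipschitz_infDist_pt Ω).dist_le_mul x y
    rw [NNReal.coe_one, one_mul, Real.dist_eq, dist_eq_norm] at h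
    have h2 := abs_max_sub_max_le_max 0 (1 - infDist x Ω) 0 (1 - infDist y Ω)
    rw [sub_self, abs_zero, sub_sub_sub_cancel_left, abs_sub_comm (infDist y Ω)] at h2
    exact h2.trans (max_le (norm_nonneg _) h)
  -- Product rule for increments, with the cutoff taken at `x` in one term and its own increment in
  -- the other.
  have e : T.reflection w x - T.reflection w y =
      χ x * ∫ θ, (w (T.point x θ) - w (T.point y θ)) ∂discMeas +
        (χ x - χ y) * ∫ θ, w (T.point y θ) ∂discMeas := by
    rw [integral_sub (hi x) (hi y), reflection, reflection]; ring
  rw [e]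
  refine (abs_add_le _ _).trans (add_le_add ?_ ?_)
  · rw [abs_mul, abs_of_nonneg hχ0]
    have h1 : |∫ θ, (w (T.point x θ) - w (T.point y θ)) ∂discMeas| ≤ ∫ θ, D θ ∂discMeas := by
      rw [← Real.norm_eq_abs]
      refine norm_integral_le_of_norm_le hD ?_
      filter_upwards [ae_discMeas_norm_le] with θ hθ
      exact hle θ hθ
    calc _ ≤ 1 * ∫ θ, D θ ∂discMeas := mul_le_mul hχ1 h1 (abs_nonneg _) zero_le_one
      _ = _ := one_mul _
  · rw [abs_mul]
    exact mul_le_mul hχl abs_integral_le_integral_abs (abs_nonneg _) (norm_nonneg _)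

/-- Gives differentiability almost everywhere (Rademacher) and integration by parts for the
reflection. -/
lemma exists_lipschitzWith_reflection {w : Plane → ℝ} (hw : ContDiff ℝ 1 w)
    (hc : HasCompactSupport w) : ∃ C, LipschitzWith C (T.reflection w) := by
  obtain ⟨B, hB⟩ := hc.exists_bound_of_continuous hw.continuous
  obtain ⟨C, hC⟩ := hw.lipschitzWith_of_hasCompactSupport hc one_ne_zero
  have hB0 : 0 ≤ B := (norm_nonneg _).trans (hB 0)
  refine ⟨(C * (T.lip + T.c) + B).toNNReal, LipschitzWith.of_dist_le_mul fun x y => ?_⟩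
  have hcp := T.c_pos
  rw [Real.coe_toNNReal _ (by positivity), Real.dist_eq, dist_eq_norm]
  refine (T.abs_reflection_sub_le hw.continuous hB (x := x) (y := y)
    (D := fun _ => C * ((T.lip + T.c) * ‖x - y‖)) (integrable_const _) fun θ hθ => ?_).trans ?_
  · have := hC.dist_le_mul (T.point x θ) (T.point y θ)
    rw [Real.dist_eq, dist_eq_norm] at this
    exact this.trans (mul_le_mul_of_nonneg_left (T.dist_point_le hθ x y) C.2)
  · have h1 : ∫ θ, |w (T.point y θ)| ∂discMeas ≤ B := by
      have := integral_mono (μ := discMeas) (T.integrable_comp_point hw.continuous hB y).abs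
        (integrable_const B) (fun _ => hB _)
      simpa using this
    simp only [integral_const, probReal_univ, smul_eq_mul, one_mul]
    nlinarith [norm_nonneg (x - y)]

/-- The derivative is bounded through increments, so `T` and the distance function are never
differentiated. The constant `lip + c` is the Lipschitz constant of `y ↦ T.point y θ` for `‖θ‖ ≤ 1`;
the last integral comes from the cutoff. -/
lemma norm_fderiv_reflection_le {w : Plane → ℝ} (hw : ContDiff ℝ 2 w)
    (hc : HasCompactSupport w) {y : Plane} (hd : DifferentiableAt ℝ (T.reflection w) y) :
    ‖fderiv ℝ (T.reflection w) y‖ ≤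
      (T.lip + T.c) * ∫ θ, ‖fderiv ℝ w (T.point y θ)‖ ∂discMeas +
        ∫ θ, |w (T.point y θ)| ∂discMeas := by
  have hw1 : ContDiff ℝ 1 w := hw.of_le (by norm_num)
  have hw' : Continuous (fderiv ℝ w) := hw1.continuous_fderiv one_ne_zero
  obtain ⟨B, hB⟩ := hc.exists_bound_of_continuous hw.continuous
  obtain ⟨B', hB'⟩ := (hc.fderiv ℝ).exists_bound_of_continuous hw'
  obtain ⟨K, hK⟩ := (hw.fderiv_right (m := 1) (by norm_num)).lipschitzWith_of_hasCompactSupport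
    (hc.fderiv ℝ) one_ne_zero
  have hcp := T.c_pos
  set L : ℝ := T.lip + T.c with hL
  have hL0 : 0 ≤ L := by positivity
  have hi := T.integrable_comp_point hw'.norm (B := B') (fun x => by rw [norm_norm]; exact hB' x) y
  set b := ∫ θ, ‖fderiv ℝ w (T.point y θ)‖ ∂discMeas with hb
  set a := ∫ θ, |w (T.point y θ)| ∂discMeas with ha
  have ha0 : 0 ≤ a := integral_nonneg fun _ => abs_nonneg _
  have hb0 : 0 ≤ b := integral_nonneg fun _ => norm_nonneg _
  refine le_of_forall_pos_le_add fun δ hδ => ?_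
  refine hd.hasFDerivAt.le_of_lip' (by positivity) ?_
  -- Close to `y` the quadratic Taylor remainder is at most `δ ‖x - y‖`; this is why `w` is taken
  -- `C²`.
  have hsmall : ∀ᶠ x in 𝓝 y, K * L ^ 2 * ‖x - y‖ < δ := by
    have : Tendsto (fun x => K * L ^ 2 * ‖x - y‖) (𝓝 y) (𝓝 (K * L ^ 2 * ‖y - y‖)) :=
      Continuous.tendsto (by fun_prop) y
    rw [sub_self, norm_zero, mul_zero] at this
    exact this.eventually (gt_mem_nhds hδ)
  filter_upwards [hsmall] with x hx
  rw [Real.norm_eq_abs]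
  refine (T.abs_reflection_sub_le hw.continuous hB (x := x) (y := y)
    (D := fun θ => ‖fderiv ℝ w (T.point y θ)‖ * (L * ‖x - y‖) + K * (L * ‖x - y‖) ^ 2)
    ((hi.mul_const _).add (integrable_const _)) fun θ hθ => ?_).trans ?_
  · refine (abs_sub_le_of_lipschitzWith_fderiv hw1 hK _ _).trans ?_
    have := T.dist_point_le hθ x y
    gcongr
  · rw [integral_add (hi.mul_const _) (integrable_const _), integral_mul_const, integral_const]
    simp only [probReal_univ, smul_eq_mul, one_mul]
    have h2 : K * (L * ‖x - y‖) ^ 2 ≤ δ * ‖x - y‖ := by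
      have := mul_le_mul_of_nonneg_right hx.le (norm_nonneg (x - y))
      nlinarith
    linarith

end InwardMap

/-! ### Completeness and restriction -/

/-- The functional is the inner product with `ψ / γ`, which belongs to `L²_γ` because `ψ` has
compact support. -/
lemma exists_integral_mul_clm (Ω : Set Plane) {ψ : Plane → ℝ} (hψ : Continuous ψ)
    (hc : HasCompactSupport ψ) :
    ∃ ℓ : L2Gauss Ω →L[ℝ] ℝ, ∀ v : L2Gauss Ω, ℓ v = ∫ x in Ω, v x * ψ x := by
  have hψ' : Continuous (fun x => ψ x * (gaussWeight x)⁻¹) :=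
    hψ.mul (continuous_gaussWeight.inv₀ fun x => (gaussWeight_pos x).ne')
  have hψc : HasCompactSupport (fun x => ψ x * (gaussWeight x)⁻¹) := hc.mul_right
  have hL : MemLp (fun x => ψ x * (gaussWeight x)⁻¹) 2 (gaussMeas.restrict Ω) :=
    hψ'.memLp_of_hasCompactSupport hψc
  refine ⟨innerSL ℝ (hL.toLp _), fun v => ?_⟩
  rw [innerSL_apply_apply, L2.inner_def]
  have h1 : ∫ x, inner ℝ (hL.toLp _ x) (v x) ∂(gaussMeas.restrict Ω) =
      ∫ x, ψ x * (gaussWeight x)⁻¹ * v x ∂(gaussMeas.restrict Ω) := by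
    refine integral_congr_ae ?_
    filter_upwards [hL.coeFn_toLp] with x hx
    rw [hx, real_inner_eq_re_inner]
    simp [mul_comm]
  rw [h1]
  generalize (v : Plane → ℝ) = v'
  rw [gaussMeas_restrict, integral_withDensity_eq_integral_toReal_smul
    measurable_ofReal_gaussWeight (Eventually.of_forall fun x => ENNReal.ofReal_lt_top)]
  refine integral_congr_ae (Eventually.of_forall fun x => ?_)
  have := (gaussWeight_pos x).ne'
  simp only [ENNReal.toReal_ofReal (gaussWeight_pos x).le, smul_eq_mul]
  field_simp

/-- Each test function and index imposes an equation between continuous functionals. The resulting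
completeness is what the final approximation argument requires. -/
lemma isClosed_H1Gauss (Ω : Set Plane) :
    IsClosed (H1Gauss Ω : Set (WithLp 2 (L2Gauss Ω × L2GaussVec Ω))) := by
  have : (H1Gauss Ω : Set (WithLp 2 (L2Gauss Ω × L2GaussVec Ω))) =
      ⋂ (φ : Plane → ℝ) (_ : ContDiff ℝ ∞ φ) (_ : HasCompactSupport φ) (_ : tsupport φ ⊆ Ω)
        (i : Fin 2), {U | ∫ x in Ω, U.fst x * fderiv ℝ φ x (EuclideanSpace.single i 1) =
          - ∫ x in Ω, U.snd x i * φ x} := by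
    ext U
    simp only [mem_iInter]
    rfl
  rw [this]
  refine isClosed_iInter fun φ => isClosed_iInter fun hφ => isClosed_iInter fun hc =>
    isClosed_iInter fun _ => isClosed_iInter fun i => ?_
  obtain ⟨ℓ₁, h₁⟩ := exists_integral_mul_clm Ω
    (continuous_fderiv_test hφ (EuclideanSpace.single i 1)) (hc.fderiv_apply ℝ _)
  obtain ⟨ℓ₂, h₂⟩ := exists_integral_mul_clm Ω hφ.continuous hc
  have h₃ : ∀ g : L2GaussVec Ω, ∫ x in Ω, g x i * φ x =
      ℓ₂ ((EuclideanSpace.proj i : Plane →L[ℝ] ℝ).compLpL 2 (gaussMeas.restrict Ω) g) := by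
    intro g
    rw [h₂]
    refine integral_congr_ae ?_
    filter_upwards [(volume_restrict_ac_gaussMeas Ω).ae_le
      ((EuclideanSpace.proj i : Plane →L[ℝ] ℝ).coeFn_compLpL g)] with x hx
    rw [hx]
    rfl
  simp only [h₃, ← h₁]
  exact isClosed_eq (ℓ₁.continuous.comp (WithLp.fstL 2 ℝ (L2Gauss Ω) (L2GaussVec Ω)).continuous)
    ((ℓ₂.continuous.comp (ContinuousLinearMap.continuous _)).comp
      (WithLp.sndL 2 ℝ (L2Gauss Ω) (L2GaussVec Ω)).continuous).neg

instance (Ω : Set Plane) : CompleteSpace (H1Gauss Ω) :=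
  (isClosed_H1Gauss Ω).completeSpace_coe

lemma H1Gauss.ext_ae {Ω : Set Plane} {U V : H1Gauss Ω}
    (h1 : toL2 Ω U =ᵐ[gaussMeas.restrict Ω] toL2 Ω V)
    (h2 : grad Ω U =ᵐ[gaussMeas.restrict Ω] grad Ω V) : U = V := by
  have e1 : toL2 Ω (U - V) = 0 := by rw [map_sub, Lp.ext h1, sub_self]
  have e2 : grad Ω (U - V) = 0 := by rw [map_sub, Lp.ext h2, sub_self]
  have : ‖U - V‖ = 0 := by rw [H1Gauss.norm_eq, e1, e2]; simp
  exact sub_eq_zero.1 (norm_eq_zero.1 this)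

lemma IsWeakGradient.restrict {Ω : Set Plane} {u : Plane → ℝ}
    {g : Plane → Plane} (h : IsWeakGradient univ u g) : IsWeakGradient Ω u g := by
  intro φ hφ hc hs i
  have h' := h φ hφ hc (subset_univ _) i
  rw [setIntegral_univ, setIntegral_univ] at h'
  have hφ0 : ∀ x, x ∉ Ω → φ x = 0 := fun x hx =>
    image_eq_zero_of_notMem_tsupport fun h => hx (hs h)
  have hφ0' : ∀ x, x ∉ Ω → fderiv ℝ φ x = 0 := fun x hx =>
    image_eq_zero_of_notMem_tsupport fun h => hx (hs (tsupport_fderiv_subset ℝ h))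
  rwa [setIntegral_eq_integral_of_forall_compl_eq_zero fun x hx => by simp [hφ0' x hx],
    setIntegral_eq_integral_of_forall_compl_eq_zero fun x hx => by simp [hφ0 x hx]]

lemma H1Gauss.exists_restrict (Ω : Set Plane)
    (V : H1Gauss (univ : Set Plane)) :
    ∃ U : H1Gauss Ω, toL2 Ω U =ᵐ[gaussMeas.restrict Ω] toL2 univ V ∧
      grad Ω U =ᵐ[gaussMeas.restrict Ω] grad univ V := by
  have hle : gaussMeas.restrict Ω ≤ gaussMeas.restrict univ :=
    Measure.restrict_mono (subset_univ _) le_rfl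
  have h1 : MemLp (toL2 univ V) 2 (gaussMeas.restrict Ω) := (Lp.memLp _).mono_measure hle
  have h2 : MemLp (grad univ V) 2 (gaussMeas.restrict Ω) := (Lp.memLp _).mono_measure hle
  obtain ⟨U, hU1, hU2⟩ := H1Gauss.exists_of_isWeakGradient h1.toLp h2.toLp
    (((H1Gauss.isWeakGradient V).restrict).congr_ae h1.coeFn_toLp h2.coeFn_toLp)
  exact ⟨U, by rw [hU1]; exact h1.coeFn_toLp, by rw [hU2]; exact h2.coeFn_toLp⟩

/-- Restriction `H¹_γ(ℝ²) → H¹_γ(Ω)`. -/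
lemma H1Gauss.exists_restrictHom (Ω : Set Plane) :
    ∃ ρ : NormedAddGroupHom (H1Gauss (univ : Set Plane)) (H1Gauss Ω), ∀ V,
      toL2 Ω (ρ V) =ᵐ[gaussMeas.restrict Ω] toL2 univ V ∧
      grad Ω (ρ V) =ᵐ[gaussMeas.restrict Ω] grad univ V := by
  choose ρ h1 h2 using fun V => H1Gauss.exists_restrict Ω V
  have hle : gaussMeas.restrict Ω ≤ gaussMeas.restrict univ :=
    Measure.restrict_mono (subset_univ _) le_rfl
  -- The restriction was chosen pointwise; additivity follows since the almost everywhere classes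
  -- determine it.
  have hadd : ∀ V W, ρ (V + W) = ρ V + ρ W := by
    intro V W
    refine H1Gauss.ext_ae ?_ ?_
    · refine (h1 _).trans ?_
      rw [map_add, map_add]
      refine ((Lp.coeFn_add (_ : Lp _ 2 (gaussMeas.restrict univ)) _).filter_mono (ae_mono hle)).trans ?_
      exact ((h1 V).symm.add (h1 W).symm).trans (Lp.coeFn_add _ _).symm
    · refine (h2 _).trans ?_
      rw [map_add, map_add]
      refine ((Lp.coeFn_add (_ : Lp _ 2 (gaussMeas.restrict univ)) _).filter_mono (ae_mono hle)).trans ?_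
      exact ((h2 V).symm.add (h2 W).symm).trans (Lp.coeFn_add _ _).symm
  refine ⟨(AddMonoidHom.mk' ρ hadd).mkNormedAddGroupHom 1 fun V => ?_, fun V => ⟨h1 V, h2 V⟩⟩
  change ‖ρ V‖ ≤ 1 * ‖V‖
  rw [one_mul, ← pow_le_pow_iff_left₀ (norm_nonneg _) (norm_nonneg _) two_ne_zero,
    ← ENNReal.ofReal_le_ofReal_iff (by positivity)]
  set G : Plane → Plane →L[ℝ] ℝ := fun x => InnerProductSpace.toDual ℝ Plane (grad univ V x)
  have hG : ∀ x, dualVec (G x) = grad univ V x := fun x => by simp [G, dualVec]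
  rw [H1Gauss.ofReal_norm_sq (u := toL2 univ V) (G := G) (h1 V) (by simpa only [hG] using h2 V),
    H1Gauss.ofReal_norm_sq (u := toL2 univ V) (G := G) EventuallyEq.rfl
      (by simp only [hG]; exact EventuallyEq.rfl)]
  exact lintegral_mono_set (subset_univ _)

/-! ### Conjugation by the square root of the weight, and the extension -/

/-- The function `exp (s |x|²)`. -/
def expNormSq (s : ℝ) (x : Plane) : ℝ := Real.exp (s * ‖x‖ ^ 2)

lemma contDiff_expNormSq (s : ℝ) : ContDiff ℝ ∞ (expNormSq s) :=
  (contDiff_const.mul (contDiff_norm_sq ℝ)).exp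

lemma expNormSq_pos (s : ℝ) (x : Plane) : 0 < expNormSq s x := Real.exp_pos _

lemma expNormSq_mul_expNormSq (s t : ℝ) (x : Plane) :
    expNormSq s x * expNormSq t x = expNormSq (s + t) x := by
  rw [expNormSq, expNormSq, expNormSq, ← Real.exp_add, add_mul]

lemma expNormSq_zero (x : Plane) : expNormSq 0 x = 1 := by simp [expNormSq]

lemma gaussWeight_eq_expNormSq (x : Plane) :
    gaussWeight x = expNormSq (-(1 / 4)) x * expNormSq (-(1 / 4)) x := by
  rw [expNormSq_mul_expNormSq, expNormSq, gaussWeight]; congr 1; ring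

lemma hasFDerivAt_expNormSq (s : ℝ) (x : Plane) :
    HasFDerivAt (expNormSq s) ((2 * s * expNormSq s x) • innerSL ℝ x) x := by
  have h1 : HasFDerivAt (fun x : Plane => s * ‖x‖ ^ 2) (s • (2 • innerSL ℝ x)) x :=
    (hasStrictFDerivAt_norm_sq x).hasFDerivAt.const_mul s
  refine h1.exp.congr_fderiv ?_
  ext v
  simp [expNormSq]
  ring

lemma fderiv_mul_expNormSq {f : Plane → ℝ} (s : ℝ) {x : Plane} (hf : DifferentiableAt ℝ f x) :
    fderiv ℝ (fun y => f y * expNormSq s y) x =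
      expNormSq s x • (fderiv ℝ f x + (2 * s * f x) • innerSL ℝ x) := by
  have h : HasFDerivAt (fun y => f y * expNormSq s y) _ x :=
    hf.hasFDerivAt.mul (hasFDerivAt_expNormSq s x)
  rw [h.fderiv]
  module

/-- The energy density of the rescaled function `w = f γ^{1/2}`. -/
def rescaledDensity (w : Plane → ℝ) (x : Plane) : ℝ :=
  (1 + ‖x‖ ^ 2) * w x ^ 2 + ‖fderiv ℝ w x‖ ^ 2

lemma rescaledDensity_nonneg (w : Plane → ℝ) (x : Plane) : 0 ≤ rescaledDensity w x := by
  unfold rescaledDensity; positivity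

/-- Here `expNormSq (-(1 / 4))` is `γ^{1/2}`, and `∇(f γ^{1/2}) = γ^{1/2} (∇f - f x / 2)`. The
second term is paid for by the moment bound. -/
lemma rescaledDensity_le {f : Plane → ℝ} {x : Plane} (hf : DifferentiableAt ℝ f x) :
    rescaledDensity (fun y => f y * expNormSq (-(1 / 4)) y) x ≤
      2 * ((f x ^ 2 + ‖fderiv ℝ f x‖ ^ 2) * gaussWeight x) +
        2 * (‖x‖ ^ 2 * f x ^ 2 * gaussWeight x) := by
  rw [rescaledDensity, fderiv_mul_expNormSq _ hf, gaussWeight_eq_expNormSq, norm_smul,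
    Real.norm_of_nonneg (expNormSq_pos _ _).le]
  set σ := expNormSq (-(1 / 4)) x
  have h1 : ‖fderiv ℝ f x + (2 * -(1 / 4) * f x) • innerSL ℝ x‖ ≤
      ‖fderiv ℝ f x‖ + 1 / 2 * (|f x| * ‖x‖) := by
    refine (norm_add_le _ _).trans ?_
    rw [norm_smul, innerSL_apply_norm, Real.norm_eq_abs, abs_mul]
    norm_num
    rw [mul_assoc]
  have h2 := pow_le_pow_left₀ (norm_nonneg _) h1 2
  have h3 : (‖fderiv ℝ f x‖ + 1 / 2 * (|f x| * ‖x‖)) ^ 2 ≤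
      2 * ‖fderiv ℝ f x‖ ^ 2 + 1 / 2 * (‖x‖ ^ 2 * f x ^ 2) := by
    rw [← sq_abs (f x)]
    nlinarith [sq_nonneg (‖fderiv ℝ f x‖ - 1 / 2 * (|f x| * ‖x‖))]
  have h4 := mul_le_mul_of_nonneg_left (h2.trans h3) (sq_nonneg σ)
  have h5 : 0 ≤ σ ^ 2 * (‖x‖ ^ 2 * f x ^ 2) := by positivity
  have h6 : 0 ≤ σ ^ 2 * f x ^ 2 := by positivity
  rw [mul_pow]
  linarith

namespace InwardMap

variable {Ω : Set Plane} (T : InwardMap Ω)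

/-- The left side is the Gaussian energy density of `W γ^{-1/2}`, with `W` the reflection. Jensen
handles the averages of `|w|` and `‖∇w‖`, and the polynomial weight at `y` is transferred to the
sampled points. -/
lemma reflection_energy_le {w : Plane → ℝ} (hw : ContDiff ℝ 2 w) (hc : HasCompactSupport w)
    {y : Plane} (hy : infDist y Ω ≤ 1) (hd : DifferentiableAt ℝ (T.reflection w) y) :
    T.reflection w y ^ 2 +
        ‖fderiv ℝ (T.reflection w) y + (1 / 2 * T.reflection w y) • innerSL ℝ y‖ ^ 2 ≤
      (6 + 4 * (T.lip + T.c) ^ 2 + (T.M + T.c) ^ 2) *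
        ∫ θ, rescaledDensity w (T.point y θ) ∂discMeas := by
  have hw1 : ContDiff ℝ 1 w := hw.of_le (by norm_num)
  have hwc := hw.continuous
  have hw' : Continuous (fderiv ℝ w) := hw1.continuous_fderiv one_ne_zero
  have hbdd : ∀ g : Plane → ℝ, Continuous g → (∀ x, x ∉ tsupport w → g x = 0) →
      Integrable (fun θ => g (T.point y θ)) discMeas := by
    intro g hg hg0
    obtain ⟨B, hB⟩ := (HasCompactSupport.intro hc hg0).exists_bound_of_continuous hg
    exact T.integrable_comp_point hg hB y
  have hz : ∀ x, x ∉ tsupport w → w x = 0 ∧ fderiv ℝ w x = 0 := fun x hx =>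
    ⟨image_eq_zero_of_notMem_tsupport hx,
      image_eq_zero_of_notMem_tsupport fun h => hx (tsupport_fderiv_subset ℝ h)⟩
  have i1 := hbdd (fun x => |w x| ^ 2) (by fun_prop) fun x hx => by simp [hz x hx]
  have i2 := hbdd (fun x => ‖fderiv ℝ w x‖ ^ 2) (by fun_prop) fun x hx => by simp [hz x hx]
  have i3 := hbdd (fun x => ‖x‖ ^ 2 * w x ^ 2) (by fun_prop) fun x hx => by simp [hz x hx]
  set a := ∫ θ, |w (T.point y θ)| ∂discMeas with ha
  set b := ∫ θ, ‖fderiv ℝ w (T.point y θ)‖ ∂discMeas with hb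
  set A := ∫ θ, |w (T.point y θ)| ^ 2 ∂discMeas with hA
  set B := ∫ θ, ‖fderiv ℝ w (T.point y θ)‖ ^ 2 ∂discMeas with hB
  set P := ∫ θ, ‖T.point y θ‖ ^ 2 * w (T.point y θ) ^ 2 ∂discMeas with hP
  have hpc := T.continuous_point y
  have ha2 : a ^ 2 ≤ A := sq_integral_le_integral_sq _
    (hwc.comp hpc).abs.aestronglyMeasurable i1
  have hb2 : b ^ 2 ≤ B := sq_integral_le_integral_sq _
    (hw'.comp hpc).norm.aestronglyMeasurable i2
  have ha0 : 0 ≤ a := integral_nonneg fun _ => abs_nonneg _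
  have hb0 : 0 ≤ b := integral_nonneg fun _ => norm_nonneg _
  have hP0 : 0 ≤ P := integral_nonneg fun _ => by positivity
  -- The transfer of the weight: `|y| ≤ |p| + (M + c)` at each sampled point `p`.
  have hyA : ‖y‖ ^ 2 * A ≤ 2 * P + 2 * (T.M + T.c) ^ 2 * A := by
    rw [hA, hP, ← integral_const_mul, ← integral_const_mul, ← integral_const_mul,
      ← integral_add (i3.const_mul _) (i1.const_mul _)]
    refine integral_mono_ae (i1.const_mul _) ((i3.const_mul _).add (i1.const_mul _)) ?_
    filter_upwards [ae_discMeas_norm_le] with θ hθ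
    have h1 := T.norm_point_sub_le hθ hy
    have h2 : ‖y‖ ≤ ‖T.point y θ‖ + (T.M + T.c) := by
      have := norm_sub_le (T.point y θ) (T.point y θ - y)
      rw [sub_sub_cancel] at this
      linarith
    have h3 := pow_le_pow_left₀ (norm_nonneg _) h2 2
    have h4 : ‖y‖ ^ 2 ≤ 2 * ‖T.point y θ‖ ^ 2 + 2 * (T.M + T.c) ^ 2 := by
      nlinarith [sq_nonneg (‖T.point y θ‖ - (T.M + T.c))]
    simp only [sq_abs]
    nlinarith [sq_nonneg (w (T.point y θ))]
  have hI : ∫ θ, rescaledDensity w (T.point y θ) ∂discMeas = A + P + B := by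
    have i13 : Integrable (fun θ => |w (T.point y θ)| ^ 2 + ‖T.point y θ‖ ^ 2 * w (T.point y θ) ^ 2)
        discMeas := i1.add i3
    rw [hA, hP, hB, ← integral_add i1 i3, ← integral_add i13 i2]
    refine integral_congr_ae (Eventually.of_forall fun θ => ?_)
    simp only [rescaledDensity, sq_abs]
    ring
  rw [hI]
  have hW := T.abs_reflection_le (w := w) y
  have hW' := T.norm_fderiv_reflection_le hw hc hd
  rw [← ha] at hW hW'
  rw [← hb] at hW'
  set W := T.reflection w y with hWdef
  set L : ℝ := T.lip + T.c with hL
  have hcp := T.c_pos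
  have hL0 : 0 ≤ L := by positivity
  have hW2 : W ^ 2 ≤ A := by
    rw [← sq_abs]; exact (pow_le_pow_left₀ (abs_nonneg _) hW 2).trans ha2
  have h1 : ‖fderiv ℝ (T.reflection w) y + (1 / 2 * W) • innerSL ℝ y‖ ≤
      (L * b + a) + 1 / 2 * (|W| * ‖y‖) := by
    refine (norm_add_le _ _).trans (add_le_add hW' (le_of_eq ?_))
    rw [norm_smul, innerSL_apply_norm, Real.norm_eq_abs, abs_mul, abs_of_pos (by norm_num)]
    ring
  have h2 := pow_le_pow_left₀ (norm_nonneg _) h1 2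
  have h3 : ((L * b + a) + 1 / 2 * (|W| * ‖y‖)) ^ 2 ≤
      4 * L ^ 2 * b ^ 2 + 4 * a ^ 2 + 1 / 2 * (‖y‖ ^ 2 * W ^ 2) := by
    rw [← sq_abs W]
    nlinarith [sq_nonneg ((L * b + a) - 1 / 2 * (|W| * ‖y‖)), sq_nonneg (L * b - a)]
  have h4 : ‖y‖ ^ 2 * W ^ 2 ≤ ‖y‖ ^ 2 * A := by gcongr
  have h5 : L ^ 2 * b ^ 2 ≤ L ^ 2 * B := by gcongr
  have hA0 : 0 ≤ A := (sq_nonneg _).trans ha2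
  have hB0 : 0 ≤ B := (sq_nonneg _).trans hb2
  nlinarith [mul_nonneg (sq_nonneg L) hA0, mul_nonneg (sq_nonneg L) hP0,
    mul_nonneg (sq_nonneg (T.M + T.c)) hB0, mul_nonneg (sq_nonneg (T.M + T.c)) hP0]

/-- The pointwise bound holds almost everywhere by Rademacher's theorem, and the averages are
integrated by `lintegral_average_le`. Normalising the disc measure produces the factor `v₁⁻¹`. -/
lemma exists_lintegral_reflection_le (hconv : Convex ℝ Ω) (hne : Ω.Nonempty) :
    ∃ C : ℝ≥0∞, C ≠ ⊤ ∧ ∀ w : Plane → ℝ, ContDiff ℝ 2 w → HasCompactSupport w →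
      ∫⁻ y, ENNReal.ofReal (T.reflection w y ^ 2 +
        ‖fderiv ℝ (T.reflection w) y + (1 / 2 * T.reflection w y) • innerSL ℝ y‖ ^ 2) ≤
      C * ∫⁻ x in Ω, ENNReal.ofReal (rescaledDensity w x) := by
  set K : ℝ := 6 + 4 * (T.lip + T.c) ^ 2 + (T.M + T.c) ^ 2 with hK
  set v₁ := volume (ball (0 : Plane) 1) with hv₁
  have hv0 : v₁ ≠ 0 := (measure_ball_pos _ _ one_pos).ne'
  have hvt : v₁ ≠ ⊤ := measure_ball_lt_top.ne
  have hmN : MeasurableSet {y : Plane | infDist y Ω ≤ 1} :=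
    (isClosed_le (continuous_infDist_pt Ω) continuous_const).measurableSet
  refine ⟨ENNReal.ofReal K * v₁⁻¹ *
    ((1 + ENNReal.ofReal (((T.c + T.M) / T.c) ^ 6)) * v₁), ?_, fun w hw hc => ?_⟩
  · exact ENNReal.mul_ne_top (ENNReal.mul_ne_top ENNReal.ofReal_ne_top (ENNReal.inv_ne_top.2 hv0))
      (ENNReal.mul_ne_top (ENNReal.add_ne_top.2 ⟨ENNReal.one_ne_top, ENNReal.ofReal_ne_top⟩) hvt)
  have hw1 : ContDiff ℝ 1 w := hw.of_le (by norm_num)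
  have hdc : Continuous (rescaledDensity w) := by
    have hwc := hw.continuous
    have hw' : Continuous (fderiv ℝ w) := hw1.continuous_fderiv one_ne_zero
    unfold rescaledDensity
    fun_prop
  obtain ⟨B, hB⟩ := (HasCompactSupport.intro (f := rescaledDensity w) hc fun x hx => by
    have h1 : w x = 0 := image_eq_zero_of_notMem_tsupport hx
    have h2 : fderiv ℝ w x = 0 :=
      image_eq_zero_of_notMem_tsupport fun h => hx (tsupport_fderiv_subset ℝ h)
    simp [rescaledDensity, h1, h2]).exists_bound_of_continuous hdc
  obtain ⟨C, hC⟩ := T.exists_lipschitzWith_reflection hw1 hc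
  have hout : ∀ y ∈ {y : Plane | infDist y Ω ≤ 1}ᶜ,
      ENNReal.ofReal (T.reflection w y ^ 2 +
        ‖fderiv ℝ (T.reflection w) y + (1 / 2 * T.reflection w y) • innerSL ℝ y‖ ^ 2) = 0 := by
    intro y hy
    have hy' : 1 < infDist y Ω := not_le.1 hy
    -- The set `d > 1` is open, so the derivative vanishes there along with the function.
    have h0 : T.reflection w =ᶠ[𝓝 y] fun _ => 0 := by
      filter_upwards [(isOpen_lt continuous_const (continuous_infDist_pt Ω)).mem_nhds hy']
        with z hz
      exact T.reflection_eq_zero w (le_of_lt hz)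
    rw [h0.fderiv_eq, h0.self_of_nhds]
    simp
  have hdm : Measurable fun x => ENNReal.ofReal (rescaledDensity w x) :=
    hdc.measurable.ennreal_ofReal
  rw [← lintegral_add_compl _ hmN, setLIntegral_eq_zero hmN.compl hout, add_zero]
  calc _ ≤ ∫⁻ y in {y : Plane | infDist y Ω ≤ 1}, ENNReal.ofReal K * (v₁⁻¹ *
        ∫⁻ θ in ball (0 : Plane) 1, ENNReal.ofReal
          (rescaledDensity w (T.toFun y + (T.c * infDist y Ω) • θ))) := by
        refine lintegral_mono_ae ((ae_restrict_iff' hmN).2 ?_)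
        filter_upwards [hC.ae_differentiableAt] with y hyd hy
        have hpt : ∀ θ, T.point y θ = T.toFun y + (T.c * infDist y Ω) • θ := fun θ => by
          rw [point, min_eq_left hy]
        refine (ENNReal.ofReal_le_ofReal (T.reflection_energy_le hw hc hy hyd)).trans ?_
        rw [ENNReal.ofReal_mul (by positivity), ofReal_integral_eq_lintegral_ofReal
          (T.integrable_comp_point hdc hB y)
          (Eventually.of_forall fun θ => rescaledDensity_nonneg w _)]
        simp only [hpt]
        rw [show discMeas = v₁⁻¹ • volume.restrict (ball 0 1) from rfl, lintegral_smul_measure, smul_eq_mul]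
    _ ≤ _ := by
        rw [lintegral_const_mul' _ _ ENNReal.ofReal_ne_top,
          lintegral_const_mul' _ _ (ENNReal.inv_ne_top.2 hv0), ← mul_assoc, mul_assoc _ (_ * v₁)]
        refine mul_le_mul_right ?_ _
        exact T.lintegral_average_le hconv hne hdm

/-- The weak derivative of the extension. -/
lemma isWeakGradient_reflection {w : Plane → ℝ} (hw : ContDiff ℝ 1 w) (hc : HasCompactSupport w) :
    IsWeakGradient univ (fun y => T.reflection w y * expNormSq (1 / 4) y) fun y =>
      dualVec (expNormSq (1 / 4) y •
        (fderiv ℝ (T.reflection w) y + (1 / 2 * T.reflection w y) • innerSL ℝ y)) := by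
  obtain ⟨C, hC⟩ := T.exists_lipschitzWith_reflection hw hc
  intro φ hφ hφc _ i
  set e : Plane := EuclideanSpace.single i 1 with he
  set W := T.reflection w with hW
  set ψ : Plane → ℝ := fun y => φ y * expNormSq (1 / 4) y with hψ
  have hψs : ContDiff ℝ ∞ ψ := hφ.mul (contDiff_expNormSq _)
  have hψc : HasCompactSupport ψ := hφc.mul_right
  have hψ1 : ContDiff ℝ 1 ψ := hψs.of_le (by simp)
  obtain ⟨D, hD⟩ := hψ1.lipschitzWith_of_hasCompactSupport hψc one_ne_zero
  -- The factor `γ^{-1/2}` is moved onto the test function, leaving integration by parts between two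
  -- Lipschitz functions, one of them compactly supported.
  have hparts := LipschitzWith.integral_lineDeriv_mul_eq (μ := volume) hC hD hψc e
  have hWc : Continuous W := hC.continuous
  have hdiff : ∀ᵐ y, DifferentiableAt ℝ W y := hC.ae_differentiableAt
  have h1 : ∫ y, lineDeriv ℝ W y e * ψ y = ∫ y, fderiv ℝ W y e * ψ y := by
    refine integral_congr_ae ?_
    filter_upwards [hdiff] with y hy
    rw [hy.lineDeriv_eq_fderiv]
  have h2 : ∀ y, lineDeriv ℝ ψ y (-e) = -(expNormSq (1 / 4) y * fderiv ℝ φ y e) -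
      1 / 2 * φ y * expNormSq (1 / 4) y * inner ℝ y e := by
    intro y
    rw [(hψs.differentiable (by simp) y).lineDeriv_eq_fderiv, hψ,
      fderiv_mul_expNormSq _ (hφ.differentiable (by simp) y)]
    simp
    ring
  simp only [h2] at hparts
  rw [h1] at hparts
  have hE := (contDiff_expNormSq (1 / 4)).continuous
  have hφ0 := hφ.continuous
  have hφ' := continuous_fderiv_test hφ e
  have j1 : Integrable fun y => W y * expNormSq (1 / 4) y * fderiv ℝ φ y e :=
    ((hWc.mul hE).mul hφ').integrable_of_hasCompactSupport (hφc.fderiv_apply ℝ _).mul_left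
  have j2 : Integrable fun y => 1 / 2 * W y * inner ℝ y e * ψ y :=
    Continuous.integrable_of_hasCompactSupport (by have := hψs.continuous; fun_prop) hψc.mul_left
  have j3 : Integrable fun y => fderiv ℝ W y e * ψ y := by
    refine (hψs.continuous.integrable_of_hasCompactSupport hψc).bdd_mul (c := C * ‖e‖)
      ((measurable_fderiv_apply_const ℝ W e).aestronglyMeasurable)
      (Eventually.of_forall fun y => ?_)
    exact ((fderiv ℝ W y).le_opNorm e).trans
      (mul_le_mul_of_nonneg_right (norm_fderiv_le_of_lipschitz ℝ hC) (norm_nonneg _))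
  rw [setIntegral_univ, setIntegral_univ]
  simp only [dualVec_apply, ← he]
  have e1 : ∫ y, (expNormSq (1 / 4) y • (fderiv ℝ W y + (1 / 2 * W y) • innerSL ℝ y)) e * φ y =
      (∫ y, fderiv ℝ W y e * ψ y) + ∫ y, 1 / 2 * W y * inner ℝ y e * ψ y := by
    rw [← integral_add j3 j2]
    refine integral_congr_ae (Eventually.of_forall fun y => ?_)
    simp [hψ]
    ring
  have e2 : ∫ y, (-(expNormSq (1 / 4) y * fderiv ℝ φ y e) -
      1 / 2 * φ y * expNormSq (1 / 4) y * inner ℝ y e) * W y =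
      -(∫ y, W y * expNormSq (1 / 4) y * fderiv ℝ φ y e) -
        ∫ y, 1 / 2 * W y * inner ℝ y e * ψ y := by
    have j1' : Integrable fun y => -(W y * expNormSq (1 / 4) y * fderiv ℝ φ y e) := j1.neg
    rw [← integral_neg, ← integral_sub j1' j2]
    refine integral_congr_ae (Eventually.of_forall fun y => ?_)
    simp [hψ]
    ring
  rw [e2] at hparts
  rw [e1, hparts]
  ring

end InwardMap

/-- The rescaled density of `f γ^{1/2}` is controlled by the Gaussian energy of `f`. -/
lemma lintegral_rescaledDensity_le {Ω : Set Plane} (hm : MeasurableSet Ω)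
    (hconv : Convex ℝ Ω) {a : Plane} (ha : a ∈ Ω) {f : Plane → ℝ} (hf : ContDiff ℝ 1 f)
    (hc : HasCompactSupport f) :
    ∫⁻ x in Ω, ENNReal.ofReal (rescaledDensity (fun y => f y * expNormSq (-(1 / 4)) y) x) ≤
      ENNReal.ofReal (2 + 2 * (32 + 3 * ‖a‖ ^ 2)) * gaussEnergy Ω f (fderiv ℝ f) := by
  have hfc := hf.continuous
  have hf' : Continuous (fderiv ℝ f) := hf.continuous_fderiv one_ne_zero
  have hγ := continuous_gaussWeight
  have hp : ∀ x, 0 ≤ gaussWeight x := fun x => (gaussWeight_pos x).le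
  calc _ ≤ ∫⁻ x in Ω, (2 * ENNReal.ofReal ((f x ^ 2 + ‖fderiv ℝ f x‖ ^ 2) * gaussWeight x) +
        2 * ENNReal.ofReal (‖x‖ ^ 2 * f x ^ 2 * gaussWeight x)) := by
        refine lintegral_mono fun x => ?_
        refine (ENNReal.ofReal_le_ofReal (rescaledDensity_le
          (hf.differentiable one_ne_zero x))).trans_eq ?_
        have := hp x
        rw [ENNReal.ofReal_add (by positivity) (by positivity), ENNReal.ofReal_mul zero_le_two,
          ENNReal.ofReal_mul (p := 2) zero_le_two, ENNReal.ofReal_ofNat]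
    _ = 2 * gaussEnergy Ω f (fderiv ℝ f) +
        2 * ∫⁻ x in Ω, ENNReal.ofReal (‖x‖ ^ 2 * f x ^ 2 * gaussWeight x) := by
        rw [lintegral_add_left (by fun_prop), lintegral_const_mul' _ _ (by simp),
          lintegral_const_mul' _ _ (by simp)]
        rfl
    _ ≤ 2 * gaussEnergy Ω f (fderiv ℝ f) +
        2 * (ENNReal.ofReal (32 + 3 * ‖a‖ ^ 2) * gaussEnergy Ω f (fderiv ℝ f)) := by
        gcongr
        exact lintegral_norm_sq_mul_le_gaussEnergy hm hconv ha hf hc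
    _ = _ := by
        rw [ENNReal.ofReal_add zero_le_two (by positivity), ENNReal.ofReal_mul zero_le_two,
          ENNReal.ofReal_ofNat]
        ring

/-- The square of `γ^{-1/2}` cancels the weight exactly. -/
lemma InwardMap.gaussEnergy_reflection {Ω : Set Plane} (T : InwardMap Ω) (w : Plane → ℝ) :
    gaussEnergy univ (fun y => T.reflection w y * expNormSq (1 / 4) y) (fun y =>
      expNormSq (1 / 4) y •
        (fderiv ℝ (T.reflection w) y + (1 / 2 * T.reflection w y) • innerSL ℝ y)) =
      ∫⁻ y, ENNReal.ofReal (T.reflection w y ^ 2 +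
        ‖fderiv ℝ (T.reflection w) y + (1 / 2 * T.reflection w y) • innerSL ℝ y‖ ^ 2) := by
  rw [gaussEnergy, Measure.restrict_univ]
  refine lintegral_congr fun y => ?_
  have h : expNormSq (1 / 4) y * expNormSq (-(1 / 4)) y = 1 := by
    rw [expNormSq_mul_expNormSq, add_neg_cancel, expNormSq_zero]
  rw [norm_smul, Real.norm_of_nonneg (expNormSq_pos _ _).le, gaussWeight_eq_expNormSq]
  congr 1
  linear_combination (T.reflection w y ^ 2 +
    ‖fderiv ℝ (T.reflection w) y + (1 / 2 * T.reflection w y) • innerSL ℝ y‖ ^ 2) *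
      (expNormSq (1 / 4) y * expNormSq (-(1 / 4)) y + 1) * h

/-- Smooth elements of `H¹_γ(Ω)` extend to the plane with control of the norm. -/
lemma exists_extension_of_isSmoothRep {Ω : Set Plane} (hΩ : IsOpen Ω) (hconv : Convex ℝ Ω)
    (hne : Ω.Nonempty) :
    ∃ C : ℝ, 0 < C ∧ ∀ U : H1Gauss Ω, (∃ f, IsSmoothRep Ω U f) →
      ∃ V : H1Gauss (univ : Set Plane),
        H1Gauss.toL2 univ V =ᵐ[gaussMeas.restrict Ω] H1Gauss.toL2 Ω U ∧ ‖V‖ ≤ C * ‖U‖ := by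
  obtain ⟨T⟩ := nonempty_inwardMap hΩ hconv hne
  obtain ⟨a, ha⟩ := hne
  obtain ⟨C, hCt, hC⟩ := T.exists_lintegral_reflection_le hconv ⟨a, ha⟩
  set D : ℝ := C.toReal * (2 + 2 * (32 + 3 * ‖a‖ ^ 2)) with hD
  have hD0 : 0 ≤ D := by positivity
  -- The norm bound holds with `√D`; adding `1` secures positivity even if `D = 0`.
  refine ⟨√D + 1, by positivity, ?_⟩
  rintro U ⟨f, hf, hfc, hU, hU'⟩
  have hf1 : ContDiff ℝ 1 f := hf.of_le (by simp)
  set w : Plane → ℝ := fun y => f y * expNormSq (-(1 / 4)) y with hw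
  have hws : ContDiff ℝ ∞ w := hf.mul (contDiff_expNormSq _)
  have hwc : HasCompactSupport w := hfc.mul_right
  have hw1 : ContDiff ℝ 1 w := hws.of_le (by simp)
  have hw2 : ContDiff ℝ 2 w := hws.of_le (by norm_cast)
  obtain ⟨K, hK⟩ := T.exists_lipschitzWith_reflection hw1 hwc
  have hE := (contDiff_expNormSq (1 / 4)).continuous
  have hbound := (hC w hw2 hwc).trans (mul_le_mul_right
    (lintegral_rescaledDensity_le hΩ.measurableSet hconv ha hf1 hfc) C)
  rw [← T.gaussEnergy_reflection, ← H1Gauss.ofReal_norm_sq hU hU', ← ENNReal.ofReal_toReal hCt,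
    ← mul_assoc, ← ENNReal.ofReal_mul ENNReal.toReal_nonneg, ← hD,
    ← ENNReal.ofReal_mul hD0] at hbound
  have hFm : AEStronglyMeasurable (fun y => T.reflection w y * expNormSq (1 / 4) y)
      (volume.restrict univ) := (hK.continuous.mul hE).aestronglyMeasurable
  have hGm : AEStronglyMeasurable (fun y => expNormSq (1 / 4) y •
      (fderiv ℝ (T.reflection w) y + (1 / 2 * T.reflection w y) • innerSL ℝ y))
      (volume.restrict univ) :=
    (hE.measurable.smul ((measurable_fderiv ℝ (T.reflection w)).add
      ((hK.continuous.const_mul _).smul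
        (innerSL ℝ).continuous).measurable)).aestronglyMeasurable
  obtain ⟨V, hV, hV'⟩ := H1Gauss.exists_of_gaussEnergy_ne_top hFm hGm
    (hbound.trans_lt ENNReal.ofReal_lt_top).ne (T.isWeakGradient_reflection hw1 hwc)
  refine ⟨V, ?_, ?_⟩
  · filter_upwards [hU, ae_mono (Measure.restrict_mono_set gaussMeas (subset_univ Ω)) hV,
      (gaussMeas_restrict_ac Ω).ae_le (ae_restrict_mem hΩ.measurableSet)] with x h1 h2 hx
    rw [h1, h2, T.reflection_eq_self w hx, hw]
    simp only
    rw [mul_assoc, expNormSq_mul_expNormSq, neg_add_cancel, expNormSq_zero, mul_one]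
  · rw [← H1Gauss.ofReal_norm_sq hV hV', ENNReal.ofReal_le_ofReal_iff (by positivity)] at hbound
    refine (abs_le_of_sq_le_sq' (b := √D * ‖U‖) ?_ (by positivity)).2.trans ?_
    · rw [mul_pow, Real.sq_sqrt hD0]; exact hbound
    · gcongr
      linarith

/-- Restriction `ρ` is solvable with bound `C` on the dense subgroup. Summing successive
approximations in the complete space `H¹_γ(ℝ²)` solves it everywhere, at the cost of enlarging `C`
by the arbitrary amount `1`. Injectivity of `toL2` turns agreement of functions on `Ω` into the
equation `ρ V = U`. -/
theorem exists_extension {Ω : Set Plane} (hΩ : IsOpen Ω) (hconv : Convex ℝ Ω)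
    (hne : Ω.Nonempty) :
    ∃ C : ℝ, 0 < C ∧ ∀ u : H1Gauss Ω, ∃ v : H1Gauss (univ : Set Plane),
      H1Gauss.toL2 univ v =ᵐ[gaussMeas.restrict Ω] H1Gauss.toL2 Ω u ∧ ‖v‖ ≤ C * ‖u‖ := by
  obtain ⟨C, hC, hext⟩ := exists_extension_of_isSmoothRep hΩ hconv hne
  obtain ⟨ρ, hρ⟩ := H1Gauss.exists_restrictHom Ω
  have hsurj : ρ.SurjectiveOnWith (smoothSubgroup Ω) C := by
    intro U hU
    obtain ⟨V, hV, hVn⟩ := hext U hU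
    exact ⟨V, H1Gauss.toL2_injective hΩ (Lp.ext ((hρ V).1.trans hV)), hVn⟩
  have h := controlled_closure_of_complete hC one_pos hsurj
  refine ⟨C + 1, by positivity, fun u => ?_⟩
  obtain ⟨v, hv, hvn⟩ := h u (dense_smoothSubgroup hΩ hconv hne u)
  exact ⟨v, hv ▸ (hρ v).1.symm, hvn⟩

end

/-! ### Main theorem -/

theorem mainTheorem4 (Ω : Set Plane) (hΩ : IsOpen Ω) (hconv : Convex ℝ Ω) :
    (∃ C : ℝ, 0 < C ∧ ∀ u : H1Gauss Ω, ∃ v : H1Gauss (univ : Set Plane),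
      (∀ᵐ x ∂(volume : Measure Plane), x ∈ Ω →
        H1Gauss.toL2 univ v x = H1Gauss.toL2 Ω u x) ∧ ‖v‖ ≤ C * ‖u‖) ∧
    IsCompactOperator (H1Gauss.toL2 Ω) := by
  rcases Ω.eq_empty_or_nonempty with rfl | hne
  -- The empty set is a convex open set with no interior point to contract to, so it is treated
  -- apart: the zero extension works and `toL2 ∅` is zero.
  · refine ⟨⟨1, one_pos, fun u => ⟨0, by simp, ?_⟩⟩, ?_⟩
    · rw [norm_zero, one_mul]; exact norm_nonneg u
    · have h : H1Gauss.toL2 ∅ = 0 := by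
        ext1 u
        refine Lp.ext ?_
        exact (ae_restrict_iff' MeasurableSet.empty).2 (by simp)
      rw [h]
      exact isCompactOperator_zero
  · refine ⟨?_, isCompactOperator_toL2 hΩ hconv hne⟩
    obtain ⟨C, hC, hext⟩ := exists_extension hΩ hconv hne
    refine ⟨C, hC, fun u => ?_⟩
    obtain ⟨v, hv, hvn⟩ := hext u
    exact ⟨v, (ae_restrict_iff' hΩ.measurableSet).1 ((volume_restrict_ac_gaussMeas Ω).ae_le hv),
      hvn⟩
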